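/- Let $I_p<F_p$, $\widetilde T>0$, $0<\mu<1$, $\alpha>0$, $\beta\in\mathbb R$, $\gamma>0$ (for the Black--Scholes model $\alpha=\sigma^2/2$, $\beta=r_f-\sigma^2/2$, $\gamma=r_f$) and a tension parameter $\rho>0$ be given. Let $u$ solve the time-fractional Black--Scholes problem $${}_0^CD_t^\mu u=\alpha u_{xx}+\beta u_x-\gamma u+\psi\quad\text{on }(I_p,F_p)\times(0,\widetilde T),$$ $$u(x,0)=z(x),\qquad u(I_p,t)=H(t),\qquad u(F_p,t)=G(t),$$ where ${}_0^CD_t^\mu u(x,t)=\frac1{\Gamma(1-\mu)}\int_0^t(t-s)^{-\mu}\,\partial_su(x,s)\,ds$ is the Caputo derivative. Suppose that on the closed rectangle $[I_p,F_p]\times[0,\widetilde T]$ the derivatives $\partial_x^iu$ $(0\le i\le4)$, $\partial_t^iu$ $(0\le i\le2)$ and $\partial_x^i\psi$ $(0\le i\le2)$ exist (one-sided at end points) and are jointly continuous. For $N_x,N_t\ge1$ put $h=h_x=(F_p-I_p)/N_x$, $h_t=\widetilde T/N_t$, $x_m=I_p+mh$, $t_n=nh_t$, $s=\sinh(\rho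 h)$, $c=\cosh(\rho h)$, $d=\rho hc-s$, and let $Q_m$, $-1\le m\le N_x+1$, be the exponential B-splines: $Q_m(x)=B(|x-x_m|)$ with $$B(y)=\begin{cases}\tilde a+\tilde b\,y+\bar c\,e^{\rho y}+q\,e^{-\rho y},&0\le y\le h,\\[2pt] \tilde r\,(y-2h)-\frac{\tilde r}{\rho}\sinh(\rho(y-2h)),&h\le y\le 2h,\\[2pt] 0,&y>2h,\end{cases}$$ $$\tilde r=\frac{\rho}{2d},\quad \tilde a=\frac{\rho hc}{d},\quad \tilde b=\frac\rho2\cdot\frac{c(c-1)+s^2}{d(1-c)},$$ $$\bar c=\frac{e^{-\rho h}(1-c)+s(e^{-\rho h}-1)}{4d(1-c)},\quad q=\frac{e^{\rho h}(c-1)+s(e^{\rho h}-1)}{4d(1-c)}.$$ Put $\eta=\frac{s-\rho h}{2d}$, $\kappa=\frac{\rho(c-1)}{2d}$, $\bar\eta=\frac{\rho^2s}{2d}$, $\widetilde\gamma=\Gamma(2-\mu)h_t^\mu$, $w_k=(k+1)^{1-\mu}-k^{1-\mu}$, and $$\chi_{1}=\eta-\alpha\widetilde\gamma\bar\eta+\beta\widetilde\gamma\kappa+\eta\gamma\widetilde\gamma,\quad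 \chi_2=1+2\alpha\widetilde\gamma\bar\eta+\gamma\widetilde\gamma,\quad \chi_3=\eta-\alpha\widetilde\gamma\bar\eta-\beta\widetilde\gamma\kappa+\eta\gamma\widetilde\gamma.$$ The numerical solution is $U^n(x)=\sum_{m=-1}^{N_x+1}R_m^nQ_m(x)$, $0\le n\le N_t$, whose coefficients satisfy, with $U_m^n:=\eta R_{m-1}^n+R_m^n+\eta R_{m+1}^n$: * initially, $U_m^0=z(x_m)$ for $0\le m\le N_x$, $\kappa(R_1^0-R_{-1}^0)=z'(I_p)$ and $\kappa(R_{N_x+1}^0-R_{N_x-1}^0)=z'(F_p)$; * for $0\le n\le N_t-1$ and $0\le m\le N_x$, $$\chi_1R_{m-1}^{n+1}+\chi_2R_m^{n+1}+\chi_3R_{m+1}^{n+1}=U_m^n-\sum_{k=1}^nw_k\,(U_m^{n-k+1}-U_m^{n-k})+\widetilde\gamma\,\psi(x_m,t_{n+1});$$ * for $0\le n\le N_t-1$, $U_0^{n+1}=H(t_{n+1})$ and $U_{N_x}^{n+1}=G(t_{n+1})$. Then the scheme converges in the maximum norm with order $O(h_t^{2-\mu}+h_x^2)$: there are constants $h_0,k_2,k_3>0$,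 depending only on the problem data, on $u$ and on $\rho$ (not on $N_x,N_t$), such that for all $N_x,N_t\ge1$ with $h_x\le h_0$ the scheme has a solution, and every solution satisfies $$\max_{0\le n\le N_t}\ \max_{x\in[I_p,F_p]}|u(x,t_n)-U^n(x)|\le k_2h_t^{2-\mu}+k_3h_x^2 .$$ -/

import Mathlib

open Set

namespace TFBS

noncomputable section

/-! ## The continuous problem -/

/-- Data of the time-fractional Black–Scholes initial-boundary value problem
`ᶜD_t^μ u = α u_xx + β u_x - γ u + ψ` on `(left, right) × (0, T)`, with
`u(x,0) = z x`, `u(left,t) = H t`, `u(right,t) = G t`. -/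
structure Problem where
  left : ℝ
  right : ℝ
  T : ℝ
  μ : ℝ
  α : ℝ
  β : ℝ
  γ : ℝ
  ψ : ℝ → ℝ → ℝ
  z : ℝ → ℝ
  H : ℝ → ℝ
  G : ℝ → ℝ

/-- The Caputo derivative of order `μ ∈ (0,1)` of `f` at `t`, based at `0`. -/
def caputo (μ : ℝ) (f : ℝ → ℝ) (t : ℝ) : ℝ :=
  1 / Real.Gamma (1 - μ) * ∫ s in (0 : ℝ)..t, (t - s) ^ (-μ) * deriv f s

/-- `f x t` is of class `C^{k,0}` on `[a,b] × [0,T]`: the partial derivatives in `x` up to order `k`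
exist (one-sided at the end points) and are jointly continuous on the closed rectangle. -/
def ContDiffInSpace (k : ℕ) (f : ℝ → ℝ → ℝ) (a b T : ℝ) : Prop :=
  (∀ t ∈ Icc 0 T, ContDiffOn ℝ k (fun x => f x t) (Icc a b)) ∧
  ∀ i ≤ k, ContinuousOn
    (fun p : ℝ × ℝ => iteratedDerivWithin i (fun x => f x p.2) (Icc a b) p.1)
    (Icc a b ×ˢ Icc 0 T)

/-- `f x t` is of class `C^{0,k}` on `[a,b] × [0,T]`: the partial derivatives in `t` up to order `k`
exist (one-sided at the end points) and are jointly continuous on the closed rectangle. -/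
def ContDiffInTime (k : ℕ) (f : ℝ → ℝ → ℝ) (a b T : ℝ) : Prop :=
  (∀ x ∈ Icc a b, ContDiffOn ℝ k (fun t => f x t) (Icc 0 T)) ∧
  ∀ i ≤ k, ContinuousOn
    (fun p : ℝ × ℝ => iteratedDerivWithin i (fun t => f p.1 t) (Icc 0 T) p.2)
    (Icc a b ×ˢ Icc 0 T)

/-- `u` solves the initial-boundary value problem. -/
structure Problem.IsSolution (P : Problem) (u : ℝ → ℝ → ℝ) : Prop where
  equation : ∀ x ∈ Ioo P.left P.right, ∀ t ∈ Ioo 0 P.T,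
    caputo P.μ (fun s => u x s) t =
      P.α * iteratedDeriv 2 (fun y => u y t) x + P.β * deriv (fun y => u y t) x
        - P.γ * u x t + P.ψ x t
  initial : ∀ x ∈ Icc P.left P.right, u x 0 = P.z x
  boundary_left : ∀ t ∈ Icc 0 P.T, u P.left t = P.H t
  boundary_right : ∀ t ∈ Icc 0 P.T, u P.right t = P.G t

/-! ## Exponential B-splines with tension parameter `ρ` and mesh width `h` -/

/-- `s̃ = sinh (ρ h)`. -/
def sT (ρ h : ℝ) : ℝ := Real.sinh (ρ * h)

/-- `c̃ = cosh (ρ h)`. -/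
def cT (ρ h : ℝ) : ℝ := Real.cosh (ρ * h)

/-- The common denominator `ρ h c̃ - s̃`. -/
def den (ρ h : ℝ) : ℝ := ρ * h * cT ρ h - sT ρ h

def coefR (ρ h : ℝ) : ℝ := ρ / (2 * den ρ h)

def coefA (ρ h : ℝ) : ℝ := ρ * h * cT ρ h / den ρ h

def coefB (ρ h : ℝ) : ℝ :=
  ρ / 2 * ((cT ρ h * (cT ρ h - 1) + sT ρ h ^ 2) / (den ρ h * (1 - cT ρ h)))

def coefC (ρ h : ℝ) : ℝ :=
  1 / 4 * ((Real.exp (-(ρ * h)) * (1 - cT ρ h) + sT ρ h * (Real.exp (-(ρ * h)) - 1)) /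
    (den ρ h * (1 - cT ρ h)))

def coefQ (ρ h : ℝ) : ℝ :=
  1 / 4 * ((Real.exp (ρ * h) * (cT ρ h - 1) + sT ρ h * (Real.exp (ρ * h) - 1)) /
    (den ρ h * (1 - cT ρ h)))

/-- The grid point `a + m h`. -/
def node (a h : ℝ) (m : ℤ) : ℝ := a + m * h

/-- The exponential B-spline centred at the grid point `node a h m`. -/
def expBSpline (ρ a h : ℝ) (m : ℤ) (x : ℝ) : ℝ :=
  if x ∈ Icc (node a h (m - 2)) (node a h (m - 1)) then
    coefR ρ h * (node a h (m - 2) - x)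
      - coefR ρ h / ρ * Real.sinh (ρ * (node a h (m - 2) - x))
  else if x ∈ Icc (node a h (m - 1)) (node a h m) then
    coefA ρ h + coefB ρ h * (node a h m - x) + coefC ρ h * Real.exp (ρ * (node a h m - x))
      + coefQ ρ h * Real.exp (-(ρ * (node a h m - x)))
  else if x ∈ Icc (node a h m) (node a h (m + 1)) then
    coefA ρ h + coefB ρ h * (x - node a h m) + coefC ρ h * Real.exp (ρ * (x - node a h m))
      + coefQ ρ h * Real.exp (-(ρ * (x - node a h m)))
  else if x ∈ Icc (node a h (m + 1)) (node a h (m + 2)) then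
    coefR ρ h * (x - node a h (m + 2))
      - coefR ρ h / ρ * Real.sinh (ρ * (x - node a h (m + 2)))
  else 0

/-- `η`, the value of a B-spline at the two nodes next to its centre. -/
def eta (ρ h : ℝ) : ℝ := (sT ρ h - ρ * h) / (2 * den ρ h)

/-- `ẽ (c̃ - 1)` with `ẽ = ρ / (2 (ρ h c̃ - s̃))`, the modulus of the first derivative of a B-spline
at the two nodes next to its centre. -/
def etaD (ρ h : ℝ) : ℝ := ρ / (2 * den ρ h) * (cT ρ h - 1)

/-- `η̄`, the second derivative of a B-spline at the two nodes next to its centre. -/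
def etaDD (ρ h : ℝ) : ℝ := ρ ^ 2 * sT ρ h / (2 * den ρ h)

/-! ## The fully discrete scheme -/

/-- The weights `(k+1)^{1-μ} - k^{1-μ}` of the L1 formula. -/
def l1Weight (μ : ℝ) (k : ℕ) : ℝ := ((k : ℝ) + 1) ^ (1 - μ) - (k : ℝ) ^ (1 - μ)

/-- Space step for `N` subintervals. -/
def Problem.hx (P : Problem) (N : ℕ) : ℝ := (P.right - P.left) / N

/-- Time step for `K` subintervals. -/
def Problem.ht (P : Problem) (K : ℕ) : ℝ := P.T / K

/-- The time level `t_n = n h_t`. -/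
def Problem.time (P : Problem) (K n : ℕ) : ℝ := n * P.ht K

/-- The grid point `x_m = left + m h_x`. -/
def Problem.xNode (P : Problem) (N : ℕ) (m : ℤ) : ℝ := node P.left (P.hx N) m

/-- `γ̃ = Γ(2-μ) h_t^μ`. -/
def Problem.gammaT (P : Problem) (K : ℕ) : ℝ := Real.Gamma (2 - P.μ) * P.ht K ^ P.μ

def Problem.chi1 (P : Problem) (ρ : ℝ) (N K : ℕ) : ℝ :=
  eta ρ (P.hx N) - P.α * P.gammaT K * etaDD ρ (P.hx N) + P.β * P.gammaT K * etaD ρ (P.hx N)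
    + eta ρ (P.hx N) * P.γ * P.gammaT K

def Problem.chi2 (P : Problem) (ρ : ℝ) (N K : ℕ) : ℝ :=
  1 + 2 * P.α * P.gammaT K * etaDD ρ (P.hx N) + P.γ * P.gammaT K

def Problem.chi3 (P : Problem) (ρ : ℝ) (N K : ℕ) : ℝ :=
  eta ρ (P.hx N) - P.α * P.gammaT K * etaDD ρ (P.hx N) - P.β * P.gammaT K * etaD ρ (P.hx N)
    + eta ρ (P.hx N) * P.γ * P.gammaT K

/-- The nodal value `η r_{m-1} + r_m + η r_{m+1}` of the spline with coefficients `r`. -/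
def nodal (ρ h : ℝ) (r : ℤ → ℝ) (m : ℤ) : ℝ :=
  eta ρ h * r (m - 1) + r m + eta ρ h * r (m + 1)

/-- `R n m`, `0 ≤ n ≤ K`, `-1 ≤ m ≤ N + 1`, are coefficients produced by the scheme with `N` space
and `K` time subintervals: the initial interpolation system, the recursion at every node,
and the two boundary relations at every later time level. -/
structure Problem.IsDiscreteSolution (P : Problem) (ρ : ℝ) (N K : ℕ) (R : ℕ → ℤ → ℝ) : Prop where
  initial : ∀ m : ℤ, 0 ≤ m → m ≤ N → nodal ρ (P.hx N) (R 0) m = P.z (P.xNode N m)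
  initial_left : etaD ρ (P.hx N) * (R 0 1 - R 0 (-1)) =
    derivWithin P.z (Icc P.left P.right) P.left
  initial_right : etaD ρ (P.hx N) * (R 0 (N + 1) - R 0 (N - 1)) =
    derivWithin P.z (Icc P.left P.right) P.right
  step : ∀ n < K, ∀ m : ℤ, 0 ≤ m → m ≤ N →
    P.chi1 ρ N K * R (n + 1) (m - 1) + P.chi2 ρ N K * R (n + 1) m
        + P.chi3 ρ N K * R (n + 1) (m + 1) =
      nodal ρ (P.hx N) (R n) m
        - ∑ k ∈ Finset.Icc 1 n, l1Weight P.μ k *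
            (nodal ρ (P.hx N) (R (n - k + 1)) m - nodal ρ (P.hx N) (R (n - k)) m)
        + P.gammaT K * P.ψ (P.xNode N m) (P.time K (n + 1))
  boundary_left : ∀ n < K, eta ρ (P.hx N) * R (n + 1) (-1) =
    P.H (P.time K (n + 1)) - R (n + 1) 0 - eta ρ (P.hx N) * R (n + 1) 1
  boundary_right : ∀ n < K, eta ρ (P.hx N) * R (n + 1) (N + 1) =
    P.G (P.time K (n + 1)) - R (n + 1) N - eta ρ (P.hx N) * R (n + 1) (N - 1)

/-- The collocation approximation `U(x) = ∑_{m=-1}^{N+1} r_m Q_m(x)` with coefficients `r`. -/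
def Problem.approx (P : Problem) (ρ : ℝ) (N : ℕ) (r : ℤ → ℝ) (x : ℝ) : ℝ :=
  ∑ m ∈ Finset.Icc (-1 : ℤ) (N + 1), r m * expBSpline ρ P.left (P.hx N) m x

end

end TFBS

/-! On a mesh cell an exponential spline is determined by its end values and its end second
derivatives: it is the linear interpolant of the values plus the second derivatives times the
functions `bend`, which are at most `h ^ 2`. After normalization by `1 + 2η`, the nodal values `e`,
second differences `ε` and centred differences `p` of the coefficients obey `SplineRelations` with
`a = ratioA ≤ 1/5`, and the scheme becomes `e - history = γ̃ (α b ε + β p - γ e + source)` with `b =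
ratioB = 1 + O(h²)` (`chi_row_eq`). Samples of the exact solution obey the same relations up to
`O(h²)` (`exists_splineRelations_sample`), and the L1 formula has error `O(h_t^{2-μ})`
(`abs_l1Approx_sub_caputo_le`). So the errors solve the scheme with a source of size `G = O(h² +
h_t^{2-μ})` (`exists_error_step`).

Stability in space comes from testing the error equation with `K e - δ²e / h²` (`energy_step`). The
scheme imposes both the equation and the Dirichlet value at the end nodes, so the right-hand side
vanishes there; multiples of it may be added for free, and this makes the quadratic form in `ε`
coercive on all nodes. Convection is absorbed by taking `K` large, the remaining terms by taking `h`
small; no relation between `h` and `h_t` is needed.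

Stability in time uses that the L1 weights are positive and decreasing: the history is a convex
combination of earlier levels, the energy at level `n + 1` is at most a multiple of `γ̃ G² / w_n`
(`energy_evolution`), and `γ̃ / w_n` is bounded in terms of `T ^ μ` (`gammaT_div_l1Weight_le`). A
discrete Sobolev inequality turns this into a maximum bound for the nodal errors.

Between nodes only `h²` times the second differences enters. Diagonal dominance of the spline
relations bounds this by `G` and `h²` (`sq_mul_abs_secondError_le`), and `abs_sub_approx_le`
concludes. Solvability follows from injectivity of square systems; for a time step, injectivity is
the same energy estimate with zero data. -/

namespace TFBS

/-! ### The two normalized spline constants -/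

/-- The ratio `η / (1 + 2η)`. -/
noncomputable def ratioA (ρ h : ℝ) : ℝ := eta ρ h / (1 + 2 * eta ρ h)

/-- The ratio `η̄ h² / (1 + 2η)`. -/
noncomputable def ratioB (ρ h : ℝ) : ℝ := etaDD ρ h * h ^ 2 / (1 + 2 * eta ρ h)

/-- The fifth-order remainder of the exponential at `x` and `-x` has constant `6 / (5! * 5) =
1/100`; half the difference and half the sum keep it. -/
lemma sinh_cosh_expansion {x : ℝ} (hx0 : 0 ≤ x) (hx1 : x ≤ 1) :
    |Real.sinh x - (x + x ^ 3 / 6)| ≤ x ^ 5 / 100 ∧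
      |Real.cosh x - (1 + x ^ 2 / 2 + x ^ 4 / 24)| ≤ x ^ 5 / 100 := by
  have h1 := Real.exp_bound (x := x) (abs_le.mpr ⟨by linarith, hx1⟩) (n := 5) (by norm_num)
  have h2 := Real.exp_bound (x := -x) (abs_le.mpr ⟨by linarith, by linarith⟩) (n := 5)
    (by norm_num)
  rw [abs_neg] at h2
  rw [abs_of_nonneg hx0] at h1 h2
  simp only [Finset.sum_range_succ, Finset.sum_range_zero, Nat.factorial] at h1 h2
  norm_num at h1 h2
  rw [abs_le] at h1 h2
  rw [Real.sinh_eq, Real.cosh_eq, abs_le, abs_le]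
  refine ⟨⟨?_, ?_⟩, ?_, ?_⟩ <;> nlinarith [h1.1, h1.2, h2.1, h2.2]

/-- The Taylor coefficients `1/6` and `1/24` are loosened to `1/5` and `1/10` to swallow the
remainder, so that later estimates are polynomial inequalities. -/
lemma sinh_cosh_bounds {x : ℝ} (hx0 : 0 < x) (hx1 : x ≤ 1) :
    x ≤ Real.sinh x ∧ Real.sinh x ≤ x + x ^ 3 / 5 ∧ 1 + x ^ 2 / 2 ≤ Real.cosh x ∧
      Real.cosh x ≤ 1 + x ^ 2 / 2 + x ^ 4 / 10 := by
  obtain ⟨h1, h2⟩ := sinh_cosh_expansion hx0.le hx1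
  rw [abs_le] at h1 h2
  have e5 : x ^ 5 ≤ x ^ 4 := pow_le_pow_of_le_one hx0.le hx1 (by norm_num)
  have e4 : x ^ 5 ≤ x ^ 3 := pow_le_pow_of_le_one hx0.le hx1 (by norm_num)
  have p3 : 0 < x ^ 3 := by positivity
  have p4 : 0 < x ^ 4 := by positivity
  refine ⟨?_, ?_, ?_, ?_⟩ <;> linarith [h1.1, h1.2, h2.1, h2.2]

section
variable {ρ h : ℝ}

lemma den_pos (hρ : 0 < ρ) (hh : 0 < h) (h1 : ρ * h ≤ 1) : 0 < den ρ h := by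
  obtain ⟨-, b, c, -⟩ := sinh_cosh_bounds (mul_pos hρ hh) h1
  have hp : 0 < ρ * h := mul_pos hρ hh
  have p3 : 0 < (ρ * h) ^ 3 := by positivity
  unfold den cT sT
  nlinarith

lemma cosh_sub_one_pos (hρ : 0 < ρ) (hh : 0 < h) : 0 < cT ρ h - 1 := by
  have := Real.one_lt_cosh.mpr (mul_pos hρ hh).ne'
  unfold cT; linarith

lemma one_add_two_eta (hρ : 0 < ρ) (hh : 0 < h) (h1 : ρ * h ≤ 1) :
    1 + 2 * eta ρ h = ρ * h * (cT ρ h - 1) / den ρ h := by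
  have := (den_pos hρ hh h1).ne'
  unfold eta
  field_simp
  unfold den
  ring

lemma one_add_two_eta_pos (hρ : 0 < ρ) (hh : 0 < h) (h1 : ρ * h ≤ 1) :
    0 < 1 + 2 * eta ρ h := by
  rw [one_add_two_eta hρ hh h1]
  exact div_pos (mul_pos (mul_pos hρ hh) (cosh_sub_one_pos hρ hh)) (den_pos hρ hh h1)

lemma etaD_eq (hρ : 0 < ρ) (hh : 0 < h) (h1 : ρ * h ≤ 1) :
    etaD ρ h = (1 + 2 * eta ρ h) / (2 * h) := by
  have := (den_pos hρ hh h1).ne'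
  rw [one_add_two_eta hρ hh h1]
  unfold etaD
  field_simp

lemma etaDD_eq (hρ : 0 < ρ) (hh : 0 < h) (h1 : ρ * h ≤ 1) :
    etaDD ρ h = ratioB ρ h * (1 + 2 * eta ρ h) / h ^ 2 := by
  have := (one_add_two_eta_pos hρ hh h1).ne'
  unfold ratioB
  field_simp

lemma eta_eq (hρ : 0 < ρ) (hh : 0 < h) (h1 : ρ * h ≤ 1) :
    eta ρ h = ratioA ρ h * (1 + 2 * eta ρ h) := by
  have := (one_add_two_eta_pos hρ hh h1).ne'
  rw [ratioA, div_mul_cancel₀ _ this]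

lemma eta_pos (hρ : 0 < ρ) (hh : 0 < h) (h1 : ρ * h ≤ 1) : 0 < eta ρ h := by
  have h2 := Real.self_lt_sinh_iff.mpr (mul_pos hρ hh)
  have := den_pos hρ hh h1
  unfold eta sT
  apply div_pos <;> linarith

lemma ratioA_nonneg (hρ : 0 < ρ) (hh : 0 < h) (h1 : ρ * h ≤ 1) : 0 ≤ ratioA ρ h :=
  div_nonneg (eta_pos hρ hh h1).le (one_add_two_eta_pos hρ hh h1).le

/-- With `x = ρ h` the ratio is `(sinh x - x) / (2 x (cosh x - 1))`, which tends to the cubic spline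
value `1/6`. The bound `1/5` gives the margins `1 - 4a ≥ 1/5`, `1 - 2a ≥ 3/5` and `1/2 - a ≥ 3/10`
used below. -/
lemma ratioA_le (hρ : 0 < ρ) (hh : 0 < h) (h1 : ρ * h ≤ 1) : ratioA ρ h ≤ 1 / 5 := by
  obtain ⟨-, b, c, -⟩ := sinh_cosh_bounds (mul_pos hρ hh) h1
  have hd := den_pos hρ hh h1
  have hp : 0 < ρ * h := mul_pos hρ hh
  have hc := cosh_sub_one_pos hρ hh
  have e : ratioA ρ h = (sT ρ h - ρ * h) / (2 * (ρ * h) * (cT ρ h - 1)) := by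
    rw [ratioA, one_add_two_eta hρ hh h1, eta]
    field_simp
  rw [e, div_le_iff₀ (by positivity)]
  unfold sT cT
  nlinarith

lemma two_eta_lt_one (hρ : 0 < ρ) (hh : 0 < h) (h1 : ρ * h ≤ 1) : 2 * eta ρ h < 1 := by
  have e1 := one_add_two_eta_pos hρ hh h1
  have := ratioA_le hρ hh h1
  rw [ratioA, div_le_iff₀ e1] at this
  linarith

/-- With `x = ρ h` the ratio is `x sinh x / (2 (cosh x - 1))`. Its deviation from `1` enters the
consistency error as a multiple of `α ρ² h² u_xx`. -/
lemma abs_ratioB_sub_one_le (hρ : 0 < ρ) (hh : 0 < h) (h1 : ρ * h ≤ 1) :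
    |ratioB ρ h - 1| ≤ ρ ^ 2 * h ^ 2 := by
  obtain ⟨a, b, c, d⟩ := sinh_cosh_bounds (mul_pos hρ hh) h1
  have hd := den_pos hρ hh h1
  have hp : 0 < ρ * h := mul_pos hρ hh
  have hc := cosh_sub_one_pos hρ hh
  have e : ratioB ρ h = ρ * h * sT ρ h / (2 * (cT ρ h - 1)) := by
    rw [ratioB, one_add_two_eta hρ hh h1, etaDD]
    field_simp
  rw [e, ← mul_pow]
  set x := ρ * h
  change 0 < Real.cosh x - 1 at hc
  change |x * Real.sinh x / (2 * (Real.cosh x - 1)) - 1| ≤ x ^ 2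
  have x2 : x ^ 2 ≤ 1 := by nlinarith
  rw [abs_le]
  constructor
  · rw [neg_le_sub_iff_le_add, ← sub_le_iff_le_add, le_div_iff₀ (by linarith)]
    nlinarith [mul_le_mul_of_nonneg_left a hp.le, mul_nonneg (sub_nonneg.2 x2) (sub_nonneg.2 d),
      pow_pos hp 4]
  · rw [sub_le_iff_le_add, div_le_iff₀ (by linarith)]
    nlinarith [mul_le_mul_of_nonneg_left b hp.le, mul_nonneg (add_nonneg (sq_nonneg x) zero_le_one) (sub_nonneg.2 c),
      pow_pos hp 4]

/-! ### Values of the splines on a mesh cell -/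

/-- The function with second derivative `sinh (ρ y) / sinh (ρ h)` that vanishes at `0` and `h`. -/
noncomputable def bend (ρ h y : ℝ) : ℝ := (Real.sinh (ρ * y) / sT ρ h - y / h) / ρ ^ 2

/-- Over a common denominator the numerator is `h sinh (ρ y) - y sinh (ρ h)`. The linear terms
cancel, leaving order `ρ³ h⁴` against a denominator of at least `ρ³ h²`. -/
lemma abs_bend_le (hρ : 0 < ρ) (hh : 0 < h) (h1 : ρ * h ≤ 1) {y : ℝ} (hy0 : 0 ≤ y) (hy : y ≤ h) :
    |bend ρ h y| ≤ h ^ 2 := by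
  have hp : 0 < ρ * h := mul_pos hρ hh
  obtain ⟨a, b, -, -⟩ := sinh_cosh_bounds hp h1
  have hs : 0 < sT ρ h := lt_of_lt_of_le hp a
  have e1 : ρ * y ≤ Real.sinh (ρ * y) := Real.self_le_sinh_iff.mpr (by positivity)
  have e2 : Real.sinh (ρ * y) ≤ ρ * y + (ρ * y) ^ 3 / 5 := by
    rcases hy0.eq_or_lt with rfl | hy0'
    · simp
    · exact (sinh_cosh_bounds (mul_pos hρ hy0') ((mul_le_mul_of_nonneg_left hy hρ.le).trans h1)).2.1
  have b' : sT ρ h ≤ ρ * h + (ρ * h) ^ 3 / 5 := b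
  have a' : ρ * h ≤ sT ρ h := a
  have hb : bend ρ h y = (h * Real.sinh (ρ * y) - y * sT ρ h) / (h * sT ρ h * ρ ^ 2) := by
    unfold bend; field_simp
  have k : (h : ℝ) * (ρ * h) ≤ h * sT ρ h := mul_le_mul_of_nonneg_left a' hh.le
  rw [hb, abs_div, abs_of_pos (show 0 < h * sT ρ h * ρ ^ 2 by positivity),
    div_le_iff₀ (by positivity)]
  have k2 : h ^ 2 * (h * (ρ * h) * ρ ^ 2) ≤ h ^ 2 * (h * sT ρ h * ρ ^ 2) := by gcongr
  refine le_trans ?_ k2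
  have yh : y ^ 3 ≤ h ^ 3 := by gcongr
  have f1 : h * Real.sinh (ρ * y) ≤ h * (ρ * y + (ρ * y) ^ 3 / 5) := by gcongr
  have f2 : h * (ρ * y) ≤ h * Real.sinh (ρ * y) := by gcongr
  have f3 : y * sT ρ h ≤ y * (ρ * h + (ρ * h) ^ 3 / 5) := by gcongr
  have f4 : y * (ρ * h) ≤ y * sT ρ h := by gcongr
  have g1 : ρ ^ 3 * h * y ^ 3 ≤ ρ ^ 3 * h * h ^ 3 := by gcongr
  have g2 : ρ ^ 3 * h ^ 3 * y ≤ ρ ^ 3 * h ^ 3 * h := by gcongr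
  have g3 : 0 ≤ ρ ^ 3 * h ^ 4 := by positivity
  rw [abs_le]
  constructor <;> nlinarith

/-- Linear interpolation of the nodal values plus the contribution of the second derivatives. -/
noncomputable def cellForm (ρ h v₀ v₁ w₀ w₁ y : ℝ) : ℝ :=
  v₀ * (1 - y / h) + v₁ * (y / h) + w₀ * bend ρ h (h - y) + w₁ * bend ρ h y

lemma outer_piece_eq (hρ : 0 < ρ) (hh : 0 < h) (h1 : ρ * h ≤ 1) (y : ℝ) :
    coefR ρ h * (-y) - coefR ρ h / ρ * Real.sinh (ρ * (-y)) =
      eta ρ h * (y / h) + etaDD ρ h * bend ρ h y := by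
  have hd := (den_pos hρ hh h1).ne'
  have hs : sT ρ h ≠ 0 := (Real.sinh_pos_iff.mpr (mul_pos hρ hh)).ne'
  rw [mul_neg, mul_neg, Real.sinh_neg]
  unfold coefR eta etaDD bend
  field_simp
  ring

/-- The piece lies in the span of `1`, `y`, `exp (ρ y)`, `exp (-ρ y)`, so it is fixed by its end
values `1, η` and end second derivatives `-2η̄, η̄`. Passing to `cosh` and `sinh` simplifies the
coefficients enough to compare both sides directly. -/
lemma inner_piece_eq (hρ : 0 < ρ) (hh : 0 < h) (h1 : ρ * h ≤ 1) (y : ℝ) :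
    coefA ρ h + coefB ρ h * y + coefC ρ h * Real.exp (ρ * y) + coefQ ρ h * Real.exp (-(ρ * y)) =
      cellForm ρ h 1 (eta ρ h) (-(2 * etaDD ρ h)) (etaDD ρ h) y := by
  have hd := (den_pos hρ hh h1).ne'
  have hs : sT ρ h ≠ 0 := (Real.sinh_pos_iff.mpr (mul_pos hρ hh)).ne'
  have hc : 1 - cT ρ h ≠ 0 := by linarith [cosh_sub_one_pos hρ hh]
  have hsq : cT ρ h ^ 2 = sT ρ h ^ 2 + 1 := Real.cosh_sq _
  have e1 : Real.exp (ρ * h) = cT ρ h + sT ρ h := (Real.cosh_add_sinh _).symm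
  have e2 : Real.exp (-(ρ * h)) = cT ρ h - sT ρ h := (Real.cosh_sub_sinh _).symm
  have e3 : Real.exp (ρ * y) = Real.cosh (ρ * y) + Real.sinh (ρ * y) := (Real.cosh_add_sinh _).symm
  have e4 : Real.exp (-(ρ * y)) = Real.cosh (ρ * y) - Real.sinh (ρ * y) :=
    (Real.cosh_sub_sinh _).symm
  have hA : coefA ρ h = 1 + sT ρ h / den ρ h := by
    unfold coefA; field_simp; unfold den; ring
  have hB : coefB ρ h = -(ρ * (2 * cT ρ h + 1) / (2 * den ρ h)) := by
    unfold coefB; field_simp; linear_combination -hsq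
  have hC : coefC ρ h + coefQ ρ h = -(sT ρ h / den ρ h) := by
    unfold coefC coefQ; rw [e1, e2]; field_simp; ring
  have hQ : coefC ρ h - coefQ ρ h = (2 * cT ρ h + 1) / (2 * den ρ h) := by
    unfold coefC coefQ; rw [e1, e2]; field_simp; linear_combination 4 * hsq
  have hsub : Real.sinh (ρ * (h - y)) =
      sT ρ h * Real.cosh (ρ * y) - cT ρ h * Real.sinh (ρ * y) := by
    rw [mul_sub, Real.sinh_sub]; rfl
  have : coefA ρ h + coefB ρ h * y + coefC ρ h * Real.exp (ρ * y)
      + coefQ ρ h * Real.exp (-(ρ * y)) = coefA ρ h + coefB ρ h * y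
        + (coefC ρ h + coefQ ρ h) * Real.cosh (ρ * y)
        + (coefC ρ h - coefQ ρ h) * Real.sinh (ρ * y) := by
    rw [e3, e4]; ring
  rw [this, hA, hB, hC, hQ]
  unfold cellForm bend
  rw [hsub]
  unfold eta etaDD
  field_simp
  unfold den
  ring

lemma bend_zero : bend ρ h 0 = 0 := by simp [bend]

lemma bend_self (hρ : 0 < ρ) (hh : 0 < h) : bend ρ h h = 0 := by
  have hs : sT ρ h ≠ 0 := (Real.sinh_pos_iff.mpr (mul_pos hρ hh)).ne'
  have : Real.sinh (ρ * h) / sT ρ h = 1 := div_self hs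
  simp [bend, this, hh.ne']

lemma node_add (a h : ℝ) (j i : ℤ) : node a h (j + i) = node a h j + i * h := by
  unfold node; push_cast; ring

lemma node_sub (a h : ℝ) (j i : ℤ) : node a h (j - i) = node a h j - i * h := by
  unfold node; push_cast; ring

lemma expBSpline_of_le (hh : 0 < h) {a x : ℝ} {m : ℤ} (hx : x ≤ node a h (m - 2)) :
    expBSpline ρ a h m x = 0 := by
  unfold expBSpline
  simp only [mem_Icc, node_add, node_sub] at *
  push_cast at *
  split_ifs with i1 i2 i3 i4
  · have : node a h m - 2 * h - x = 0 := by linarith [i1.1]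
    rw [this]; simp
  all_goals first | rfl | (exfalso; linarith [i2.1]) | (exfalso; linarith [i3.1]) | (exfalso; linarith [i4.1])

lemma expBSpline_of_ge (hh : 0 < h) {a x : ℝ} {m : ℤ} (hx : node a h (m + 2) ≤ x) :
    expBSpline ρ a h m x = 0 := by
  unfold expBSpline
  simp only [mem_Icc, node_add, node_sub] at *
  push_cast at *
  split_ifs with i1 i2 i3 i4
  · exfalso; linarith [i1.2]
  · exfalso; linarith [i2.2]
  · exfalso; linarith [i3.2]
  · have : x - (node a h m + 2 * h) = 0 := by linarith [i4.2]
    rw [this]; simp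
  · rfl

lemma expBSpline_left_outer (hρ : 0 < ρ) (hh : 0 < h) (h1 : ρ * h ≤ 1) {a x : ℝ} {m : ℤ}
    (hx0 : node a h (m - 2) ≤ x) (hx1 : x ≤ node a h (m - 1)) :
    expBSpline ρ a h m x = eta ρ h * ((x - node a h (m - 2)) / h)
      + etaDD ρ h * bend ρ h (x - node a h (m - 2)) := by
  rw [expBSpline, if_pos ⟨hx0, hx1⟩, ← outer_piece_eq hρ hh h1, neg_sub]

lemma expBSpline_left_inner (hρ : 0 < ρ) (hh : 0 < h) (h1 : ρ * h ≤ 1) {a x : ℝ} {m : ℤ}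
    (hx0 : node a h (m - 1) ≤ x) (hx1 : x ≤ node a h m) :
    expBSpline ρ a h m x =
      cellForm ρ h 1 (eta ρ h) (-(2 * etaDD ρ h)) (etaDD ρ h) (node a h m - x) := by
  by_cases i1 : x ∈ Icc (node a h (m - 2)) (node a h (m - 1))
  -- The branches of the definition overlap at nodes and the earlier one wins; at the shared node
  -- both pieces equal `η`.
  · rw [expBSpline_left_outer hρ hh h1 i1.1 i1.2]
    have e1 : x - node a h (m - 2) = h := by
      rw [le_antisymm i1.2 hx0, node_sub, node_sub]; push_cast; ring
    have e2 : node a h m - x = h := by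
      rw [le_antisymm i1.2 hx0, node_sub]; push_cast; ring
    rw [e1, e2, cellForm, sub_self, bend_self hρ hh, bend_zero, div_self hh.ne']
    ring
  · rw [expBSpline, if_neg i1, if_pos ⟨hx0, hx1⟩, inner_piece_eq hρ hh h1]

lemma expBSpline_right_inner (hρ : 0 < ρ) (hh : 0 < h) (h1 : ρ * h ≤ 1) {a x : ℝ} {m : ℤ}
    (hx0 : node a h m ≤ x) (hx1 : x ≤ node a h (m + 1)) :
    expBSpline ρ a h m x =
      cellForm ρ h 1 (eta ρ h) (-(2 * etaDD ρ h)) (etaDD ρ h) (x - node a h m) := by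
  rcases hx0.eq_or_lt with rfl | hx0'
  · rw [expBSpline_left_inner hρ hh h1 (by rw [node_sub]; push_cast; linarith) le_rfl]
  · have i1 : x ∉ Icc (node a h (m - 2)) (node a h (m - 1)) := by
      rintro ⟨-, i⟩; rw [node_sub] at i; push_cast at i; linarith
    have i2 : x ∉ Icc (node a h (m - 1)) (node a h m) := fun i => absurd i.2 hx0'.not_ge
    rw [expBSpline, if_neg i1, if_neg i2, if_pos ⟨hx0, hx1⟩, inner_piece_eq hρ hh h1]

lemma expBSpline_right_outer (hρ : 0 < ρ) (hh : 0 < h) (h1 : ρ * h ≤ 1) {a x : ℝ} {m : ℤ}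
    (hx0 : node a h (m + 1) ≤ x) (hx1 : x ≤ node a h (m + 2)) :
    expBSpline ρ a h m x = eta ρ h * ((node a h (m + 2) - x) / h)
      + etaDD ρ h * bend ρ h (node a h (m + 2) - x) := by
  rcases hx0.eq_or_lt with rfl | hx0'
  · rw [expBSpline_right_inner hρ hh h1 (by rw [node_add]; push_cast; linarith) le_rfl]
    have e1 : node a h (m + 1) - node a h m = h := by rw [node_add]; push_cast; ring
    have e2 : node a h (m + 2) - node a h (m + 1) = h := by
      rw [node_add, node_add]; push_cast; ring
    rw [e1, e2, cellForm, sub_self, bend_self hρ hh, bend_zero, div_self hh.ne']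
    ring
  · have e := node_add a h m 1
    have e' := node_sub a h m 1
    push_cast at e e'
    have i1 : x ∉ Icc (node a h (m - 2)) (node a h (m - 1)) := by
      rintro ⟨-, i⟩; linarith
    have i2 : x ∉ Icc (node a h (m - 1)) (node a h m) := by
      rintro ⟨-, i⟩; linarith
    have i3 : x ∉ Icc (node a h m) (node a h (m + 1)) := by
      rintro ⟨-, i⟩; linarith
    rw [expBSpline, if_neg i1, if_neg i2, if_neg i3, if_pos ⟨hx0, hx1⟩,
      ← outer_piece_eq hρ hh h1, neg_sub]

/-- The nodal second derivative of the spline with coefficients `r`. -/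
noncomputable def nodalDD (ρ h : ℝ) (r : ℤ → ℝ) (m : ℤ) : ℝ :=
  etaDD ρ h * (r (m - 1) - 2 * r m + r (m + 1))

/-- Only the splines centred at `j - 1, …, j + 2` live on the cell. Each is a cell form there, and
cell forms are linear in their four data. -/
lemma sum_expBSpline_eq (hρ : 0 < ρ) (hh : 0 < h) (h1 : ρ * h ≤ 1) {a x : ℝ} {N : ℕ} {j : ℤ}
    (r : ℤ → ℝ) (hj0 : 0 ≤ j) (hjN : j + 1 ≤ N)
    (hx0 : node a h j ≤ x) (hx1 : x ≤ node a h (j + 1)) :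
    ∑ m ∈ Finset.Icc (-1 : ℤ) (N + 1), r m * expBSpline ρ a h m x =
      cellForm ρ h (nodal ρ h r j) (nodal ρ h r (j + 1)) (nodalDD ρ h r j)
        (nodalDD ρ h r (j + 1)) (x - node a h j) := by
  have hnode : ∀ {i k : ℤ}, i ≤ k → node a h i ≤ node a h k := by
    intro i k hik
    unfold node
    have : (i : ℝ) ≤ k := by exact_mod_cast hik
    nlinarith
  have hsub : Finset.Icc (j - 1) (j + 2) ⊆ Finset.Icc (-1 : ℤ) (N + 1) :=
    Finset.Icc_subset_Icc (by omega) (by omega)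
  rw [← Finset.sum_subset hsub]
  · have hset : Finset.Icc (j - 1) (j + 2) = {j - 1, j, j + 1, j + 2} := by
      ext i; simp only [Finset.mem_Icc, Finset.mem_insert, Finset.mem_singleton]; omega
    rw [hset, Finset.sum_insert (by simp only [Finset.mem_insert, Finset.mem_singleton]; omega),
      Finset.sum_insert (by simp only [Finset.mem_insert, Finset.mem_singleton]; omega),
      Finset.sum_insert (by simp only [Finset.mem_singleton]; omega), Finset.sum_singleton,
      expBSpline_right_outer hρ hh h1 (m := j - 1) (by simpa using hx0)
        (by convert hx1 using 2; ring),
      expBSpline_right_inner hρ hh h1 hx0 hx1,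
      expBSpline_left_inner hρ hh h1 (m := j + 1) (by simpa using hx0) hx1,
      expBSpline_left_outer hρ hh h1 (m := j + 2) (by simpa using hx0)
        (by convert hx1 using 2; ring)]
    have e1 : node a h (j - 1 + 2) - x = h - (x - node a h j) := by
      rw [show j - 1 + 2 = j + 1 by ring, node_add]; push_cast; ring
    have e2 : node a h (j + 1) - x = h - (x - node a h j) := by
      rw [node_add]; push_cast; ring
    have e3 : x - node a h (j + 2 - 2) = x - node a h j := by simp
    rw [e1, e2, e3]
    have e4 : h - (h - (x - node a h j)) = x - node a h j := by ring
    unfold cellForm nodal nodalDD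
    rw [e4, show j + 1 - 1 = j by ring, show j + 1 + 1 = j + 2 by ring]
    field_simp
    ring
  · intro i _ hi
    rw [Finset.mem_Icc, not_and_or, not_le, not_le] at hi
    rcases hi with hi | hi
    · rw [expBSpline_of_ge hh ((hnode (by omega)).trans hx0), mul_zero]
    · rw [expBSpline_of_le hh (hx1.trans (hnode (by omega))), mul_zero]

end

/-! ### Discrete calculus on a grid with nodes `0, …, n + 1` -/

section
open Finset

lemma sum_by_parts (n : ℕ) (u v : ℕ → ℝ) :
    ∑ i ∈ range n, v (i + 1) * (u (i + 2) - 2 * u (i + 1) + u i)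
      + ∑ i ∈ range (n + 1), (u (i + 1) - u i) * (v (i + 1) - v i) =
      v (n + 1) * (u (n + 1) - u n) - v 0 * (u 1 - u 0) := by
  induction n with
  | zero => simp; ring
  | succ n ih =>
    rw [sum_range_succ, sum_range_succ _ (n + 1)]
    linear_combination ih

lemma sum_by_parts_of_zero {n : ℕ} (u : ℕ → ℝ) {v : ℕ → ℝ} (h0 : v 0 = 0) (h1 : v (n + 1) = 0) :
    ∑ i ∈ range n, v (i + 1) * (u (i + 2) - 2 * u (i + 1) + u i) =
      -∑ i ∈ range (n + 1), (u (i + 1) - u i) * (v (i + 1) - v i) := by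
  have := sum_by_parts n u v
  rw [h0, h1] at this
  linarith

/-- The centred difference is skew-symmetric, so convection does not contribute to the mass part of
the energy; the sum telescopes. -/
lemma sum_centered_eq_zero {n : ℕ} {e : ℕ → ℝ} (h0 : e 0 = 0) (h1 : e (n + 1) = 0) :
    ∑ i ∈ range n, e (i + 1) * (e (i + 2) - e i) = 0 := by
  have : ∑ i ∈ range n, e (i + 1) * (e (i + 2) - e i) =
      ∑ i ∈ range n, (e (i + 1) * e (i + 1 + 1) - e i * e (i + 1)) :=
    sum_congr rfl fun i _ => by ring
  rw [this, sum_range_sub (fun i => e i * e (i + 1)), h0, h1]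
  ring

lemma sum_interior_add (n : ℕ) (v : ℕ → ℝ) :
    ∑ i ∈ range n, v (i + 1) + v 0 + v (n + 1) = ∑ i ∈ range (n + 2), v i := by
  rw [sum_range_succ, sum_range_succ']

lemma sum_left_le {n : ℕ} {v : ℕ → ℝ} (hv : ∀ i, 0 ≤ v i) :
    ∑ i ∈ range n, v i ≤ ∑ i ∈ range (n + 2), v i :=
  sum_le_sum_of_subset_of_nonneg (range_subset_range.2 (by omega)) fun i _ _ => hv i

lemma sum_right_le {n : ℕ} {v : ℕ → ℝ} (hv : ∀ i, 0 ≤ v i) :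
    ∑ i ∈ range n, v (i + 2) ≤ ∑ i ∈ range (n + 2), v i := by
  rw [sum_range_succ' _ (n + 1), sum_range_succ']
  linarith [hv 0, hv (0 + 1)]

lemma sum_middle_le {n : ℕ} {v : ℕ → ℝ} (hv : ∀ i, 0 ≤ v i) :
    ∑ i ∈ range n, v (i + 1) ≤ ∑ i ∈ range (n + 2), v i := by
  linarith [sum_interior_add n v, hv 0, hv (n + 1)]

/-- The squared discrete `H¹` seminorm, with polarization. -/
noncomputable def gradForm (n : ℕ) (h : ℝ) (u v : ℕ → ℝ) : ℝ :=
  (∑ i ∈ range (n + 1), (u (i + 1) - u i) * (v (i + 1) - v i)) / h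

/-- The discrete `L²` inner product over interior nodes. -/
noncomputable def massForm (n : ℕ) (h : ℝ) (u v : ℕ → ℝ) : ℝ :=
  h * ∑ i ∈ range n, u (i + 1) * v (i + 1)

/-- Discrete Sobolev inequality: Cauchy–Schwarz for the increments summed from the left end. It
converts the energy bound into the maximum norm. -/
lemma sq_le_gradForm {n : ℕ} {h : ℝ} (hh : 0 < h) {e : ℕ → ℝ} (h0 : e 0 = 0) {m : ℕ}
    (hm : m ≤ n + 1) : e m ^ 2 ≤ ((n + 1 : ℕ) * h) * gradForm n h e e := by
  have e1 : e m = ∑ i ∈ range m, (e (i + 1) - e i) := by rw [sum_range_sub, h0, sub_zero]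
  have e2 := sq_sum_le_card_mul_sum_sq (s := range m) (f := fun i => e (i + 1) - e i)
  rw [← e1, card_range] at e2
  have e3 : ∑ i ∈ range m, (e (i + 1) - e i) ^ 2 ≤ ∑ i ∈ range (n + 1), (e (i + 1) - e i) ^ 2 :=
    sum_le_sum_of_subset_of_nonneg (range_subset_range.2 hm) fun i _ _ => sq_nonneg _
  have e4 : (m : ℝ) ≤ (n + 1 : ℕ) := by exact_mod_cast hm
  have e5 : ((n + 1 : ℕ) * h) * gradForm n h e e
      = (n + 1 : ℕ) * ∑ i ∈ range (n + 1), (e (i + 1) - e i) ^ 2 := by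
    unfold gradForm
    rw [mul_assoc, mul_div_cancel₀ _ hh.ne']
    simp only [sq]
  rw [e5]
  refine e2.trans (mul_le_mul e4 e3 (sum_nonneg fun i _ => sq_nonneg _) (by positivity))

lemma gradForm_self_nonneg {n : ℕ} {h : ℝ} (hh : 0 < h) (e : ℕ → ℝ) : 0 ≤ gradForm n h e e :=
  div_nonneg (sum_nonneg fun _ _ => mul_self_nonneg _) hh.le

lemma massForm_self_nonneg {n : ℕ} {h : ℝ} (hh : 0 < h) (e : ℕ → ℝ) : 0 ≤ massForm n h e e :=
  mul_nonneg hh.le (sum_nonneg fun _ _ => mul_self_nonneg _)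

lemma massForm_self_le {n : ℕ} {h : ℝ} (hh : 0 < h) {e : ℕ → ℝ} (h0 : e 0 = 0) :
    massForm n h e e ≤ ((n + 1 : ℕ) * h) ^ 2 * gradForm n h e e := by
  have e1 : ∑ i ∈ range n, e (i + 1) * e (i + 1) ≤
      ∑ i ∈ range n, ((n + 1 : ℕ) * h) * gradForm n h e e :=
    sum_le_sum fun i hi => by
      rw [← sq]; exact sq_le_gradForm hh h0 (by have := mem_range.1 hi; omega)
  rw [sum_const, card_range, nsmul_eq_mul] at e1
  have hg := gradForm_self_nonneg (n := n) hh e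
  have : massForm n h e e ≤ h * (n * (((n + 1 : ℕ) * h) * gradForm n h e e)) :=
    mul_le_mul_of_nonneg_left e1 hh.le
  refine this.trans ?_
  have : (n : ℝ) ≤ (n + 1 : ℕ) := by push_cast; linarith
  have k : 0 ≤ ((n + 1 : ℕ) * h) * gradForm n h e e := by positivity
  calc h * (n * (((n + 1 : ℕ) * h) * gradForm n h e e))
      ≤ h * ((n + 1 : ℕ) * (((n + 1 : ℕ) * h) * gradForm n h e e)) := by gcongr
    _ = _ := by ring

/-- The relations between nodal errors `e` and errors `ε` of second differences of the coefficients,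
with first differences `p` and defect `σ`. -/
structure SplineRelations (n : ℕ) (a h : ℝ) (e ε p σ : ℕ → ℝ) : Prop where
  second : ∀ i < n, ε (i + 1) + a * (ε (i + 2) - 2 * ε (i + 1) + ε i) =
    (e (i + 2) - 2 * e (i + 1) + e i) / h ^ 2 + σ (i + 1)
  first : ∀ i < n, p (i + 1) =
    (e (i + 2) - e i) / (2 * h) - a * h / 2 * (ε (i + 2) - ε i)
  first_left : p 0 = (e 1 - e 0) / h - a * h * (ε 1 - ε 0) - h / 2 * ε 0
  first_right : p (n + 1) = (e (n + 1) - e n) / h - a * h * (ε (n + 1) - ε n) + h / 2 * ε (n + 1)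

/-! ### Estimates drawn from the spline relations -/

section
variable {n : ℕ} {a h G : ℝ} {e ε p σ : ℕ → ℝ}

/-- By the relation `second` the bracket is `δ²e / h²`, so this is summation by parts. The test
sequence is left free because both `e` and its increment in time are used. -/
lemma SplineRelations.sum_mul_second (H : SplineRelations n a h e ε p σ) (hh : 0 < h)
    {v : ℕ → ℝ} (h0 : v 0 = 0) (h1 : v (n + 1) = 0) :
    h * ∑ i ∈ range n, v (i + 1) *
      (ε (i + 1) + a * (ε (i + 2) - 2 * ε (i + 1) + ε i) - σ (i + 1)) = -gradForm n h e v := by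
  have : ∑ i ∈ range n, v (i + 1) *
      (ε (i + 1) + a * (ε (i + 2) - 2 * ε (i + 1) + ε i) - σ (i + 1)) =
      (∑ i ∈ range n, v (i + 1) * (e (i + 2) - 2 * e (i + 1) + e i)) / h ^ 2 := by
    rw [sum_div]
    refine sum_congr rfl fun i hi => ?_
    rw [H.second i (mem_range.1 hi)]; ring
  rw [this, sum_by_parts_of_zero e h0 h1, gradForm]
  field_simp

/-- After splitting the mixed products, the interior sum still lacks control at the two end nodes;
the added end squares supply it, and `1 - 4a ≥ 1/5` remains. -/
lemma sum_quadratic_ge (ha0 : 0 ≤ a) (ha : a ≤ 1 / 5) :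
    1 / 5 * ∑ i ∈ range (n + 2), ε i ^ 2 ≤
      ∑ i ∈ range n, ε (i + 1) * (ε (i + 1) + a * (ε (i + 2) - 2 * ε (i + 1) + ε i))
        + ε 0 ^ 2 + ε (n + 1) ^ 2 := by
  have s1 := sum_interior_add n (fun i => ε i ^ 2)
  have s2 := sum_left_le (n := n) (v := fun i => ε i ^ 2) fun i => sq_nonneg _
  have s3 := sum_right_le (n := n) (v := fun i => ε i ^ 2) fun i => sq_nonneg _
  have s4 : ∑ i ∈ range n, ((1 - 3 * a) * ε (i + 1) ^ 2 - a / 2 * ε i ^ 2 - a / 2 * ε (i + 2) ^ 2) ≤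
      ∑ i ∈ range n, ε (i + 1) * (ε (i + 1) + a * (ε (i + 2) - 2 * ε (i + 1) + ε i)) :=
    sum_le_sum fun i _ => by
      nlinarith [mul_nonneg ha0 (sq_nonneg (ε (i + 1) + ε (i + 2))),
        mul_nonneg ha0 (sq_nonneg (ε (i + 1) + ε i))]
  simp only [sum_sub_distrib, ← mul_sum] at s4
  set W := ∑ i ∈ range (n + 2), ε i ^ 2
  have W0 : 0 ≤ W := sum_nonneg fun i _ => sq_nonneg _
  have k1 := mul_le_mul_of_nonneg_left s2 ha0
  have k2 := mul_le_mul_of_nonneg_left s3 ha0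
  have k3 := mul_le_mul_of_nonneg_right ha W0
  have k4 : 0 ≤ a * (ε 0 ^ 2 + ε (n + 1) ^ 2) := by positivity
  have s1' : (1 - 3 * a) * (∑ i ∈ range n, ε (i + 1) ^ 2 + ε 0 ^ 2 + ε (n + 1) ^ 2)
    = (1 - 3 * a) * W := by rw [s1]
  linarith

/-- Without the defect the summand is the convex combination of `ε (i + 1)`, `ε i`, `ε (i + 2)` with
weights `1 - 2a, a, a`, so its square is bounded by the same combination of squares. -/
lemma sum_second_sq_le (ha0 : 0 ≤ a) (ha : a ≤ 1 / 5) (hσ : ∀ i < n, |σ (i + 1)| ≤ G) :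
    ∑ i ∈ range n, (ε (i + 1) + a * (ε (i + 2) - 2 * ε (i + 1) + ε i) - σ (i + 1)) ^ 2 ≤
      2 * (∑ i ∈ range (n + 2), ε i ^ 2) + 2 * n * G ^ 2 := by
  have s1 := sum_middle_le (n := n) (v := fun i => ε i ^ 2) fun i => sq_nonneg _
  have s2 := sum_left_le (n := n) (v := fun i => ε i ^ 2) fun i => sq_nonneg _
  have s3 := sum_right_le (n := n) (v := fun i => ε i ^ 2) fun i => sq_nonneg _
  have s4 : ∑ i ∈ range n, (ε (i + 1) + a * (ε (i + 2) - 2 * ε (i + 1) + ε i) - σ (i + 1)) ^ 2 ≤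
      ∑ i ∈ range n, (2 * (1 - 2 * a) * ε (i + 1) ^ 2 + 2 * a * ε i ^ 2 + 2 * a * ε (i + 2) ^ 2
        + 2 * G ^ 2) :=
    sum_le_sum fun i hi => by
      have hs : σ (i + 1) ^ 2 ≤ G ^ 2 := sq_le_sq' (by linarith [(abs_le.1 (hσ i (mem_range.1 hi))).1]) (abs_le.1 (hσ i (mem_range.1 hi))).2
      have c1 : (ε (i + 1) + a * (ε (i + 2) - 2 * ε (i + 1) + ε i) - σ (i + 1)) ^ 2 ≤
        2 * (ε (i + 1) + a * (ε (i + 2) - 2 * ε (i + 1) + ε i)) ^ 2 + 2 * σ (i + 1) ^ 2 := by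
        nlinarith [sq_nonneg (ε (i + 1) + a * (ε (i + 2) - 2 * ε (i + 1) + ε i) + σ (i + 1))]
      have c2 : (ε (i + 1) + a * (ε (i + 2) - 2 * ε (i + 1) + ε i)) ^ 2 ≤
        (1 - 2 * a) * ε (i + 1) ^ 2 + a * ε i ^ 2 + a * ε (i + 2) ^ 2 := by
        have d1 := mul_nonneg (mul_nonneg ha0 (by linarith : (0 : ℝ) ≤ 1 - 2 * a)) (sq_nonneg (ε (i + 1) - ε i))
        have d2 := mul_nonneg (mul_nonneg ha0 (by linarith : (0 : ℝ) ≤ 1 - 2 * a)) (sq_nonneg (ε (i + 1) - ε (i + 2)))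
        have d3 := mul_nonneg (mul_nonneg ha0 ha0) (sq_nonneg (ε i - ε (i + 2)))
        linarith
      linarith
  simp only [sum_add_distrib, ← mul_sum, sum_const, card_range, nsmul_eq_mul] at s4
  have k1 := mul_le_mul_of_nonneg_left s2 ha0
  have k2 := mul_le_mul_of_nonneg_left s3 ha0
  have k3 := mul_le_mul_of_nonneg_left s1 (by linarith : (0 : ℝ) ≤ 1 - 2 * a)
  linarith

/-- Moving one difference onto `e` gains the factor `h`, which makes this term absorbable on fine
meshes. -/
lemma abs_sum_mul_second_le (hh : 0 < h) (h0 : e 0 = 0) (h1 : e (n + 1) = 0) :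
    |h * ∑ i ∈ range n, e (i + 1) * (ε (i + 2) - 2 * ε (i + 1) + ε i)| ≤
      h / 2 * (gradForm n h e e + 4 * (h * ∑ i ∈ range (n + 2), ε i ^ 2)) := by
  rw [sum_by_parts_of_zero ε h0 h1, mul_neg, abs_neg, abs_mul, abs_of_pos hh]
  have s1 : |∑ i ∈ range (n + 1), (ε (i + 1) - ε i) * (e (i + 1) - e i)| ≤
      ∑ i ∈ range (n + 1), ((e (i + 1) - e i) * (e (i + 1) - e i) / (2 * h)
        + h * (ε (i + 1) ^ 2 + ε i ^ 2)) := by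
    refine (abs_sum_le_sum_abs _ _).trans (sum_le_sum fun i _ => ?_)
    set x := ε (i + 1) - ε i with hx
    set y := e (i + 1) - e i
    have hx2 : x ^ 2 ≤ 2 * (ε (i + 1) ^ 2 + ε i ^ 2) := by
      nlinarith [sq_nonneg (ε (i + 1) + ε i)]
    have hy : |x * y| ≤ y * y / (2 * h) + h / 2 * x ^ 2 := by
      have : y * y / (2 * h) + h / 2 * x ^ 2 - x * y = (y - h * x) ^ 2 / (2 * h) := by
        field_simp; ring
      have h2 : y * y / (2 * h) + h / 2 * x ^ 2 + x * y = (y + h * x) ^ 2 / (2 * h) := by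
        field_simp; ring
      have p1 : 0 ≤ (y - h * x) ^ 2 / (2 * h) := by positivity
      have p2 : 0 ≤ (y + h * x) ^ 2 / (2 * h) := by positivity
      rw [abs_le]; constructor <;> linarith
    nlinarith
  have e1 : ∑ i ∈ range (n + 1), ((e (i + 1) - e i) * (e (i + 1) - e i) / (2 * h)
        + h * (ε (i + 1) ^ 2 + ε i ^ 2)) = gradForm n h e e / 2
        + h * (∑ i ∈ range (n + 1), ε (i + 1) ^ 2 + ∑ i ∈ range (n + 1), ε i ^ 2) := by
    rw [sum_add_distrib, ← sum_div, ← mul_sum, sum_add_distrib, gradForm]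
    field_simp
  have e2 : ∑ i ∈ range (n + 1), ε (i + 1) ^ 2 ≤ ∑ i ∈ range (n + 2), ε i ^ 2 := by
    rw [sum_range_succ' _ (n + 1)]; linarith [sq_nonneg (ε 0)]
  have e3 : ∑ i ∈ range (n + 1), ε i ^ 2 ≤ ∑ i ∈ range (n + 2), ε i ^ 2 := by
    rw [sum_range_succ _ (n + 1)]; linarith [sq_nonneg (ε (n + 1))]
  rw [e1] at s1
  have k := mul_le_mul_of_nonneg_left (add_le_add e2 e3) hh.le
  nlinarith [mul_le_mul_of_nonneg_left (s1.trans (add_le_add_right k _)) hh.le]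

/-- The centred difference of `e` inside `p` drops out by skew-symmetry; what is left carries the
factor `a h`. -/
lemma SplineRelations.abs_sum_mul_first_le (H : SplineRelations n a h e ε p σ) (hh : 0 < h)
    (ha0 : 0 ≤ a) (ha : a ≤ 1 / 5) (h0 : e 0 = 0) (h1 : e (n + 1) = 0) :
    |h * ∑ i ∈ range n, e (i + 1) * p (i + 1)| ≤
      h / 20 * (massForm n h e e + 4 * (h * ∑ i ∈ range (n + 2), ε i ^ 2)) := by
  have e1 : ∑ i ∈ range n, e (i + 1) * p (i + 1) =
      -(a * h / 2 * ∑ i ∈ range n, e (i + 1) * (ε (i + 2) - ε i)) := by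
    have : ∑ i ∈ range n, e (i + 1) * p (i + 1) =
        ∑ i ∈ range n, (1 / (2 * h) * (e (i + 1) * (e (i + 2) - e i))
          - a * h / 2 * (e (i + 1) * (ε (i + 2) - ε i))) :=
      sum_congr rfl fun i hi => by rw [H.first i (mem_range.1 hi)]; ring
    rw [this, sum_sub_distrib, ← mul_sum, ← mul_sum, sum_centered_eq_zero h0 h1]
    ring
  have s2 := sum_left_le (n := n) (v := fun i => ε i ^ 2) fun i => sq_nonneg _
  have s3 := sum_right_le (n := n) (v := fun i => ε i ^ 2) fun i => sq_nonneg _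
  have s1 : |∑ i ∈ range n, e (i + 1) * (ε (i + 2) - ε i)| ≤
      ∑ i ∈ range n, (1 / 2 * (e (i + 1) * e (i + 1)) + ε (i + 2) ^ 2 + ε i ^ 2) := by
    refine (abs_sum_le_sum_abs _ _).trans (sum_le_sum fun i _ => ?_)
    rw [abs_le]
    constructor <;> nlinarith [sq_nonneg (e (i + 1) + (ε (i + 2) - ε i)),
      sq_nonneg (e (i + 1) - (ε (i + 2) - ε i)), sq_nonneg (ε (i + 2) + ε i)]
  simp only [sum_add_distrib, ← mul_sum] at s1
  rw [e1, mul_neg, abs_neg, abs_mul, abs_of_pos hh, abs_mul,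
    abs_of_nonneg (by positivity : 0 ≤ a * h / 2), massForm]
  set W := ∑ i ∈ range (n + 2), ε i ^ 2
  set M := ∑ i ∈ range n, e (i + 1) * e (i + 1)
  have M0 : 0 ≤ M := sum_nonneg fun i _ => mul_self_nonneg _
  have W0 : 0 ≤ W := sum_nonneg fun i _ => sq_nonneg _
  calc h * (a * h / 2 * |∑ i ∈ range n, e (i + 1) * (ε (i + 2) - ε i)|)
      ≤ h * ((1 / 5) * h / 2 * (1 / 2 * M + W + W)) := by
        gcongr; linarith
    _ ≤ _ := by nlinarith

/-- The constant `8` is `1 + 1` from the interior centred differences plus `3 + 3` from the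
one-sided formulas at the two ends. -/
lemma SplineRelations.sum_first_sq_le (H : SplineRelations n a h e ε p σ) (hh : 0 < h)
    (ha0 : 0 ≤ a) (ha : a ≤ 1 / 5) :
    h * (∑ i ∈ range n, p (i + 1) ^ 2 + p 0 ^ 2 + p (n + 1) ^ 2) ≤
      8 * gradForm n h e e + 4 * h ^ 2 * (h * ∑ i ∈ range (n + 2), ε i ^ 2) := by
  have s2 := sum_left_le (n := n) (v := fun i => ε i ^ 2) fun i => sq_nonneg _
  have s3 := sum_right_le (n := n) (v := fun i => ε i ^ 2) fun i => sq_nonneg _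
  have a2 : a ^ 2 ≤ 1 / 25 := by nlinarith
  have hδ : ∀ x y : ℝ, (x - y) ^ 2 ≤ 2 * (x ^ 2 + y ^ 2) := fun x y => by
    nlinarith [sq_nonneg (x + y)]
  have ht : ∀ x y z : ℝ, (x + y + z) ^ 2 ≤ 3 * (x ^ 2 + y ^ 2 + z ^ 2) := fun x y z => by
    nlinarith [sq_nonneg (x - y), sq_nonneg (y - z), sq_nonneg (x - z)]
  have s1 : ∑ i ∈ range n, p (i + 1) ^ 2 ≤ ∑ i ∈ range n,
      (1 / h ^ 2 * (e (i + 1) - e i) ^ 2 + 1 / h ^ 2 * (e (i + 1 + 1) - e (i + 1)) ^ 2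
        + h ^ 2 / 25 * ε (i + 2) ^ 2 + h ^ 2 / 25 * ε i ^ 2) := by
    refine sum_le_sum fun i hi => ?_
    rw [H.first i (mem_range.1 hi)]
    have c1 : ((e (i + 2) - e i) / (2 * h)) ^ 2 ≤ 1 / (2 * h ^ 2) *
        ((e (i + 1) - e i) ^ 2 + (e (i + 1 + 1) - e (i + 1)) ^ 2) := by
      have : ((e (i + 2) - e i) / (2 * h)) ^ 2 = 1 / (4 * h ^ 2) * (e (i + 2) - e i) ^ 2 := by
        field_simp; ring
      rw [this]
      have k := hδ (e (i + 2) - e (i + 1)) (e i - e (i + 1))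
      calc 1 / (4 * h ^ 2) * (e (i + 2) - e i) ^ 2
          ≤ 1 / (4 * h ^ 2) * (2 * ((e (i + 2) - e (i + 1)) ^ 2 + (e i - e (i + 1)) ^ 2)) := by
            gcongr; linarith
        _ = _ := by field_simp; ring
    have c2 : (a * h / 2 * (ε (i + 2) - ε i)) ^ 2 ≤ h ^ 2 / 50 * (ε (i + 2) ^ 2 + ε i ^ 2) := by
      have : (a * h / 2 * (ε (i + 2) - ε i)) ^ 2 = a ^ 2 * (h ^ 2 / 4 * (ε (i + 2) - ε i) ^ 2) := by
        ring
      rw [this]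
      calc a ^ 2 * (h ^ 2 / 4 * (ε (i + 2) - ε i) ^ 2)
          ≤ 1 / 25 * (h ^ 2 / 4 * (2 * (ε (i + 2) ^ 2 + ε i ^ 2))) := by
            gcongr; exact hδ _ _
        _ = _ := by ring
    have c3 := hδ ((e (i + 2) - e i) / (2 * h)) (a * h / 2 * (ε (i + 2) - ε i))
    have c4 : 2 * (1 / (2 * h ^ 2) *
        ((e (i + 1) - e i) ^ 2 + (e (i + 1 + 1) - e (i + 1)) ^ 2)) =
        1 / h ^ 2 * (e (i + 1) - e i) ^ 2 + 1 / h ^ 2 * (e (i + 1 + 1) - e (i + 1)) ^ 2 := by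
      field_simp
    linarith
  simp only [sum_add_distrib, ← mul_sum] at s1
  set g := ∑ i ∈ range (n + 1), (e (i + 1) - e i) ^ 2 with hg
  have g1 : ∑ i ∈ range n, (e (i + 1) - e i) ^ 2 ≤ g := by
    rw [hg, sum_range_succ]; linarith [sq_nonneg (e (n + 1) - e n)]
  have g2 : ∑ i ∈ range n, (e (i + 1 + 1) - e (i + 1)) ^ 2 ≤ g := by
    rw [hg, sum_range_succ']; linarith [sq_nonneg (e (0 + 1) - e 0)]
  have g3 : (e 1 - e 0) ^ 2 ≤ g := by
    rw [hg, sum_range_succ']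
    have : 0 ≤ ∑ i ∈ range n, (e (i + 1 + 1) - e (i + 1)) ^ 2 := sum_nonneg fun i _ => sq_nonneg _
    linarith
  have g4 : (e (n + 1) - e n) ^ 2 ≤ g := by
    rw [hg, sum_range_succ]
    have : 0 ≤ ∑ i ∈ range n, (e (i + 1) - e i) ^ 2 := sum_nonneg fun i _ => sq_nonneg _
    linarith
  set W := ∑ i ∈ range (n + 2), ε i ^ 2 with hW
  have hWm : ∀ m ≤ n + 1, ε m ^ 2 ≤ W := fun m hm =>
    single_le_sum (f := fun i => ε i ^ 2) (fun i _ => sq_nonneg _) (mem_range.2 (by omega))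
  have W01 : ε 0 ^ 2 + ε 1 ^ 2 ≤ W := by
    rw [hW, sum_range_succ', sum_range_succ']
    have : 0 ≤ ∑ i ∈ range n, ε (i + 1 + 1) ^ 2 := sum_nonneg fun i _ => sq_nonneg _
    simp only [zero_add]; linarith
  have Wn1 : ε n ^ 2 + ε (n + 1) ^ 2 ≤ W := by
    rw [hW, sum_range_succ, sum_range_succ]
    have : 0 ≤ ∑ i ∈ range n, ε i ^ 2 := sum_nonneg fun i _ => sq_nonneg _
    linarith
  have hgf : gradForm n h e e = h * (1 / h ^ 2 * g) := by
    rw [hg, gradForm]; simp only [sq]; field_simp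
  have bd : ∀ x y z w : ℝ, x ^ 2 ≤ g → y ^ 2 + z ^ 2 ≤ W → w ^ 2 ≤ W →
      (x / h + (-(a * h * (y - z))) + h / 2 * w) ^ 2 ≤ 3 * (1 / h ^ 2 * g) + 3 / 2 * h ^ 2 * W := by
    intro x y z w hx hyz hw
    have k1 := ht (x / h) (-(a * h * (y - z))) (h / 2 * w)
    have k2 : (x / h) ^ 2 ≤ 1 / h ^ 2 * g := by
      rw [div_pow, div_eq_inv_mul, ← one_div]; gcongr
    have k3 : (-(a * h * (y - z))) ^ 2 ≤ 2 / 25 * h ^ 2 * W := by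
      have : (-(a * h * (y - z))) ^ 2 = a ^ 2 * (h ^ 2 * (y - z) ^ 2) := by ring
      rw [this]
      calc a ^ 2 * (h ^ 2 * (y - z) ^ 2) ≤ 1 / 25 * (h ^ 2 * (2 * W)) := by
            gcongr; linarith [hδ y z]
        _ = _ := by ring
    have k4 : (h / 2 * w) ^ 2 ≤ h ^ 2 / 4 * W := by
      have : (h / 2 * w) ^ 2 = h ^ 2 / 4 * w ^ 2 := by ring
      rw [this]; gcongr
    have : 0 ≤ h ^ 2 * W := mul_nonneg (sq_nonneg _) (sum_nonneg fun i _ => sq_nonneg _)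
    linarith
  have p0 : p 0 ^ 2 ≤ 3 * (1 / h ^ 2 * g) + 3 / 2 * h ^ 2 * W := by
    have := bd (e 1 - e 0) (ε 1) (ε 0) (-ε 0) g3 (by linarith) (by rw [neg_sq]; exact hWm 0 (by omega))
    convert this using 2
    rw [H.first_left]; ring
  have pn : p (n + 1) ^ 2 ≤ 3 * (1 / h ^ 2 * g) + 3 / 2 * h ^ 2 * W := by
    have := bd (e (n + 1) - e n) (ε (n + 1)) (ε n) (ε (n + 1)) g4 (by linarith) (hWm _ le_rfl)
    convert this using 2
    rw [H.first_right]; ring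
  have i1 : 1 / h ^ 2 * ∑ i ∈ range n, (e (i + 1) - e i) ^ 2 ≤ 1 / h ^ 2 * g := by gcongr
  have i2 : 1 / h ^ 2 * ∑ i ∈ range n, (e (i + 1 + 1) - e (i + 1)) ^ 2 ≤ 1 / h ^ 2 * g := by gcongr
  have i3 : h ^ 2 / 25 * ∑ i ∈ range n, ε (i + 2) ^ 2 ≤ h ^ 2 / 25 * W := by gcongr
  have i4 : h ^ 2 / 25 * ∑ i ∈ range n, ε i ^ 2 ≤ h ^ 2 / 25 * W := by gcongr
  rw [hgf]
  have key : ∑ i ∈ range n, p (i + 1) ^ 2 + p 0 ^ 2 + p (n + 1) ^ 2 ≤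
      8 * (1 / h ^ 2 * g) + 4 * h ^ 2 * W := by
    have : 0 ≤ h ^ 2 * W := mul_nonneg (sq_nonneg _) (sum_nonneg fun i _ => sq_nonneg _)
    linarith
  calc h * (∑ i ∈ range n, p (i + 1) ^ 2 + p 0 ^ 2 + p (n + 1) ^ 2)
      ≤ h * (8 * (1 / h ^ 2 * g) + 4 * h ^ 2 * W) := by gcongr
    _ = _ := by ring

end

end

/-! ### The energy estimate for one implicit step -/

section
open Finset

lemma mul_le_young {x y d : ℝ} (hd : 0 < d) : x * y ≤ d * x ^ 2 + y ^ 2 / (4 * d) := by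
  have : d * x ^ 2 + y ^ 2 / (4 * d) - x * y = (2 * d * x - y) ^ 2 / (4 * d) := by
    field_simp; ring
  have : 0 ≤ (2 * d * x - y) ^ 2 / (4 * d) := by positivity
  linarith

/-- The weight of the mass form in the energy. -/
noncomputable def energyWeight (α β : ℝ) : ℝ := 6400 * (β / α) ^ 2 + 1

/-- The mesh width below which the energy estimate holds. -/
noncomputable def energyMesh (α β L : ℝ) : ℝ :=
  min 1 (min (α / (|β| * L ^ 2 + 1))
    (9 / 200 * α / (energyWeight α β * α + 200 * β ^ 2 / α + energyWeight α β * |β| + 1)))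

lemma energyWeight_pos (α β : ℝ) : 0 < energyWeight α β := by unfold energyWeight; positivity

lemma energyMesh_pos {α β L : ℝ} (hα : 0 < α) : 0 < energyMesh α β L := by
  have := energyWeight_pos α β
  unfold energyMesh
  positivity

/-- The constant of the energy estimate. -/
noncomputable def energyConst (α β L : ℝ) : ℝ :=
  L * (10 * α + 2 * energyWeight α β * α * L ^ 2 + α + 400 / α
    + energyWeight α β * (2 * L ^ 2 / α))

lemma energyConst_nonneg {α β L : ℝ} (hα : 0 < α) (hL : 0 < L) : 0 ≤ energyConst α β L := by
  have := energyWeight_pos α β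
  unfold energyConst
  positivity

/-- The absorption argument, separated from the sums. `Z` stands for `h Σ ε²`, `X` and `M` for the
gradient and mass of `e`, `G2` for the squared source. The coefficient of `K α X` is at most `-13/40
+ 1/16 + 1/20 + 1/8 < 0`. That of `α Z` is `-3/40 + 3/100 = -9/200`, and `energyMesh` is chosen so
that the terms of size `h Z` fit into it. -/
lemma energy_arith {α β γ L b h K Q Z X M A B S Y V G2 R : ℝ}
    (hα : 0 < α) (hγ : 0 ≤ γ) (hL : 0 < L) (hh : 0 < h) (hK : K = energyWeight α β)
    (hh0 : h ≤ energyMesh α β L)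
    (hb : 1 / 2 ≤ b) (hb2 : b ≤ 2) (hZ : 0 ≤ Z) (hX : 0 ≤ X) (hM : M ≤ L ^ 2 * X)
    (hG : 0 ≤ G2) (hQ : 1 / 5 * Z ≤ Q) (hA : -A ≤ h / 10 * (X + 4 * Z))
    (hB : B ≤ |β| * (h / 20 * (M + 4 * Z)))
    (hS : S ≤ 3 * Z + 2 * (L * G2)) (hV : V ≤ 8 * X + 4 * h ^ 2 * Z)
    (hR : R ≤ 2 * (L * G2))
    (hY : Y ≤ -(α * b * Q) + α * b * (Z / 20 + 5 * (L * G2))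
      + K * (α * b) * (-X + M / (4 * L ^ 2) + L ^ 2 * (L * G2) - A)
      + α / 100 * S + 50 * β ^ 2 / α * V + K * B - γ * X + 50 / α * R
      + K * α / (8 * L ^ 2) * M + K * (2 * L ^ 2 / α) * (L * G2)) :
    Y ≤ energyConst α β L * G2 := by
  have K0 : 0 < K := hK ▸ energyWeight_pos α β
  have h1 : h ≤ 1 := hh0.trans (min_le_left _ _)
  have h2 : h * (|β| * L ^ 2 + 1) ≤ α := by
    have := hh0.trans ((min_le_right _ _).trans (min_le_left _ _))
    rwa [le_div_iff₀ (by positivity)] at this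
  have h3 : h * (K * α + 200 * β ^ 2 / α + K * |β| + 1) ≤ 9 / 200 * α := by
    have := hh0.trans ((min_le_right _ _).trans (min_le_right _ _))
    rw [← hK] at this
    rwa [le_div_iff₀ (by positivity)] at this
  -- This explains the number `6400` in `energyWeight`: the gradient part of the convection costs
  -- one sixteenth of `K α X`.
  have hKe : 400 * β ^ 2 / α = (K - 1) * α / 16 := by
    rw [hK, energyWeight]; field_simp; ring
  have hM' : M / (4 * L ^ 2) ≤ X / 4 := by
    rw [div_le_iff₀ (by positivity)]; linarith
  have LG : 0 ≤ L * G2 := by positivity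
  have hL2 : 0 ≤ L ^ 2 * (L * G2) := by positivity
  have t1 : -(α * b * Q) + α * b * (Z / 20 + 5 * (L * G2)) ≤
      -(3 / 40) * (α * Z) + 10 * α * (L * G2) := by
    have : α * b * (3 / 20 * Z) ≤ α * b * (Q - Z / 20) := by gcongr; linarith
    have k2 : α * (1 / 2) * (3 / 20 * Z) ≤ α * b * (3 / 20 * Z) := by gcongr
    have k3 : α * b * (5 * (L * G2)) ≤ α * 2 * (5 * (L * G2)) := by gcongr
    linarith
  have t2 : K * (α * b) * (-X + M / (4 * L ^ 2) + L ^ 2 * (L * G2) - A) ≤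
      -(13 / 40) * (K * α * X) + 2 * (K * α) * (L ^ 2 * (L * G2)) + 4 / 5 * (K * α * h) * Z := by
    have hhX : h * X ≤ X := by nlinarith
    have k0 : -X + M / (4 * L ^ 2) + L ^ 2 * (L * G2) - A ≤
      -(13 / 20 * X) + L ^ 2 * (L * G2) + 2 / 5 * h * Z := by linarith
    have k1 : K * (α * b) * (-X + M / (4 * L ^ 2) + L ^ 2 * (L * G2) - A) ≤
      K * (α * b) * (-(13 / 20 * X) + L ^ 2 * (L * G2) + 2 / 5 * h * Z) := by gcongr
    have k2 : K * (α * (1 / 2)) * (13 / 20 * X) ≤ K * (α * b) * (13 / 20 * X) := by gcongr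
    have k3 : K * (α * b) * (L ^ 2 * (L * G2) + 2 / 5 * h * Z) ≤
      K * (α * 2) * (L ^ 2 * (L * G2) + 2 / 5 * h * Z) := by gcongr
    linarith
  have t3 : α / 100 * S ≤ 3 / 100 * (α * Z) + α * (L * G2) := by
    have : α / 100 * S ≤ α / 100 * (3 * Z + 2 * (L * G2)) := by gcongr
    have k := mul_nonneg hα.le LG
    linarith
  have t4 : 50 * β ^ 2 / α * V ≤ (K - 1) * α / 16 * X + 200 * β ^ 2 / α * h * Z := by
    have : 50 * β ^ 2 / α * V ≤ 50 * β ^ 2 / α * (8 * X + 4 * h ^ 2 * Z) := by gcongr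
    have k2 : 200 * β ^ 2 / α * (h ^ 2) * Z ≤ 200 * β ^ 2 / α * h * Z := by
      gcongr; nlinarith
    rw [← hKe]
    calc _ ≤ _ := this
      _ = 400 * β ^ 2 / α * X + 200 * β ^ 2 / α * (h ^ 2) * Z := by ring
      _ ≤ _ := by linarith
  have t5 : K * B ≤ 1 / 20 * (K * α * X) + K * |β| * h * Z / 5 := by
    have k1 : K * B ≤ K * (|β| * (h / 20 * (L ^ 2 * X + 4 * Z))) := by
      gcongr; exact hB.trans (by gcongr)
    have k2 : h * (|β| * L ^ 2) * (K * X / 20) ≤ α * (K * X / 20) := by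
      gcongr; linarith
    linarith
  have t6 : 50 / α * R ≤ 100 / α * (L * G2) := by
    have : 50 / α * R ≤ 50 / α * (2 * (L * G2)) := by gcongr
    calc _ ≤ _ := this
      _ = _ := by ring
  have t7 : K * α / (8 * L ^ 2) * M ≤ 1 / 8 * (K * α * X) := by
    have : K * α / (8 * L ^ 2) * M ≤ K * α / (8 * L ^ 2) * (L ^ 2 * X) := by gcongr
    refine this.trans (le_of_eq ?_)
    field_simp
  have t8 : h * (K * α + 200 * β ^ 2 / α + K * |β| + 1) * Z ≤ 9 / 200 * α * Z := by gcongr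
  have t9 : 0 ≤ γ * X := by positivity
  have e : energyConst α β L * G2 = 10 * α * (L * G2) + 2 * (K * α) * (L ^ 2 * (L * G2))
      + α * (L * G2) + 400 / α * (L * G2) + K * (2 * L ^ 2 / α) * (L * G2) := by
    rw [energyConst, hK]; ring
  have t10 : 100 / α * (L * G2) ≤ 400 / α * (L * G2) := by gcongr; norm_num
  have n1 : 0 ≤ K * α * X := by positivity
  have n2 : 0 ≤ α * X := by positivity
  have n3 : 0 ≤ h * Z := by positivity
  have n4 : 0 ≤ K * α * h * Z := by positivity
  have n5 : 0 ≤ K * |β| * h * Z := by positivity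
  rw [e]
  linarith

set_option maxHeartbeats 400000 in
/-- Stability of one implicit step in the discrete energy. -/
theorem energy_step {n : ℕ} {a h b g α β γ L G : ℝ} {e f ε p σ τ : ℕ → ℝ}
    (hα : 0 < α) (hγ : 0 ≤ γ) (hh : 0 < h) (hL : L = (n + 1 : ℕ) * h)
    (hh0 : h ≤ energyMesh α β L) (ha0 : 0 ≤ a) (ha : a ≤ 1 / 5) (hb : 1 / 2 ≤ b) (hb2 : b ≤ 2)
    (hg : 0 < g) (H : SplineRelations n a h e ε p σ)
    (he0 : e 0 = 0) (he1 : e (n + 1) = 0) (hf0 : f 0 = 0) (hf1 : f (n + 1) = 0)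
    (hstep : ∀ m ≤ n + 1, e m - f m = g * (α * b * ε m + β * p m - γ * e m + τ m))
    (hσ : ∀ i < n, |σ (i + 1)| ≤ G) (hτ : ∀ m ≤ n + 1, |τ m| ≤ G) :
    gradForm n h e (fun m => e m - f m)
        + energyWeight α β * massForm n h e (fun m => e m - f m) ≤
      g * (energyConst α β L * G ^ 2) := by
  set K := energyWeight α β with hK
  have K0 : 0 < K := energyWeight_pos α β
  have hL0 : 0 < L := hL ▸ by positivity
  -- At interior nodes `D i` is the second difference quotient of `e` at node `i + 1`. The equation
  -- `e - f = g F` is tested with `K e - D`.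
  set D : ℕ → ℝ := fun i => ε (i + 1) + a * (ε (i + 2) - 2 * ε (i + 1) + ε i) - σ (i + 1) with hD
  set F : ℕ → ℝ := fun m => α * b * ε m + β * p m - γ * e m + τ m with hF
  have hnh : (n : ℝ) * h ≤ L := by rw [hL]; push_cast; linarith
  have sqb : ∀ x : ℝ, |x| ≤ G → x ^ 2 ≤ G ^ 2 := fun x hx =>
    sq_le_sq' (by linarith [(abs_le.1 hx).1]) (abs_le.1 hx).2
  have hv0 : (fun m => e m - f m) 0 = 0 := by simp [he0, hf0]
  have hv1 : (fun m => e m - f m) (n + 1) = 0 := by simp [he1, hf1]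
  -- The equation holds at the end nodes too, where new value and history both vanish.
  have b0 : F 0 = 0 := by
    have := hstep 0 (by omega)
    rw [he0, hf0, sub_zero, eq_comm, mul_eq_zero] at this
    exact he0 ▸ this.resolve_left hg.ne'
  have b1 : F (n + 1) = 0 := by
    have := hstep (n + 1) le_rfl
    rw [he1, hf1, sub_zero, eq_comm, mul_eq_zero] at this
    exact he1 ▸ this.resolve_left hg.ne'
  -- The two end terms are zero; they are added because they contain `-α b ε²` at the end nodes,
  -- which completes the coercive form of `sum_quadratic_ge`.
  have eY : gradForm n h e (fun m => e m - f m) + K * massForm n h e (fun m => e m - f m) =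
      g * (h * ∑ i ∈ range n, F (i + 1) * (K * e (i + 1) - D i)
        + h * (-(F 0 * ε 0) - F (n + 1) * ε (n + 1))) := by
    rw [b0, b1, ← neg_neg (gradForm _ _ _ _), ← H.sum_mul_second hh hv0 hv1, massForm]
    have : ∑ i ∈ range n, F (i + 1) * (K * e (i + 1) - D i) =
        K * (∑ i ∈ range n, e (i + 1) * F (i + 1)) - ∑ i ∈ range n, F (i + 1) * D i := by
      rw [mul_sum, ← sum_sub_distrib]
      exact sum_congr rfl fun i _ => by ring
    rw [this]
    have e1 : ∑ i ∈ range n, e (i + 1) * (fun m => e m - f m) (i + 1) =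
        g * ∑ i ∈ range n, e (i + 1) * F (i + 1) := by
      rw [mul_sum]
      refine sum_congr rfl fun i hi => ?_
      have := hstep (i + 1) (by have := mem_range.1 hi; omega)
      simp only [this, hF]; ring
    have e2 : ∑ i ∈ range n, (fun m => e m - f m) (i + 1) * D i =
        g * ∑ i ∈ range n, F (i + 1) * D i := by
      rw [mul_sum]
      refine sum_congr rfl fun i hi => ?_
      have := hstep (i + 1) (by have := mem_range.1 hi; omega)
      simp only [this, hF]; ring
    rw [e1, e2]
    ring
  rw [eY]
  refine mul_le_mul_of_nonneg_left ?_ hg.le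
  set W := ∑ i ∈ range (n + 2), ε i ^ 2 with hW
  have W0 : 0 ≤ W := sum_nonneg fun i _ => sq_nonneg _
  have hX := gradForm_self_nonneg (n := n) hh e
  have hM := massForm_self_le (n := n) hh he0
  rw [← hL] at hM
  have hd : 0 < α / 200 := by positivity
  have d4 : ∀ y : ℝ, y / (4 * (α / 200)) = 50 / α * y := fun y => by field_simp; ring
  -- interior nodes
  have hint : ∑ i ∈ range n, F (i + 1) * (K * e (i + 1) - D i) ≤ ∑ i ∈ range n,
      (-(α * b) * (ε (i + 1) * (ε (i + 1) + a * (ε (i + 2) - 2 * ε (i + 1) + ε i)))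
        + α * b / 20 * ε (i + 1) ^ 2 + (α * b * 5 + K * (α * b) * L ^ 2 + K * (2 * L ^ 2 / α)) * G ^ 2
        + (K * (α * b) + γ) * (e (i + 1) * D i)
        + (K * (α * b) / (4 * L ^ 2) + K * α / (8 * L ^ 2)) * (e (i + 1) * e (i + 1))
        - K * (α * b) * a * (e (i + 1) * (ε (i + 2) - 2 * ε (i + 1) + ε i))
        + α / 100 * D i ^ 2 + 50 * β ^ 2 / α * p (i + 1) ^ 2
        + K * β * (e (i + 1) * p (i + 1)) + 50 / α * τ (i + 1) ^ 2) := by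
    refine sum_le_sum fun i hi => ?_
    have hi' := mem_range.1 hi
    have hσ2 := sqb _ (hσ i hi')
    have hτ2 := sqb _ (hτ (i + 1) (by omega))
    have y1 : ε (i + 1) * σ (i + 1) ≤ 1 / 20 * ε (i + 1) ^ 2 + 5 * G ^ 2 := by
      have := mul_le_young (x := ε (i + 1)) (y := σ (i + 1)) (d := 1 / 20) (by norm_num)
      norm_num at this
      linarith
    have y2 : e (i + 1) * σ (i + 1) ≤ 1 / (4 * L ^ 2) * e (i + 1) ^ 2 + L ^ 2 * G ^ 2 := by
      have := mul_le_young (x := e (i + 1)) (y := σ (i + 1)) (d := 1 / (4 * L ^ 2)) (by positivity)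
      have e3 : σ (i + 1) ^ 2 / (4 * (1 / (4 * L ^ 2))) = L ^ 2 * σ (i + 1) ^ 2 := by field_simp
      rw [e3] at this
      have : L ^ 2 * σ (i + 1) ^ 2 ≤ L ^ 2 * G ^ 2 := by gcongr
      linarith
    have y3 := mul_le_young (x := D i) (y := -(β * p (i + 1))) hd
    have y4 := mul_le_young (x := D i) (y := -τ (i + 1)) hd
    rw [d4] at y3 y4
    have y5 : e (i + 1) * τ (i + 1) ≤ α / (8 * L ^ 2) * e (i + 1) ^ 2 + 2 * L ^ 2 / α * G ^ 2 := by
      have := mul_le_young (x := e (i + 1)) (y := τ (i + 1)) (d := α / (8 * L ^ 2)) (by positivity)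
      have e3 : τ (i + 1) ^ 2 / (4 * (α / (8 * L ^ 2))) = 2 * L ^ 2 / α * τ (i + 1) ^ 2 := by
        field_simp; ring
      rw [e3] at this
      have : 2 * L ^ 2 / α * τ (i + 1) ^ 2 ≤ 2 * L ^ 2 / α * G ^ 2 := by gcongr
      linarith
    have z1 : α * b * (ε (i + 1) * σ (i + 1)) ≤ α * b * (1 / 20 * ε (i + 1) ^ 2 + 5 * G ^ 2) :=
      mul_le_mul_of_nonneg_left y1 (by positivity)
    have z2 : K * (α * b) * (e (i + 1) * σ (i + 1)) ≤
      K * (α * b) * (1 / (4 * L ^ 2) * e (i + 1) ^ 2 + L ^ 2 * G ^ 2) :=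
      mul_le_mul_of_nonneg_left y2 (by positivity)
    have z5 : K * (e (i + 1) * τ (i + 1)) ≤
      K * (α / (8 * L ^ 2) * e (i + 1) ^ 2 + 2 * L ^ 2 / α * G ^ 2) :=
      mul_le_mul_of_nonneg_left y5 K0.le
    have z6 : 0 ≤ K * γ * e (i + 1) ^ 2 := by positivity
    -- Used only in the product of `ε` with `K e`: it produces `e D`, whose sum is minus the
    -- gradient form, and a small term in `e δ²ε`.
    have hε : ε (i + 1) = D i + σ (i + 1) - a * (ε (i + 2) - 2 * ε (i + 1) + ε i) := by
      simp only [hD]; ring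
    have expand : F (i + 1) * (K * e (i + 1) - D i) =
      -(α * b) * (ε (i + 1) * (ε (i + 1) + a * (ε (i + 2) - 2 * ε (i + 1) + ε i)))
      + α * b * (ε (i + 1) * σ (i + 1))
      + K * (α * b) * (e (i + 1) * (D i + σ (i + 1) - a * (ε (i + 2) - 2 * ε (i + 1) + ε i)))
      + D i * -(β * p (i + 1)) + K * β * (e (i + 1) * p (i + 1)) + γ * (e (i + 1) * D i)
      - K * γ * e (i + 1) ^ 2 + D i * -τ (i + 1) + K * (e (i + 1) * τ (i + 1)) := by
      rw [← hε]
      simp only [hF, hD]; ring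
    rw [expand]
    have r1 : K * (α * b) * (1 / (4 * L ^ 2) * e (i + 1) ^ 2) + K * (α / (8 * L ^ 2) * e (i + 1) ^ 2)
      = (K * (α * b) / (4 * L ^ 2) + K * α / (8 * L ^ 2)) * (e (i + 1) * e (i + 1)) := by ring
    have r2 : 50 / α * (-(β * p (i + 1))) ^ 2 = 50 * β ^ 2 / α * p (i + 1) ^ 2 := by ring
    have r3 : 50 / α * (-τ (i + 1)) ^ 2 = 50 / α * τ (i + 1) ^ 2 := by ring
    linarith
  -- boundary nodes
  have hbd : ∀ m, -(F m * ε m) ≤ -(α * b) * ε m ^ 2 + γ * (e m * ε m) + α / 100 * ε m ^ 2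
      + 50 * β ^ 2 / α * p m ^ 2 + 50 / α * τ m ^ 2 := by
    intro m
    have y3 := mul_le_young (x := ε m) (y := -(β * p m)) hd
    have y4 := mul_le_young (x := ε m) (y := -τ m) hd
    rw [d4] at y3 y4
    have r2 : 50 / α * (-(β * p m)) ^ 2 = 50 * β ^ 2 / α * p m ^ 2 := by ring
    have r3 : 50 / α * (-τ m) ^ 2 = 50 / α * τ m ^ 2 := by ring
    simp only [hF]
    linarith
  have hbd0 := hbd 0
  have hbd1 := hbd (n + 1)
  rw [he0] at hbd0
  rw [he1] at hbd1
  simp only [sum_add_distrib, sum_sub_distrib, ← mul_sum, sum_const, card_range, nsmul_eq_mul] at hint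
  have hA := abs_le.1 (abs_sum_mul_second_le (ε := ε) (n := n) hh he0 he1)
  have hB := H.abs_sum_mul_first_le hh ha0 ha he0 he1
  have hV := H.sum_first_sq_le hh ha0 ha
  have hQ := sum_quadratic_ge (n := n) (ε := ε) ha0 ha
  have hS := sum_second_sq_le (n := n) (ε := ε) ha0 ha hσ
  have hDe := H.sum_mul_second hh he0 he1
  have hmid := sum_interior_add n (fun i => ε i ^ 2)
  have hR : ∑ i ∈ range n, τ (i + 1) ^ 2 ≤ n * G ^ 2 := by
    have : ∑ i ∈ range n, τ (i + 1) ^ 2 ≤ ∑ i ∈ range n, G ^ 2 :=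
      sum_le_sum fun i hi => sqb _ (hτ _ (by have := mem_range.1 hi; omega))
    simpa using this
  have hτ0 := sqb _ (hτ 0 (by omega))
  have hτ1 := sqb _ (hτ (n + 1) le_rfl)
  rw [← hW] at hA hB hV hQ hS
  rw [← hW] at hmid
  set Q := ∑ i ∈ range n, ε (i + 1) * (ε (i + 1) + a * (ε (i + 2) - 2 * ε (i + 1) + ε i))
  set A := ∑ i ∈ range n, e (i + 1) * (ε (i + 2) - 2 * ε (i + 1) + ε i)
  have hDe' : h * ∑ i ∈ range n, e (i + 1) * D i = -gradForm n h e e := hDe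
  have hS' : ∑ i ∈ range n, D i ^ 2 ≤ 2 * W + 2 * n * G ^ 2 := hS
  set SD := ∑ i ∈ range n, D i ^ 2
  set DE := ∑ i ∈ range n, e (i + 1) * D i
  set B := ∑ i ∈ range n, e (i + 1) * p (i + 1)
  set V := ∑ i ∈ range n, p (i + 1) ^ 2
  set R := ∑ i ∈ range n, τ (i + 1) ^ 2
  have hMe : massForm n h e e = h * ∑ i ∈ range n, e (i + 1) * e (i + 1) := rfl
  set E2 := ∑ i ∈ range n, e (i + 1) * e (i + 1)
  have hnG : h * (n * G ^ 2) ≤ L * G ^ 2 := by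
    calc h * (n * G ^ 2) = n * h * G ^ 2 := by ring
      _ ≤ _ := by gcongr
  have hn1G : h * (n * G ^ 2 + 2 * G ^ 2) ≤ 2 * (L * G ^ 2) := by
    have : h * (n * G ^ 2 + 2 * G ^ 2) = (n + 1 + 1) * h * G ^ 2 := by ring
    rw [this]
    have : ((n : ℝ) + 1 + 1) * h ≤ 2 * L := by
      have k1 : (0 : ℝ) ≤ n * h := by positivity
      have k2 : ((n : ℝ) + 1 + 1) * h = n * h + 2 * h := by ring
      have k3 : 2 * L = 2 * (n * h) + 2 * h := by rw [hL]; push_cast; ring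
      rw [k2, k3]; linarith only [k1]
    calc ((n : ℝ) + 1 + 1) * h * G ^ 2 ≤ 2 * L * G ^ 2 := by gcongr
      _ = _ := by ring
  refine energy_arith (γ := γ) (b := b) (h := h) (K := K) (β := β)
    (Q := h * (Q + ε 0 ^ 2 + ε (n + 1) ^ 2)) (Z := h * W) (X := gradForm n h e e)
    (M := massForm n h e e) (A := a * (h * A)) (B := β * (h * B))
    (S := h * (SD + ε 0 ^ 2 + ε (n + 1) ^ 2)) (V := h * (V + p 0 ^ 2 + p (n + 1) ^ 2))
    (R := h * (R + τ 0 ^ 2 + τ (n + 1) ^ 2)) hα hγ hL0 hh hK hh0 hb hb2 (by positivity) hX hM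
    (sq_nonneg G) ?_ ?_ ?_ ?_ hV ?_ ?_
  · have := mul_le_mul_of_nonneg_left hQ hh.le
    linarith
  · have k0 : 0 ≤ gradForm n h e e + 4 * (h * W) := by positivity
    have k1 : a * (-(h * A)) ≤ a * (h / 2 * (gradForm n h e e + 4 * (h * W))) :=
      mul_le_mul_of_nonneg_left (by linarith [hA.1]) ha0
    have k2 : a * (h / 2 * (gradForm n h e e + 4 * (h * W))) ≤
      1 / 5 * (h / 2 * (gradForm n h e e + 4 * (h * W))) := by gcongr
    linarith
  · calc β * (h * B) ≤ |β * (h * B)| := le_abs_self _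
      _ = |β| * |h * B| := abs_mul _ _
      _ ≤ _ := by gcongr
  · have : h * SD ≤ h * (2 * W + 2 * n * G ^ 2) := by gcongr
    have k2 : h * (ε 0 ^ 2 + ε (n + 1) ^ 2) ≤ h * W := by
      gcongr
      have : 0 ≤ ∑ i ∈ range n, ε (i + 1) ^ 2 := sum_nonneg fun i _ => sq_nonneg _
      linarith
    linarith
  · have : h * (R + τ 0 ^ 2 + τ (n + 1) ^ 2) ≤ h * (n * G ^ 2 + 2 * G ^ 2) :=
      mul_le_mul_of_nonneg_left (by linarith only [hR, hτ0, hτ1]) hh.le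
    linarith only [this, hn1G]
  · have k1 := mul_le_mul_of_nonneg_left hint hh.le
    have k2 := mul_le_mul_of_nonneg_left (add_le_add hbd0 hbd1) hh.le
    have c0 : 0 ≤ α * b * 5 + K * (α * b) * L ^ 2 + K * (2 * L ^ 2 / α) := by positivity
    have k3 := mul_le_mul_of_nonneg_left hnG c0
    have hmi : h * (α * b / 20 * ∑ i ∈ range n, ε (i + 1) ^ 2) ≤ α * b / 20 * (h * W) := by
      have : ∑ i ∈ range n, ε (i + 1) ^ 2 ≤ W := by
        linarith [sq_nonneg (ε 0), sq_nonneg (ε (n + 1))]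
      calc h * (α * b / 20 * ∑ i ∈ range n, ε (i + 1) ^ 2)
          ≤ h * (α * b / 20 * W) := by gcongr
        _ = _ := by ring
    have hde : h * ((K * (α * b) + γ) * DE) = (K * (α * b) + γ) * -gradForm n h e e := by
      rw [← hDe']; ring
    have hme : h * ((K * (α * b) / (4 * L ^ 2) + K * α / (8 * L ^ 2)) * E2) =
      (K * (α * b) / (4 * L ^ 2) + K * α / (8 * L ^ 2)) * massForm n h e e := by rw [hMe]; ring
    have expand :
      K * (α * b) * (-gradForm n h e e + massForm n h e e / (4 * L ^ 2) + L ^ 2 * (L * G ^ 2)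
        - a * (h * A)) = K * (α * b) * -gradForm n h e e
        + K * (α * b) / (4 * L ^ 2) * massForm n h e e + K * (α * b) * L ^ 2 * (L * G ^ 2)
        - K * (α * b) * a * (h * A) := by ring
    rw [expand]
    linarith

end

section
open Finset

/-! ### The L1 weights -/

section
variable {μ : ℝ}

lemma l1Weight_zero (hμ₁ : μ < 1) : l1Weight μ 0 = 1 := by
  simp [l1Weight, Real.zero_rpow (by linarith : 1 - μ ≠ 0)]

/-- Midpoint concavity of `x ^ (1 - μ)` at `k` and `k + 2`. -/
lemma l1Weight_succ_le (hμ₀ : 0 < μ) (hμ₁ : μ < 1) (k : ℕ) :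
    l1Weight μ (k + 1) ≤ l1Weight μ k := by
  have hx : (k : ℝ) ∈ Set.Ici (0 : ℝ) := Set.mem_Ici.2 (Nat.cast_nonneg k)
  have hy : (k : ℝ) + 2 ∈ Set.Ici (0 : ℝ) := by
    have : (0 : ℝ) ≤ k + 2 := by positivity
    exact Set.mem_Ici.2 this
  have hc := (Real.concaveOn_rpow (p := 1 - μ) (by linarith) (by linarith)).2 hx hy
    (by norm_num : (0 : ℝ) ≤ 1 / 2) (by norm_num : (0 : ℝ) ≤ 1 / 2) (by norm_num)
  simp only [smul_eq_mul] at hc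
  have e : 1 / 2 * (k : ℝ) + 1 / 2 * ((k : ℝ) + 2) = k + 1 := by ring
  rw [e] at hc
  unfold l1Weight
  push_cast
  rw [show (k : ℝ) + 1 + 1 = k + 2 by ring]
  linarith

lemma l1Weight_antitone (hμ₀ : 0 < μ) (hμ₁ : μ < 1) : Antitone (l1Weight μ) :=
  antitone_nat_of_succ_le (l1Weight_succ_le hμ₀ hμ₁)

/-- Bernoulli's inequality for `(1 - 1/(k+1)) ^ (1 - μ)`. The rate `(k + 1) ^ (-μ)` is exactly what
the factor `h_t ^ μ` of the scheme compensates. -/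
lemma l1Weight_ge (hμ₀ : 0 < μ) (hμ₁ : μ < 1) (k : ℕ) :
    (1 - μ) / ((k : ℝ) + 1) ^ μ ≤ l1Weight μ k := by
  have hk : (0 : ℝ) < k + 1 := by positivity
  have hb := rpow_one_add_le_one_add_mul_self (s := -(1 / ((k : ℝ) + 1))) (p := 1 - μ)
    (by rw [neg_le_neg_iff, div_le_one hk]; linarith [(Nat.cast_nonneg k : (0 : ℝ) ≤ k)])
    (by linarith) (by linarith)
  have e1 : (k : ℝ) = (k + 1) * (1 + -(1 / ((k : ℝ) + 1))) := by field_simp; ring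
  have e0 : 0 ≤ 1 + -(1 / ((k : ℝ) + 1)) := by
    have : (1 : ℝ) + -(1 / ((k : ℝ) + 1)) = k / (k + 1) := by field_simp; ring
    rw [this]; positivity
  have e2 : (k : ℝ) ^ (1 - μ) = ((k : ℝ) + 1) ^ (1 - μ) * (1 + -(1 / ((k : ℝ) + 1))) ^ (1 - μ) := by
    conv_lhs => rw [e1]
    rw [Real.mul_rpow hk.le e0]
  have e3 : ((k : ℝ) + 1) ^ (1 - μ) = ((k : ℝ) + 1) / ((k : ℝ) + 1) ^ μ := by
    rw [Real.rpow_sub hk, Real.rpow_one]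
  have hp : 0 < ((k : ℝ) + 1) ^ (1 - μ) := Real.rpow_pos_of_pos hk _
  have := mul_le_mul_of_nonneg_left hb hp.le
  unfold l1Weight
  rw [e2]
  have e4 : (1 - μ) / ((k : ℝ) + 1) ^ μ = ((k : ℝ) + 1) ^ (1 - μ) * ((1 - μ) * (1 / ((k : ℝ) + 1))) := by
    rw [e3]; field_simp
  rw [e4]
  linarith

lemma l1Weight_pos (hμ₀ : 0 < μ) (hμ₁ : μ < 1) (k : ℕ) : 0 < l1Weight μ k :=
  lt_of_lt_of_le (div_pos (by linarith) (Real.rpow_pos_of_pos (by positivity) _))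
    (l1Weight_ge hμ₀ hμ₁ k)

/-- The value against which the new level is compared in the L1 formula. -/
noncomputable def l1History (μ : ℝ) (v : ℕ → ℝ) (n : ℕ) : ℝ :=
  v n - ∑ k ∈ Icc 1 n, l1Weight μ k * (v (n - k + 1) - v (n - k))

lemma sum_Icc_one_eq (f : ℕ → ℝ) (n : ℕ) : ∑ k ∈ Icc 1 n, f k = ∑ k ∈ range n, f (k + 1) := by
  rw [range_eq_Ico, sum_Ico_add' f 0 n 1]
  rfl

/-- Abel summation. For decreasing positive weights this is a convex combination of the earlier
levels. -/
lemma l1History_eq (hμ₁ : μ < 1) (v : ℕ → ℝ) (n : ℕ) :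
    l1History μ v n = ∑ k ∈ range n, (l1Weight μ k - l1Weight μ (k + 1)) * v (n - k)
      + l1Weight μ n * v 0 := by
  have abel : ∀ (x : ℕ → ℝ) (n : ℕ),
      x 0 - ∑ k ∈ range n, l1Weight μ (k + 1) * (x k - x (k + 1)) =
        ∑ k ∈ range n, (l1Weight μ k - l1Weight μ (k + 1)) * x k + l1Weight μ n * x n := by
    intro x n
    induction n with
    | zero => simp [l1Weight_zero hμ₁]
    | succ n ih =>
      rw [sum_range_succ, sum_range_succ]
      linear_combination ih
  have := abel (fun k => v (n - k)) n
  simp only [Nat.sub_zero, Nat.sub_self] at this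
  rw [← this, l1History, sum_Icc_one_eq]
  congr 1
  refine sum_congr rfl fun k hk => ?_
  have hk' := mem_range.1 hk
  rw [show n - (k + 1) + 1 = n - k by omega]

/-- The L1 difference, written by increments. -/
lemma sub_l1History_eq (hμ₁ : μ < 1) (v : ℕ → ℝ) (n : ℕ) :
    v (n + 1) - l1History μ v n =
      ∑ j ∈ range (n + 1), l1Weight μ (n - j) * (v (j + 1) - v j) := by
  rw [l1History, sum_Icc_one_eq, sum_range_succ, Nat.sub_self, l1Weight_zero hμ₁,
    ← sum_range_reflect]
  have : ∑ k ∈ range n, l1Weight μ (n - 1 - k + 1) *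
      (v (n - (n - 1 - k + 1) + 1) - v (n - (n - 1 - k + 1))) =
      ∑ k ∈ range n, l1Weight μ (n - k) * (v (k + 1) - v k) :=
    sum_congr rfl fun k hk => by
      have hk' := mem_range.1 hk
      rw [show n - 1 - k + 1 = n - k by omega, show n - (n - k) = k by omega]
  rw [this]
  ring

lemma l1History_sub (u v : ℕ → ℝ) (n : ℕ) :
    l1History μ (fun j => u j - v j) n = l1History μ u n - l1History μ v n := by
  simp only [l1History]
  have : ∀ k, l1Weight μ k * (u (n - k + 1) - v (n - k + 1) - (u (n - k) - v (n - k))) =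
      l1Weight μ k * (u (n - k + 1) - u (n - k)) - l1Weight μ k * (v (n - k + 1) - v (n - k)) :=
    fun k => by ring
  simp only [this, sum_sub_distrib]
  ring

/-- The majorant reproduces itself: the coefficients add up to `1 - w_n`, and `(1 - w_n) (G / w_n) +
G = G / w_n`. Earlier levels satisfy the same bound because the weights decrease, so no exponential
factor arises. -/
lemma l1_stability (hμ₀ : 0 < μ) (hμ₁ : μ < 1) {y : ℕ → ℝ} {K : ℕ} {G : ℝ} (hG : 0 ≤ G)
    (hy : ∀ n < K, y (n + 1) ≤
      ∑ k ∈ range n, (l1Weight μ k - l1Weight μ (k + 1)) * y (n - k) + G) :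
    ∀ n < K, y (n + 1) ≤ G / l1Weight μ n := by
  intro n
  induction n using Nat.strong_induction_on with
  | _ n ih =>
    intro hn
    have hw := l1Weight_pos hμ₀ hμ₁ n
    have h1 : ∑ k ∈ range n, (l1Weight μ k - l1Weight μ (k + 1)) * y (n - k) ≤
        ∑ k ∈ range n, (l1Weight μ k - l1Weight μ (k + 1)) * (G / l1Weight μ n) := by
      refine sum_le_sum fun k hk => ?_
      have hk' := mem_range.1 hk
      refine mul_le_mul_of_nonneg_left ?_ (sub_nonneg.2 (l1Weight_succ_le hμ₀ hμ₁ k))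
      have := ih (n - k - 1) (by omega) (by omega)
      rw [show n - k - 1 + 1 = n - k by omega] at this
      exact this.trans (div_le_div_of_nonneg_left hG hw (l1Weight_antitone hμ₀ hμ₁ (by omega)))
    rw [← sum_mul, sum_range_sub', l1Weight_zero hμ₁] at h1
    refine (hy n hn).trans ((add_le_add_left h1 G).trans (le_of_eq ?_))
    field_simp
    ring

end

/-! ### The energy of a discrete evolution -/

/-- The energy inner product. -/
noncomputable def energyForm (n : ℕ) (h K : ℝ) (u v : ℕ → ℝ) : ℝ :=
  gradForm n h u v + K * massForm n h u v

lemma energyForm_sub (n : ℕ) (h K : ℝ) (u v w : ℕ → ℝ) :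
    energyForm n h K u (fun m => v m - w m) = energyForm n h K u v - energyForm n h K u w := by
  have e1 : ∀ i, (u (i + 1) - u i) * (v (i + 1) - w (i + 1) - (v i - w i)) =
    (u (i + 1) - u i) * (v (i + 1) - v i) - (u (i + 1) - u i) * (w (i + 1) - w i) :=
    fun i => by ring
  simp only [energyForm, gradForm, massForm, e1, mul_sub, sum_sub_distrib]
  ring

lemma energyForm_sum (n : ℕ) (h K : ℝ) (u : ℕ → ℝ) (s : Finset ℕ) (c : ℕ → ℝ) (v : ℕ → ℕ → ℝ) :
    energyForm n h K u (fun m => ∑ k ∈ s, c k * v k m) =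
      ∑ k ∈ s, c k * energyForm n h K u (v k) := by
  induction s using Finset.cons_induction with
  | empty => simp [energyForm, gradForm, massForm]
  | cons a s ha ih =>
    simp only [sum_cons]
    rw [← ih]
    have e1 : ∀ i, (u (i + 1) - u i) * (c a * v a (i + 1) + ∑ k ∈ s, c k * v k (i + 1)
        - (c a * v a i + ∑ k ∈ s, c k * v k i)) =
      c a * ((u (i + 1) - u i) * (v a (i + 1) - v a i)) +
      (u (i + 1) - u i) * (∑ k ∈ s, c k * v k (i + 1) - ∑ k ∈ s, c k * v k i) :=
      fun i => by ring
    have e2 : ∀ i, u (i + 1) * (c a * v a (i + 1) + ∑ k ∈ s, c k * v k (i + 1)) =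
      c a * (u (i + 1) * v a (i + 1)) + u (i + 1) * ∑ k ∈ s, c k * v k (i + 1) :=
      fun i => by ring
    simp only [energyForm, gradForm, massForm, e1, e2, sum_add_distrib, ← mul_sum]
    ring

lemma energyForm_congr_right {n : ℕ} {h K : ℝ} (u : ℕ → ℝ) {v w : ℕ → ℝ}
    (hvw : ∀ m ≤ n + 1, v m = w m) : energyForm n h K u v = energyForm n h K u w := by
  have e1 : ∑ i ∈ range (n + 1), (u (i + 1) - u i) * (v (i + 1) - v i) =
      ∑ i ∈ range (n + 1), (u (i + 1) - u i) * (w (i + 1) - w i) :=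
    sum_congr rfl fun i hi => by
      have := mem_range.1 hi
      rw [hvw i (by omega), hvw (i + 1) (by omega)]
  have e2 : ∑ i ∈ range n, u (i + 1) * v (i + 1) = ∑ i ∈ range n, u (i + 1) * w (i + 1) :=
    sum_congr rfl fun i hi => by
      have := mem_range.1 hi
      rw [hvw (i + 1) (by omega)]
  rw [energyForm, energyForm, gradForm, gradForm, massForm, massForm, e1, e2]

lemma energyForm_self_nonneg {n : ℕ} {h K : ℝ} (hh : 0 < h) (hK : 0 ≤ K) (u : ℕ → ℝ) :
    0 ≤ energyForm n h K u u :=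
  add_nonneg (gradForm_self_nonneg hh u) (mul_nonneg hK (massForm_self_nonneg hh u))

lemma energyForm_comm (n : ℕ) (h K : ℝ) (u v : ℕ → ℝ) :
    energyForm n h K u v = energyForm n h K v u := by
  simp only [energyForm, gradForm, massForm, mul_comm]

lemma two_mul_energyForm_le {n : ℕ} {h K : ℝ} (hh : 0 < h) (hK : 0 ≤ K) (u v : ℕ → ℝ) :
    2 * energyForm n h K u v ≤ energyForm n h K u u + energyForm n h K v v := by
  have := energyForm_self_nonneg (n := n) hh hK (fun m => u m - v m)
  rw [energyForm_sub, energyForm_comm _ _ _ _ u, energyForm_comm _ _ _ _ v, energyForm_sub,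
    energyForm_sub, energyForm_comm _ _ _ v u] at this
  linarith

/-- If the energy product of the new level with its L1 increment is bounded, the energy stays
bounded. -/
lemma energy_evolution {μ : ℝ} (hμ₀ : 0 < μ) (hμ₁ : μ < 1) {n : ℕ} {h K G : ℝ} (hh : 0 < h)
    (hK : 0 ≤ K) (hG : 0 ≤ G) {e : ℕ → ℕ → ℝ} {T : ℕ} (h0 : ∀ m ≤ n + 1, e 0 m = 0)
    (he : ∀ j < T, energyForm n h K (e (j + 1))
      (fun m => e (j + 1) m - l1History μ (fun i => e i m) j) ≤ G) :
    ∀ j < T, energyForm n h K (e (j + 1)) (e (j + 1)) ≤ 2 * G / l1Weight μ j := by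
  refine l1_stability (y := fun j => energyForm n h K (e j) (e j)) hμ₀ hμ₁ (by positivity) ?_
  · intro j hj
    have h1 := he j hj
    have e1 : ∀ m ≤ n + 1, e (j + 1) m - l1History μ (fun i => e i m) j =
        (fun m => e (j + 1) m
          - ∑ k ∈ range j, (l1Weight μ k - l1Weight μ (k + 1)) * e (j - k) m) m := by
      intro m hm
      rw [l1History_eq hμ₁, h0 m hm, mul_zero, add_zero]
    rw [energyForm_congr_right _ e1, energyForm_sub, energyForm_sum n h K _ _ _ (fun k => e (j - k))] at h1
    -- The mixed products are split evenly. The new level receives the total coefficient `1 - w_j`,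
    -- which twice its energy absorbs, with `1 + w_j` left over.
    have h2 : ∑ k ∈ range j, (l1Weight μ k - l1Weight μ (k + 1)) *
        (2 * energyForm n h K (e (j + 1)) (e (j - k))) ≤
        ∑ k ∈ range j, (l1Weight μ k - l1Weight μ (k + 1)) *
        (energyForm n h K (e (j + 1)) (e (j + 1)) + energyForm n h K (e (j - k)) (e (j - k))) :=
      sum_le_sum fun k _ => mul_le_mul_of_nonneg_left (two_mul_energyForm_le hh hK _ _)
        (sub_nonneg.2 (l1Weight_succ_le hμ₀ hμ₁ k))
    simp only [mul_add, sum_add_distrib, ← sum_mul] at h2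
    rw [sum_range_sub', l1Weight_zero hμ₁] at h2
    have h3 : ∑ k ∈ range j, (l1Weight μ k - l1Weight μ (k + 1)) *
        (2 * energyForm n h K (e (j + 1)) (e (j - k))) =
        2 * ∑ k ∈ range j, (l1Weight μ k - l1Weight μ (k + 1)) *
          energyForm n h K (e (j + 1)) (e (j - k)) := by
      rw [mul_sum]; exact sum_congr rfl fun k _ => by ring
    have h4 := mul_nonneg (l1Weight_pos hμ₀ hμ₁ j).le
      (energyForm_self_nonneg (n := n) hh hK (e (j + 1)))
    linarith

end

/-! ### Truncation error of the L1 formula -/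

/-- The L1 approximation with `n + 1` steps of the Caputo derivative of `f` at `t`. -/
noncomputable def l1Approx (μ : ℝ) (f : ℝ → ℝ) (n : ℕ) (t : ℝ) : ℝ :=
  (f ((n + 1 : ℕ) * (t / (n + 1 : ℕ))) - l1History μ (fun j => f (j * (t / (n + 1 : ℕ)))) n) /
    (Real.Gamma (2 - μ) * (t / (n + 1 : ℕ)) ^ μ)

lemma intervalIntegrable_kernel {μ : ℝ} (hμ₁ : μ < 1) (t a b : ℝ) :
    IntervalIntegrable (fun s => (t - s) ^ (-μ)) MeasureTheory.volume a b := by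
  have := (intervalIntegral.intervalIntegrable_rpow' (r := -μ) (by linarith)
    (a := t - a) (b := t - b)).comp_sub_left t
  simpa using this

lemma integral_kernel {μ : ℝ} (hμ₁ : μ < 1) (t a b : ℝ) :
    ∫ s in a..b, (t - s) ^ (-μ) = ((t - a) ^ (1 - μ) - (t - b) ^ (1 - μ)) / (1 - μ) := by
  rw [intervalIntegral.integral_comp_sub_left (fun x => x ^ (-μ)) t,
    integral_rpow (Or.inl (by linarith)), show -μ + 1 = 1 - μ by ring]

section
variable {μ t τ B : ℝ} {n : ℕ} {f g : ℝ → ℝ}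

/-- The slope is the mean of `g` over the cell and also a value of `g` there. The vanishing mean is
the cancellation behind the order `2 - μ`. -/
lemma abs_sub_slope_le (hτ : 0 < τ) {a : ℝ} (hg : ContinuousOn g (Icc a (a + τ)))
    (hfg : ∀ s ∈ Icc a (a + τ), HasDerivWithinAt f (g s) (Icc a (a + τ)) s)
    (hB : ∀ s ∈ Icc a (a + τ), ∀ r ∈ Icc a (a + τ), |g s - g r| ≤ B * |s - r|)
    (hB0 : 0 ≤ B) :
    (∫ s in a..a + τ, (g s - (f (a + τ) - f a) / τ)) = 0 ∧
      ∀ s ∈ Icc a (a + τ), |g s - (f (a + τ) - f a) / τ| ≤ B * τ := by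
  have hcont : ContinuousOn f (Icc a (a + τ)) := fun s hs => (hfg s hs).continuousWithinAt
  have hlt : a < a + τ := by linarith
  have hd : ∀ s ∈ Ioo a (a + τ), HasDerivAt f (g s) s := fun s hs =>
    (hfg s (Ioo_subset_Icc_self hs)).hasDerivAt (Icc_mem_nhds hs.1 hs.2)
  have hgi : IntervalIntegrable g MeasureTheory.volume a (a + τ) :=
    ContinuousOn.intervalIntegrable (by rwa [uIcc_of_le hlt.le])
  constructor
  · rw [intervalIntegral.integral_sub hgi intervalIntegrable_const,
      intervalIntegral.integral_eq_sub_of_hasDerivAt_of_le hlt.le hcont hd hgi,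
      intervalIntegral.integral_const, smul_eq_mul, add_sub_cancel_left,
      mul_div_cancel₀ _ hτ.ne', sub_self]
  · intro s hs
    obtain ⟨c, hc, hc'⟩ := exists_hasDerivAt_eq_slope f g hlt hcont hd
    rw [add_sub_cancel_left] at hc'
    rw [← hc']
    refine (hB s hs c (Ioo_subset_Icc_self hc)).trans ?_
    refine mul_le_mul_of_nonneg_left ?_ hB0
    rw [abs_le]; constructor <;> linarith [hs.1, hs.2, hc.1, hc.2]

/-- The L1 formula has order `2 - μ`. -/
theorem abs_l1Approx_sub_caputo_le (hμ₀ : 0 < μ) (hμ₁ : μ < 1) (ht : 0 < t) (n : ℕ)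
    (hg : ContinuousOn g (Icc 0 t))
    (hfg : ∀ s ∈ Icc 0 t, HasDerivWithinAt f (g s) (Icc 0 t) s) (hB0 : 0 ≤ B)
    (hB : ∀ s ∈ Icc 0 t, ∀ r ∈ Icc 0 t, |g s - g r| ≤ B * |s - r|) :
    |l1Approx μ f n t - caputo μ f t| ≤
      (1 + 1 / (1 - μ)) / Real.Gamma (1 - μ) * B * (t / (n + 1 : ℕ)) ^ (2 - μ) := by
  set τ := t / (n + 1 : ℕ) with hτ
  have hτ0 : 0 < τ := by positivity
  have hnτ : ((n + 1 : ℕ) : ℝ) * τ = t := by rw [hτ]; field_simp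
  have hμ1 : 0 < 1 - μ := by linarith
  have hΓ : 0 < Real.Gamma (1 - μ) := Real.Gamma_pos_of_pos hμ1
  have hΓ2 : Real.Gamma (2 - μ) = (1 - μ) * Real.Gamma (1 - μ) := by
    rw [← Real.Gamma_add_one hμ1.ne']; congr 1; ring
  set p : ℕ → ℝ := fun j => j * τ with hp
  have hp1 : ∀ j, p (j + 1) = p j + τ := fun j => by simp only [hp]; push_cast; ring
  have hp0 : ∀ j, 0 ≤ p j := fun j => by simp only [hp]; positivity
  have hpt : ∀ j ≤ n + 1, p j ≤ t := fun j hj => by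
    rw [← hnτ]
    have : (j : ℝ) ≤ (n + 1 : ℕ) := by exact_mod_cast hj
    exact mul_le_mul_of_nonneg_right this hτ0.le
  have hsub : ∀ j ≤ n, Icc (p j) (p j + τ) ⊆ Icc 0 t := fun j hj =>
    Icc_subset_Icc (hp0 j) (by rw [← hp1]; exact hpt _ (by omega))
  have htp : ∀ j ≤ n + 1, t - p j = ((n + 1 - j : ℕ) : ℝ) * τ := fun j hj => by
    rw [← hnτ, Nat.cast_sub hj]; simp only [hp]; ring
  set S : ℕ → ℝ := fun j => (f (p j + τ) - f (p j)) / τ with hS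
  set k : ℝ → ℝ := fun s => (t - s) ^ (-μ) with hk
  have hcell : ∀ j ≤ n, (∫ s in p j..p j + τ, (g s - S j)) = 0 ∧
      ∀ s ∈ Icc (p j) (p j + τ), |g s - S j| ≤ B * τ := fun j hj =>
    abs_sub_slope_le hτ0 (hg.mono (hsub j hj))
      (fun s hs => (hfg s (hsub j hj hs)).mono (hsub j hj))
      (fun s hs r hr => hB s (hsub j hj hs) r (hsub j hj hr)) hB0
  have hgi : ∀ j ≤ n, ContinuousOn g (uIcc (p j) (p j + τ)) := fun j hj => by
    rw [uIcc_of_le (by linarith)]; exact hg.mono (hsub j hj)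
  have hki : ∀ a b, IntervalIntegrable k MeasureTheory.volume a b := fun a b =>
    intervalIntegrable_kernel hμ₁ t a b
  have hkgi : ∀ j ≤ n, IntervalIntegrable (fun s => k s * g s) MeasureTheory.volume (p j)
      (p j + τ) := fun j hj => (hki _ _).mul_continuousOn (hgi j hj)
  -- the Caputo derivative cell by cell
  have hcap : caputo μ f t = 1 / Real.Gamma (1 - μ) *
      ∑ j ∈ Finset.range (n + 1), ∫ s in p j..p j + τ, k s * g s := by
    unfold caputo
    congr 1
    have e1 : ∫ s in (0 : ℝ)..t, (t - s) ^ (-μ) * deriv f s = ∫ s in (0 : ℝ)..t, k s * g s := by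
      refine intervalIntegral.integral_congr_Ioo_of_le ht.le fun s hs => ?_
      simp only [hk]
      rw [((hfg s (Ioo_subset_Icc_self hs)).hasDerivAt (Icc_mem_nhds hs.1 hs.2)).deriv]
    have e2 := intervalIntegral.sum_integral_adjacent_intervals (a := p) (n := n + 1)
      (f := fun s => k s * g s) (μ := MeasureTheory.volume)
      (fun j hj => by rw [hp1]; exact hkgi j (by omega))
    have e3 : p 0 = 0 := by simp [hp]
    have e4 : p (n + 1) = t := hnτ
    rw [e1, ← e4, ← e3, ← e2]
    simp only [hp1]
  have hkint : ∀ j ≤ n, ∫ s in p j..p j + τ, k s = τ ^ (1 - μ) * l1Weight μ (n - j) / (1 - μ) := by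
    intro j hj
    simp only [hk]
    rw [integral_kernel hμ₁, ← hp1, htp j (by omega), htp (j + 1) (by omega),
      Real.mul_rpow (by positivity) hτ0.le, Real.mul_rpow (by positivity) hτ0.le, l1Weight,
      show n + 1 - j = n - j + 1 by omega, show n + 1 - (j + 1) = n - j by omega]
    push_cast
    ring
  have hl1 : l1Approx μ f n t = 1 / Real.Gamma (1 - μ) *
      ∑ j ∈ Finset.range (n + 1), S j * ∫ s in p j..p j + τ, k s := by
    have e1 : l1Approx μ f n t = (f (p (n + 1))
      - l1History μ (fun j : ℕ => f (p j)) n) / (Real.Gamma (2 - μ) * τ ^ μ) := rfl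
    rw [e1, sub_l1History_eq hμ₁ (fun j : ℕ => f (p j)) n, Finset.sum_div, Finset.mul_sum]
    refine Finset.sum_congr rfl fun j hj => ?_
    have hj' := Finset.mem_range.1 hj
    have hτμ : 0 < τ ^ μ := Real.rpow_pos_of_pos hτ0 _
    rw [hkint j (by omega), hΓ2, Real.rpow_sub hτ0, Real.rpow_one]
    simp only [hS, hp1]
    field_simp
  set E : ℕ → ℝ := fun j => ∫ s in p j..p j + τ, k s * (g s - S j) with hE
  have hdiff : caputo μ f t - l1Approx μ f n t =
      1 / Real.Gamma (1 - μ) * ∑ j ∈ Finset.range (n + 1), E j := by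
    rw [hcap, hl1, ← mul_sub, ← Finset.sum_sub_distrib]
    congr 1
    refine Finset.sum_congr rfl fun j hj => ?_
    have hj' := Finset.mem_range.1 hj
    simp only [hE]
    rw [← intervalIntegral.integral_const_mul,
      ← intervalIntegral.integral_sub (hkgi j (by omega)) ((hki _ _).const_mul _)]
    exact intervalIntegral.integral_congr fun s _ => by ring
  -- On the last cell the kernel is singular but integrable, and its integral already supplies `τ ^
  -- (1 - μ)`.
  have hlast : |E n| ≤ B * τ ^ (2 - μ) / (1 - μ) := by
    have h1 : ‖∫ s in p n..p n + τ, k s * (g s - S n)‖ ≤ ∫ s in p n..p n + τ, k s * (B * τ) := by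
      refine intervalIntegral.norm_integral_le_of_norm_le (by linarith) ?_ ((hki _ _).mul_const _)
      refine Filter.Eventually.of_forall fun s hs => ?_
      have hs1 : 0 ≤ t - s := by
        have := hpt (n + 1) le_rfl
        rw [hp1] at this; linarith [hs.2]
      have hk0 : 0 ≤ k s := Real.rpow_nonneg hs1 _
      rw [Real.norm_eq_abs, abs_mul, abs_of_nonneg hk0]
      exact mul_le_mul_of_nonneg_left ((hcell n le_rfl).2 s (Ioc_subset_Icc_self hs)) hk0
    rw [intervalIntegral.integral_mul_const, hkint n le_rfl, Nat.sub_self, l1Weight_zero hμ₁] at h1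
    refine h1.trans (le_of_eq ?_)
    rw [show (2 : ℝ) - μ = (1 - μ) + 1 by ring, Real.rpow_add hτ0, Real.rpow_one]
    ring
  -- Since `g - S j` has mean zero, the kernel may be replaced by its increase from the left end of
  -- the cell; the kernel is monotone.
  have hcellE : ∀ j < n, |E j| ≤ (k (p (j + 1)) - k (p j)) * (B * τ) * τ := by
    intro j hj
    have e1 : E j = ∫ s in p j..p j + τ, (k s - k (p j)) * (g s - S j) := by
      have : E j = ∫ s in p j..p j + τ, ((k s - k (p j)) * (g s - S j) + k (p j) * (g s - S j)) :=
        intervalIntegral.integral_congr fun s _ => by ring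
      have hc : ContinuousOn (fun s => g s - S j) (uIcc (p j) (p j + τ)) :=
        (hgi j hj.le).sub continuousOn_const
      rw [this, intervalIntegral.integral_add
        (((hki _ _).sub intervalIntegrable_const).mul_continuousOn hc)
        ((hc.intervalIntegrable).const_mul _), intervalIntegral.integral_const_mul,
        (hcell j hj.le).1, mul_zero, add_zero]
    have h1 := intervalIntegral.norm_integral_le_of_norm_le_const (a := p j) (b := p j + τ)
      (f := fun s => (k s - k (p j)) * (g s - S j))
      (C := (k (p (j + 1)) - k (p j)) * (B * τ)) (by
        intro s hs
        rw [uIoc_of_le (by linarith)] at hs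
        have hlt : p (j + 1) < t := by
          have e : p (j + 1) + τ ≤ t := by rw [← hp1]; exact hpt _ (by omega)
          linarith
        have hs2 : s ≤ p (j + 1) := by rw [hp1]; exact hs.2
        have m1 : k (p j) ≤ k s := by
          simp only [hk]
          exact Real.rpow_le_rpow_of_nonpos (by linarith) (by linarith [hs.1]) (by linarith)
        have m2 : k s ≤ k (p (j + 1)) := by
          simp only [hk]
          exact Real.rpow_le_rpow_of_nonpos (by linarith) (by linarith) (by linarith)
        rw [Real.norm_eq_abs, abs_mul, abs_of_nonneg (sub_nonneg.2 m1)]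
        exact mul_le_mul (by linarith) ((hcell j hj.le).2 s (Ioc_subset_Icc_self hs)) (abs_nonneg _)
          (by linarith))
    rw [add_sub_cancel_left, abs_of_pos hτ0] at h1
    rw [e1]
    exact h1
  -- The kernel increments telescope to at most `τ ^ (-μ)`, so the number of cells does not enter.
  have hsum : |∑ j ∈ Finset.range (n + 1), E j| ≤ (1 + 1 / (1 - μ)) * B * τ ^ (2 - μ) := by
    rw [Finset.sum_range_succ]
    refine (abs_add_le _ _).trans ?_
    have h1 : |∑ j ∈ Finset.range n, E j| ≤
        ∑ j ∈ Finset.range n, (k (p (j + 1)) - k (p j)) * (B * τ) * τ :=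
      (Finset.abs_sum_le_sum_abs _ _).trans
        (Finset.sum_le_sum fun j hj => hcellE j (Finset.mem_range.1 hj))
    rw [← Finset.sum_mul, ← Finset.sum_mul, Finset.sum_range_sub (fun j => k (p j))] at h1
    have k0 : 0 ≤ k (p 0) := Real.rpow_nonneg (by linarith [hpt 0 (by omega)]) _
    have kn : k (p n) = τ ^ (-μ) := by
      simp only [hk]
      rw [htp n (by omega)]; simp
    have e : τ ^ (2 - μ) = τ ^ (-μ) * τ * τ := by
      rw [show (2 : ℝ) - μ = -μ + 1 + 1 by ring, Real.rpow_add hτ0, Real.rpow_add hτ0,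
        Real.rpow_one]
    have h2 : (k (p n) - k (p 0)) * (B * τ) * τ ≤ B * τ ^ (2 - μ) := by
      rw [kn, e]
      have : 0 ≤ k (p 0) * (B * τ) * τ := by positivity
      linarith
    have h3 : (1 + 1 / (1 - μ)) * B * τ ^ (2 - μ) =
        B * τ ^ (2 - μ) + B * τ ^ (2 - μ) / (1 - μ) := by ring
    linarith
  rw [abs_sub_comm, hdiff, abs_mul, abs_of_pos (by positivity)]
  calc 1 / Real.Gamma (1 - μ) * |∑ j ∈ Finset.range (n + 1), E j|
      ≤ 1 / Real.Gamma (1 - μ) * ((1 + 1 / (1 - μ)) * B * τ ^ (2 - μ)) := by gcongr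
    _ = _ := by ring

end

/-! ### Consistency in space -/

/-- Induction on the order by the mean value inequality, which costs the factorial in the remainder
but handles one-sided derivatives and both directions at once. -/
lemma abs_sub_taylor_le {a b B : ℝ} {k : ℕ} {F : ℕ → ℝ → ℝ}
    (hF : ∀ i < k, ∀ x ∈ Icc a b, HasDerivWithinAt (F i) (F (i + 1) x) (Icc a b) x)
    (hB : ∀ x ∈ Icc a b, |F k x| ≤ B) {x y : ℝ} (hx : x ∈ Icc a b) (hy : y ∈ Icc a b) :
    |F 0 y - ∑ j ∈ Finset.range k, F j x * (y - x) ^ j / j.factorial| ≤ B * |y - x| ^ k := by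
  induction k generalizing F y with
  | zero => simpa using hB y hy
  | succ k ih =>
    have hsub : uIcc x y ⊆ Icc a b := uIcc_subset_Icc hx hy
    have hd : ∀ z ∈ uIcc x y, HasDerivWithinAt
        (fun z => F 0 z - ∑ j ∈ Finset.range (k + 1), F j x * (z - x) ^ j / j.factorial)
        (F 1 z - ∑ j ∈ Finset.range k, F (j + 1) x * (z - x) ^ j / j.factorial) (uIcc x y) z := by
      intro z hz
      refine ((hF 0 (by omega) z (hsub hz)).mono hsub).sub ?_
      have hs : ∀ j ∈ Finset.range (k + 1), HasDerivAt
          (fun z => F j x * (z - x) ^ j / j.factorial)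
          (F j x * ((j : ℝ) * (z - x) ^ (j - 1)) / j.factorial) z := by
        intro j _
        have := (((hasDerivAt_id z).sub_const x).pow j).const_mul (F j x)
        simpa using this.div_const (j.factorial : ℝ)
      have h1 := HasDerivAt.fun_sum hs
      rw [Finset.sum_range_succ'] at h1
      refine HasDerivAt.hasDerivWithinAt (h1.congr_deriv ?_)
      simp only [CharP.cast_eq_zero, zero_mul, mul_zero, zero_div, add_zero]
      refine Finset.sum_congr rfl fun j _ => ?_
      rw [Nat.factorial_succ, Nat.add_sub_cancel]
      have : (j.factorial : ℝ) ≠ 0 := by exact_mod_cast j.factorial_ne_zero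
      push_cast
      field_simp
    have hb : ∀ z ∈ uIcc x y,
        ‖F 1 z - ∑ j ∈ Finset.range k, F (j + 1) x * (z - x) ^ j / j.factorial‖ ≤
          B * |y - x| ^ k := by
      intro z hz
      refine (ih (F := fun i => F (i + 1)) (fun i hi => hF (i + 1) (by omega)) hB
        (hsub hz)).trans ?_
      have hB0 : 0 ≤ B := (abs_nonneg _).trans (hB x hx)
      have : |z - x| ≤ |y - x| := abs_sub_left_of_mem_uIcc hz
      gcongr
    have := (convex_uIcc x y).norm_image_sub_le_of_norm_hasDerivWithin_le hd hb left_mem_uIcc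
      right_mem_uIcc
    have e : F 0 x - ∑ j ∈ Finset.range (k + 1), F j x * (x - x) ^ j / j.factorial = 0 := by
      rw [Finset.sum_range_succ']; simp
    rw [e, sub_zero] at this
    rw [pow_succ, ← mul_assoc]
    exact this

section
variable {n : ℕ} {a h B : ℝ}

lemma SplineRelations.sub {e ε p σ e' ε' p' σ' : ℕ → ℝ} (H : SplineRelations n a h e ε p σ)
    (H' : SplineRelations n a h e' ε' p' σ') :
    SplineRelations n a h (fun i => e i - e' i) (fun i => ε i - ε' i) (fun i => p i - p' i)
      (fun i => σ i - σ' i) where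
  second i hi := by
    have h1 := H.second i hi
    have h2 := H'.second i hi
    linear_combination h1 - h2
  first i hi := by
    have h1 := H.first i hi
    have h2 := H'.first i hi
    linear_combination h1 - h2
  first_left := by
    have h1 := H.first_left
    have h2 := H'.first_left
    linear_combination h1 - h2
  first_right := by
    have h1 := H.first_right
    have h2 := H'.first_right
    linear_combination h1 - h2

/-- Smooth functions satisfy the spline relations at the nodes up to second order. -/
lemma exists_splineRelations_sample {l r : ℝ} {F : ℕ → ℝ → ℝ} (hh : 0 < h)
    (ha0 : 0 ≤ a) (ha : a ≤ 1 / 5)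
    (hr : l + (n + 1 : ℕ) * h = r)
    (hF : ∀ i < 4, ∀ x ∈ Icc l r, HasDerivWithinAt (F i) (F (i + 1) x) (Icc l r) x)
    (hB : ∀ i ≤ 4, ∀ x ∈ Icc l r, |F i x| ≤ B) :
    ∃ p σ : ℕ → ℝ, SplineRelations n a h (fun i => F 0 (l + i * h)) (fun i => F 2 (l + i * h)) p σ
      ∧ (∀ i < n, |σ (i + 1)| ≤ 3 * B * h ^ 2)
      ∧ ∀ m ≤ n + 1, |p m - F 1 (l + m * h)| ≤ 2 * B * h ^ 2 := by
  have hmem : ∀ i ≤ n + 1, l + (i : ℕ) * h ∈ Icc l r := fun i hi => by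
    have : (i : ℝ) ≤ (n + 1 : ℕ) := by exact_mod_cast hi
    refine ⟨by nlinarith [(Nat.cast_nonneg i : (0 : ℝ) ≤ i)], ?_⟩
    rw [← hr]; nlinarith
  have T4 : ∀ i ≤ n + 1, ∀ j ≤ n + 1, |F 0 (l + (j : ℕ) * h) - (F 0 (l + (i : ℕ) * h)
      + F 1 (l + i * h) * ((j - i) * h) + F 2 (l + i * h) * ((j - i) * h) ^ 2 / 2
      + F 3 (l + i * h) * ((j - i) * h) ^ 3 / 6)| ≤ B * |(j - i) * h| ^ 4 := by
    intro i hi j hj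
    have := abs_sub_taylor_le (k := 4) hF (hB 4 le_rfl) (hmem i hi) (hmem j hj)
    have e : l + (j : ℝ) * h - (l + i * h) = (j - i) * h := by ring
    simp only [Finset.sum_range_succ, Finset.sum_range_zero, Nat.factorial, e] at this
    norm_num at this
    rw [← abs_mul] at this
    exact this
  have T3 : ∀ i ≤ n + 1, ∀ j ≤ n + 1, |F 0 (l + (j : ℕ) * h) - (F 0 (l + (i : ℕ) * h)
      + F 1 (l + i * h) * ((j - i) * h) + F 2 (l + i * h) * ((j - i) * h) ^ 2 / 2)| ≤
      B * |(j - i) * h| ^ 3 := by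
    intro i hi j hj
    have := abs_sub_taylor_le (k := 3) (fun i hi => hF i (by omega)) (hB 3 (by norm_num))
      (hmem i hi) (hmem j hj)
    have e : l + (j : ℝ) * h - (l + i * h) = (j - i) * h := by ring
    simp only [Finset.sum_range_succ, Finset.sum_range_zero, Nat.factorial, e] at this
    norm_num at this
    rw [← abs_mul] at this
    exact this
  have W2 : ∀ i ≤ n + 1, ∀ j ≤ n + 1, |F 2 (l + (j : ℕ) * h) - (F 2 (l + (i : ℕ) * h)
      + F 3 (l + i * h) * ((j - i) * h))| ≤ B * |(j - i) * h| ^ 2 := by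
    intro i hi j hj
    have := abs_sub_taylor_le (k := 2) (F := fun i => F (i + 2)) (fun i hi => hF (i + 2) (by omega))
      (hB 4 (by norm_num)) (hmem i hi) (hmem j hj)
    have e : l + (j : ℝ) * h - (l + i * h) = (j - i) * h := by ring
    simp only [Finset.sum_range_succ, Finset.sum_range_zero, Nat.factorial, e] at this
    norm_num at this
    rw [← abs_mul] at this
    exact this
  have W1 : ∀ i ≤ n + 1, ∀ j ≤ n + 1, |F 2 (l + (j : ℕ) * h) - F 2 (l + (i : ℕ) * h)| ≤
      B * |(j - i) * h| := by
    intro i hi j hj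
    have := abs_sub_taylor_le (k := 1) (F := fun i => F (i + 2)) (fun i hi => hF (i + 2) (by omega))
      (hB 3 (by norm_num)) (hmem i hi) (hmem j hj)
    have e : l + (j : ℝ) * h - (l + i * h) = (j - i) * h := by ring
    simp only [Finset.sum_range_succ, Finset.sum_range_zero, Nat.factorial, e] at this
    norm_num at this
    simpa using this
  have B0 : 0 ≤ B := (abs_nonneg _).trans (hB 0 (by norm_num) _ (hmem 0 (by omega)))
  have habs : |h| = h := abs_of_pos hh
  set u : ℕ → ℝ := fun i => F 0 (l + i * h) with hu
  set w : ℕ → ℝ := fun i => F 2 (l + i * h) with hw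
  -- Both witnesses are read off from the relations, which then hold exactly. The truncated `m - 1`
  -- at `m = 0` is harmless: `p` has its own branch there and `σ` matters only at interior nodes.
  refine ⟨fun m => if m = 0 then (u 1 - u 0) / h - a * h * (w 1 - w 0) - h / 2 * w 0
    else if m = n + 1 then (u (n + 1) - u n) / h - a * h * (w (n + 1) - w n) + h / 2 * w (n + 1)
    else (u (m + 1) - u (m - 1)) / (2 * h) - a * h / 2 * (w (m + 1) - w (m - 1)),
    fun m => w m + a * (w (m + 1) - 2 * w m + w (m - 1))
      - (u (m + 1) - 2 * u m + u (m - 1)) / h ^ 2, ?_, ?_, ?_⟩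
  · constructor
    · intro i hi
      simp only [Nat.add_sub_cancel]
      ring
    · intro i hi
      rw [if_neg (by omega), if_neg (by omega)]
      simp only [Nat.add_sub_cancel]
    · rw [if_pos rfl]
    · rw [if_neg (by omega), if_pos rfl]
  · intro i hi
    simp only [Nat.add_sub_cancel]
    have t1 := T4 (i + 1) (by omega) (i + 1 + 1) (by omega)
    have t2 := T4 (i + 1) (by omega) i (by omega)
    have s1 := W2 (i + 1) (by omega) (i + 1 + 1) (by omega)
    have s2 := W2 (i + 1) (by omega) i (by omega)
    have e1 : (((i + 1 + 1 : ℕ) : ℝ) - (i + 1 : ℕ)) * h = h := by push_cast; ring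
    have e2 : (((i : ℕ) : ℝ) - (i + 1 : ℕ)) * h = -h := by push_cast; ring
    rw [e1, habs] at t1 s1
    rw [e2, abs_neg, habs] at t2 s2
    change |u (i + 1 + 1) - (u (i + 1) + _ + w (i + 1) * _ / 2 + _)| ≤ _ at t1
    change |u i - (u (i + 1) + _ + w (i + 1) * _ / 2 + _)| ≤ _ at t2
    change |w (i + 1 + 1) - (w (i + 1) + _)| ≤ _ at s1
    change |w i - (w (i + 1) + _)| ≤ _ at s2
    -- The odd Taylor terms at `±h` cancel. Together with `a * 2 B h² ≤ (2/5) B h²` the defect stays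
    -- below `3 B h²`.
    have k1 : |w (i + 1) - (u (i + 1 + 1) - 2 * u (i + 1) + u i) / h ^ 2| ≤ 2 * B * h ^ 2 := by
      have : w (i + 1) - (u (i + 1 + 1) - 2 * u (i + 1) + u i) / h ^ 2 =
        -((u (i + 1 + 1) - 2 * u (i + 1) + u i) - w (i + 1) * h ^ 2) / h ^ 2 := by
        field_simp; ring
      rw [this, abs_div, abs_neg, abs_of_pos (by positivity : 0 < h ^ 2),
        div_le_iff₀ (by positivity)]
      rw [abs_le] at t1 t2 ⊢
      constructor <;> linarith [t1.1, t1.2, t2.1, t2.2]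
    have k2 : |w (i + 1 + 1) - 2 * w (i + 1) + w i| ≤ 2 * B * h ^ 2 := by
      rw [abs_le] at s1 s2 ⊢
      constructor <;> linarith [s1.1, s1.2, s2.1, s2.2]
    have k3 : |a * (w (i + 1 + 1) - 2 * w (i + 1) + w i)| ≤ 1 / 5 * (2 * B * h ^ 2) := by
      rw [abs_mul, abs_of_nonneg ha0]; gcongr
    have : 0 ≤ B * h ^ 2 := by positivity
    rw [abs_le] at k1 k3 ⊢
    constructor <;> linarith [k1.1, k1.2, k3.1, k3.2]
  · intro m hm
    have BH : 0 ≤ B * h ^ 2 := by positivity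
    have hah : 0 ≤ a * h := by positivity
    have haB : a * h * (B * h) ≤ 1 / 5 * (B * h ^ 2) := by
      calc a * h * (B * h) = a * (B * h ^ 2) := by ring
        _ ≤ _ := by gcongr
    simp only
    split_ifs with h0 h1
    · subst h0
      have t1 := T3 0 (by omega) 1 (by omega)
      have s1 := W1 0 (by omega) 1 (by omega)
      have e1 : (((1 : ℕ) : ℝ) - (0 : ℕ)) * h = h := by push_cast; ring
      rw [e1, habs] at t1 s1
      change |u 1 - (u 0 + _ + w 0 * _ / 2)| ≤ _ at t1
      change |w 1 - w 0| ≤ _ at s1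
      have k2 : |a * h * (w 1 - w 0)| ≤ a * h * (B * h) := by
        rw [abs_mul, abs_of_nonneg hah]; gcongr
      have k1 : |(u 1 - u 0) / h - h / 2 * w 0 - F 1 (l + (0 : ℕ) * h)| ≤ B * h ^ 2 := by
        have : (u 1 - u 0) / h - h / 2 * w 0 - F 1 (l + (0 : ℕ) * h) =
            (u 1 - (u 0 + F 1 (l + (0 : ℕ) * h) * h + w 0 * h ^ 2 / 2)) / h := by field_simp; ring
        rw [this, abs_div, habs, div_le_iff₀ hh]
        exact t1.trans (le_of_eq (by ring))
      rw [abs_le] at k1 k2 ⊢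
      constructor <;> linarith [k1.1, k1.2, k2.1, k2.2]
    · subst h1
      have t1 := T3 (n + 1) (by omega) n (by omega)
      have s1 := W1 n (by omega) (n + 1) (by omega)
      have e1 : (((n + 1 : ℕ) : ℝ) - (n : ℕ)) * h = h := by push_cast; ring
      have e2 : (((n : ℕ) : ℝ) - (n + 1 : ℕ)) * h = -h := by push_cast; ring
      rw [e2, abs_neg, habs] at t1
      rw [e1, habs] at s1
      change |u n - (u (n + 1) + _ + w (n + 1) * _ / 2)| ≤ _ at t1
      change |w (n + 1) - w n| ≤ _ at s1
      have k2 : |a * h * (w (n + 1) - w n)| ≤ a * h * (B * h) := by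
        rw [abs_mul, abs_of_nonneg hah]; gcongr
      have k1 : |(u (n + 1) - u n) / h + h / 2 * w (n + 1) - F 1 (l + (n + 1 : ℕ) * h)|
          ≤ B * h ^ 2 := by
        have : (u (n + 1) - u n) / h + h / 2 * w (n + 1) - F 1 (l + (n + 1 : ℕ) * h) =
            -(u n - (u (n + 1) + F 1 (l + (n + 1 : ℕ) * h) * -h + w (n + 1) * (-h) ^ 2 / 2)) / h := by
          field_simp; ring
        rw [this, abs_div, abs_neg, habs, div_le_iff₀ hh]
        exact t1.trans (le_of_eq (by ring))
      rw [abs_le] at k1 k2 ⊢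
      constructor <;> linarith [k1.1, k1.2, k2.1, k2.2]
    · obtain ⟨i, rfl⟩ : ∃ i, m = i + 1 := ⟨m - 1, by omega⟩
      rw [Nat.add_sub_cancel]
      have t1 := T3 (i + 1) (by omega) (i + 1 + 1) (by omega)
      have t2 := T3 (i + 1) (by omega) i (by omega)
      have s1 := W1 (i + 1) (by omega) (i + 1 + 1) (by omega)
      have s2 := W1 (i + 1) (by omega) i (by omega)
      have e1 : (((i + 1 + 1 : ℕ) : ℝ) - (i + 1 : ℕ)) * h = h := by push_cast; ring
      have e2 : (((i : ℕ) : ℝ) - (i + 1 : ℕ)) * h = -h := by push_cast; ring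
      rw [e1, habs] at t1 s1
      rw [e2, abs_neg, habs] at t2 s2
      change |u (i + 1 + 1) - (u (i + 1) + _ + w (i + 1) * _ / 2)| ≤ _ at t1
      change |u i - (u (i + 1) + _ + w (i + 1) * _ / 2)| ≤ _ at t2
      change |w (i + 1 + 1) - w (i + 1)| ≤ _ at s1
      change |w i - w (i + 1)| ≤ _ at s2
      have k2 : |a * h / 2 * (w (i + 1 + 1) - w i)| ≤ a * h / 2 * (2 * (B * h)) := by
        rw [abs_mul, abs_of_nonneg (by positivity)]
        gcongr
        rw [abs_le] at s1 s2 ⊢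
        constructor <;> linarith [s1.1, s1.2, s2.1, s2.2]
      have k1 : |(u (i + 1 + 1) - u i) / (2 * h) - F 1 (l + (i + 1 : ℕ) * h)| ≤ B * h ^ 2 := by
        have : (u (i + 1 + 1) - u i) / (2 * h) - F 1 (l + (i + 1 : ℕ) * h) =
            (u (i + 1 + 1) - u i - F 1 (l + (i + 1 : ℕ) * h) * (2 * h)) / (2 * h) := by
          field_simp
        rw [this, abs_div, abs_of_pos (by positivity : 0 < 2 * h), div_le_iff₀ (by positivity)]
        rw [abs_le] at t1 t2 ⊢
        constructor <;> linarith [t1.1, t1.2, t2.1, t2.2]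
      rw [abs_le] at k1 k2 ⊢
      constructor <;> linarith [k1.1, k1.2, k2.1, k2.2]

end

/-! ### Nodal differences of spline coefficients -/

/-- The normalized second difference of the coefficients. -/
noncomputable def coefDD (ρ h : ℝ) (r : ℤ → ℝ) (m : ℤ) : ℝ :=
  (1 + 2 * eta ρ h) * (r (m - 1) - 2 * r m + r (m + 1)) / h ^ 2

/-- The normalized centered difference of the coefficients. -/
noncomputable def coefD (ρ h : ℝ) (r : ℤ → ℝ) (m : ℤ) : ℝ :=
  (1 + 2 * eta ρ h) * (r (m + 1) - r (m - 1)) / (2 * h)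

section
variable {ρ h : ℝ}

lemma nodalDD_eq (hρ : 0 < ρ) (hh : 0 < h) (h1 : ρ * h ≤ 1) (r : ℤ → ℝ) (m : ℤ) :
    nodalDD ρ h r m = ratioB ρ h * coefDD ρ h r m := by
  rw [nodalDD, etaDD_eq hρ hh h1, coefDD]
  ring

lemma nodal_eq (hρ : 0 < ρ) (hh : 0 < h) (h1 : ρ * h ≤ 1) (r : ℤ → ℝ) (m : ℤ) :
    nodal ρ h r m = (1 + 2 * eta ρ h) * r m + ratioA ρ h * h ^ 2 * coefDD ρ h r m := by
  have e := eta_eq hρ hh h1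
  have : ratioA ρ h * h ^ 2 * coefDD ρ h r m =
      ratioA ρ h * (1 + 2 * eta ρ h) * (r (m - 1) - 2 * r m + r (m + 1)) := by
    rw [coefDD]; field_simp
  rw [this, ← e, nodal]
  ring

/-- Exact for splines, with zero defect. At the ends the coefficient outside the interval is
eliminated from the centred difference by means of the second difference at the same node. -/
lemma splineRelations_coef (hρ : 0 < ρ) (hh : 0 < h) (h1 : ρ * h ≤ 1) (r : ℤ → ℝ) (n : ℕ) :
    SplineRelations n (ratioA ρ h) h (fun i => nodal ρ h r i) (fun i => coefDD ρ h r i)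
      (fun i => coefD ρ h r i) (fun _ => 0) := by
  have e := eta_eq hρ hh h1
  constructor
  · intro i _
    simp only [nodal_eq hρ hh h1]
    have c1 : ((i + 2 : ℕ) : ℤ) = (i : ℤ) + 2 := by push_cast; ring
    have c2 : ((i + 1 : ℕ) : ℤ) = (i : ℤ) + 1 := by push_cast; ring
    rw [c1, c2]
    simp only [coefDD]
    have d1 : (i : ℤ) + 1 - 1 = i := by ring
    have d2 : (i : ℤ) + 1 + 1 = i + 2 := by ring
    have d3 : (i : ℤ) + 2 - 1 = i + 1 := by ring
    rw [d1, d2, d3]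
    field_simp
    ring
  · intro i _
    simp only [nodal_eq hρ hh h1]
    have c1 : ((i + 2 : ℕ) : ℤ) = (i : ℤ) + 2 := by push_cast; ring
    have c2 : ((i + 1 : ℕ) : ℤ) = (i : ℤ) + 1 := by push_cast; ring
    rw [c1, c2]
    simp only [coefDD, coefD]
    have d1 : (i : ℤ) + 1 - 1 = i := by ring
    have d2 : (i : ℤ) + 1 + 1 = i + 2 := by ring
    have d3 : (i : ℤ) + 2 - 1 = i + 1 := by ring
    rw [d1, d2, d3]
    field_simp
    ring
  · simp only [nodal_eq hρ hh h1, coefDD, coefD, Nat.cast_zero, Nat.cast_one, zero_add, zero_sub,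
      sub_self]
    field_simp
    ring
  · simp only [nodal_eq hρ hh h1]
    have c2 : ((n + 1 : ℕ) : ℤ) = (n : ℤ) + 1 := by push_cast; ring
    rw [c2]
    simp only [coefDD, coefD]
    have d1 : (n : ℤ) + 1 - 1 = n := by ring
    rw [d1]
    field_simp
    ring

/-- A matrix row is the collocated equation in the variables of `SplineRelations`; from here on the
coefficients `χ` are not needed. -/
lemma chi_row_eq (P : Problem) (hρ : 0 < ρ) {N : ℕ} (K : ℕ) (hh : 0 < P.hx N) (h1 : ρ * P.hx N ≤ 1)
    (r : ℤ → ℝ) (m : ℤ) :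
    P.chi1 ρ N K * r (m - 1) + P.chi2 ρ N K * r m + P.chi3 ρ N K * r (m + 1) =
      nodal ρ (P.hx N) r m - P.gammaT K * (P.α * ratioB ρ (P.hx N) * coefDD ρ (P.hx N) r m
        + P.β * coefD ρ (P.hx N) r m - P.γ * nodal ρ (P.hx N) r m) := by
  have e1 := etaD_eq hρ hh h1
  have e2 := etaDD_eq hρ hh h1
  unfold Problem.chi1 Problem.chi2 Problem.chi3 nodal coefDD coefD
  rw [e1, e2]
  field_simp
  ring

end

/-! ### Consistency on the closed rectangle -/

lemma hasDerivWithinAt_iteratedDerivWithin_Icc {f : ℝ → ℝ} {a b : ℝ} {k : ℕ} (hab : a < b)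
    (hf : ContDiffOn ℝ k f (Icc a b)) {i : ℕ} (hi : i < k) {x : ℝ} (hx : x ∈ Icc a b) :
    HasDerivWithinAt (iteratedDerivWithin i f (Icc a b)) (iteratedDerivWithin (i + 1) f (Icc a b) x)
      (Icc a b) x := by
  rw [iteratedDerivWithin_succ]
  exact ((hf.differentiableOn_iteratedDerivWithin (by exact_mod_cast hi)
    (uniqueDiffOn_Icc hab)) x hx).hasDerivWithinAt

lemma exists_common_bound {X : Type*} [TopologicalSpace X] {s : Set X} (hs : IsCompact s) (k : ℕ)
    {f : ℕ → X → ℝ} (hf : ∀ i ≤ k, ContinuousOn (f i) s) :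
    ∃ B : ℝ, 0 ≤ B ∧ ∀ i ≤ k, ∀ p ∈ s, |f i p| ≤ B := by
  have h : ∀ i, ∃ b : ℝ, i ≤ k → ∀ p ∈ s, |f i p| ≤ b := by
    intro i
    by_cases hi : i ≤ k
    · obtain ⟨b, hb⟩ := hs.exists_bound_of_continuousOn (hf i hi)
      exact ⟨b, fun _ p hp => by simpa using hb p hp⟩
    · exact ⟨0, fun h => absurd h hi⟩
  choose b hb using h
  refine ⟨∑ i ∈ Finset.range (k + 1), |b i|, Finset.sum_nonneg fun _ _ => abs_nonneg _,
    fun i hi p hp => (hb i hi p hp).trans ((le_abs_self _).trans ?_)⟩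
  exact Finset.single_le_sum (f := fun i => |b i|) (fun _ _ => abs_nonneg _)
    (Finset.mem_range.2 (by omega))

lemma ContDiffInSpace.continuousOn_zero {k : ℕ} {f : ℝ → ℝ → ℝ} {a b T : ℝ}
    (hf : ContDiffInSpace k f a b T) :
    ContinuousOn (fun p : ℝ × ℝ => f p.1 p.2) (Icc a b ×ˢ Icc 0 T) := by
  have := hf.2 0 (Nat.zero_le _)
  simpa only [iteratedDerivWithin_zero] using this

/-- The right-hand side of the equation, with one-sided derivatives at the end points. -/
noncomputable def Problem.rhs (P : Problem) (u : ℝ → ℝ → ℝ) (x t : ℝ) : ℝ :=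
  P.α * iteratedDerivWithin 2 (fun y => u y t) (Icc P.left P.right) x
    + P.β * iteratedDerivWithin 1 (fun y => u y t) (Icc P.left P.right) x
    - P.γ * u x t + P.ψ x t

section
variable {P : Problem} {u : ℝ → ℝ → ℝ}

lemma iteratedDerivWithin_Icc_eq {f : ℝ → ℝ} {a b x : ℝ} (i : ℕ) (hx : x ∈ Ioo a b) :
    iteratedDerivWithin i f (Icc a b) x = iteratedDeriv i f x := by
  have h : Icc a b =ᶠ[nhds x] univ := by
    filter_upwards [Icc_mem_nhds hx.1 hx.2] with y hy
    exact propext ⟨fun _ => trivial, fun _ => hy⟩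
  rw [← iteratedDerivWithin_univ, iteratedDerivWithin, iteratedDerivWithin,
    iteratedFDerivWithin_congr_set h]

lemma caputo_eq_rhs (hu : P.IsSolution u) {x t : ℝ} (hx : x ∈ Ioo P.left P.right)
    (ht : t ∈ Ioo 0 P.T) : caputo P.μ (fun s => u x s) t = P.rhs u x t := by
  rw [hu.equation x hx t ht, Problem.rhs, iteratedDerivWithin_Icc_eq 2 hx,
    iteratedDerivWithin_Icc_eq 1 hx, iteratedDeriv_one]

lemma continuousOn_rhs {k l : ℕ} (hk : 2 ≤ k) (hux : ContDiffInSpace k u P.left P.right P.T)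
    (hψ : ContDiffInSpace l P.ψ P.left P.right P.T) :
    ContinuousOn (fun p : ℝ × ℝ => P.rhs u p.1 p.2) (Icc P.left P.right ×ˢ Icc 0 P.T) := by
  unfold Problem.rhs
  exact (((continuousOn_const.mul (hux.2 2 hk)).add
    (continuousOn_const.mul (hux.2 1 (by omega)))).sub
    (continuousOn_const.mul hux.continuousOn_zero)).add hψ.continuousOn_zero

lemma continuousOn_l1Approx {a b T μ : ℝ} (hμ₁ : μ < 1)
    (hu : ContinuousOn (fun p : ℝ × ℝ => u p.1 p.2) (Icc a b ×ˢ Icc 0 T)) (n : ℕ) :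
    ContinuousOn (fun p : ℝ × ℝ => l1Approx μ (u p.1) n p.2) (Icc a b ×ˢ Ioc 0 T) := by
  have hj : ∀ j ≤ n + 1, ContinuousOn (fun p : ℝ × ℝ => u p.1 (j * (p.2 / (n + 1 : ℕ))))
      (Icc a b ×ˢ Ioc 0 T) := by
    intro j hj
    refine hu.comp (f := fun p : ℝ × ℝ => (p.1, (j : ℝ) * (p.2 / (n + 1 : ℕ))))
      (by fun_prop) ?_
    rintro ⟨x, t⟩ ⟨hx, ht⟩
    have hj' : (j : ℝ) ≤ (n + 1 : ℕ) := by exact_mod_cast hj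
    have h0 : 0 ≤ t / (n + 1 : ℕ) := div_nonneg ht.1.le (by positivity)
    refine ⟨hx, mul_nonneg (by positivity) h0, ?_⟩
    calc (j : ℝ) * (t / (n + 1 : ℕ)) ≤ (n + 1 : ℕ) * (t / (n + 1 : ℕ)) := by gcongr
      _ = t := by field_simp
      _ ≤ T := ht.2
  unfold l1Approx l1History
  refine ContinuousOn.div ?_ ?_ ?_
  · refine (hj (n + 1) le_rfl).sub ((hj n (by omega)).sub (continuousOn_finsetSum _ fun k hk => ?_))
    have := Finset.mem_Icc.1 hk
    exact continuousOn_const.mul ((hj (n - k + 1) (by omega)).sub (hj (n - k) (by omega)))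
  · refine continuousOn_const.mul (ContinuousOn.rpow_const (by fun_prop) ?_)
    rintro ⟨x, t⟩ ⟨-, ht⟩
    exact Or.inl (div_pos ht.1 (by positivity)).ne'
  · rintro ⟨x, t⟩ ⟨-, ht⟩
    exact mul_ne_zero (Real.Gamma_pos_of_pos (by linarith)).ne'
      (Real.rpow_pos_of_pos (div_pos ht.1 (by positivity)) _).ne'

/-- The L1 formula applied to the solution satisfies the equation up to order `2 - μ`, at every
point of the closed rectangle with positive time. -/
theorem exists_l1Approx_bound (hdom : P.left < P.right) (hT : 0 < P.T) (hμ₀ : 0 < P.μ)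
    (hμ₁ : P.μ < 1) (hu : P.IsSolution u)
    (hux : ContDiffInSpace 4 u P.left P.right P.T) (hut : ContDiffInTime 2 u P.left P.right P.T)
    (hψ : ContDiffInSpace 2 P.ψ P.left P.right P.T) :
    ∃ C : ℝ, 0 ≤ C ∧ ∀ n : ℕ, ∀ x ∈ Icc P.left P.right, ∀ t ∈ Ioc 0 P.T,
      |l1Approx P.μ (u x) n t - P.rhs u x t| ≤ C * (t / (n + 1 : ℕ)) ^ (2 - P.μ) := by
  obtain ⟨B, hB0, hB⟩ := exists_common_bound (isCompact_Icc.prod isCompact_Icc) 2 hut.2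
  have hΓ : 0 < Real.Gamma (1 - P.μ) := Real.Gamma_pos_of_pos (by linarith)
  have hμ' : 0 < 1 - P.μ := by linarith
  set C := (1 + 1 / (1 - P.μ)) / Real.Gamma (1 - P.μ) * B with hC
  refine ⟨C, by positivity, fun n => ?_⟩
  have hopen : ∀ p ∈ Ioo P.left P.right ×ˢ Ioo 0 P.T,
      |l1Approx P.μ (u p.1) n p.2 - P.rhs u p.1 p.2| ≤ C * (p.2 / (n + 1 : ℕ)) ^ (2 - P.μ) := by
    rintro ⟨x, t⟩ ⟨hx, ht⟩
    rw [← caputo_eq_rhs hu hx ht]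
    have hxI := Ioo_subset_Icc_self hx
    have hd : ∀ i < 2, ∀ s ∈ Icc 0 P.T, HasDerivWithinAt
        (iteratedDerivWithin i (fun t => u x t) (Icc 0 P.T))
        (iteratedDerivWithin (i + 1) (fun t => u x t) (Icc 0 P.T) s) (Icc 0 P.T) s :=
      fun i hi s hs => hasDerivWithinAt_iteratedDerivWithin_Icc hT (hut.1 x hxI) hi hs
    have hsub : Icc 0 t ⊆ Icc 0 P.T := Icc_subset_Icc le_rfl ht.2.le
    refine abs_l1Approx_sub_caputo_le (f := u x) (B := B)
      (g := iteratedDerivWithin 1 (fun t => u x t) (Icc 0 P.T)) hμ₀ hμ₁ ht.1 n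
      (fun s hs => ((hd 1 (by norm_num) s (hsub hs)).mono hsub).continuousWithinAt)
      (fun s hs => ?_) hB0 (fun s hs r hr => ?_)
    · have := (hd 0 (by norm_num) s (hsub hs)).mono hsub
      rwa [iteratedDerivWithin_zero] at this
    · exact (convex_Icc 0 P.T).norm_image_sub_le_of_norm_hasDerivWithin_le
        (hd 1 (by norm_num)) (fun y hy => hB 2 le_rfl (x, y) ⟨hxI, hy⟩) (hsub hr) (hsub hs)
  intro x hx t ht
  have hsub : Ioo P.left P.right ×ˢ Ioo 0 P.T ⊆ Icc P.left P.right ×ˢ Ioc 0 P.T :=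
    prod_mono Ioo_subset_Icc_self Ioo_subset_Ioc_self
  -- The equation is known only in the open rectangle, whereas the scheme collocates at the end
  -- points and at the final time. Both sides are continuous for positive time, so the inequality
  -- passes to the closure.
  have hcl : (x, t) ∈ closure (Ioo P.left P.right ×ˢ Ioo 0 P.T) := by
    rw [closure_prod_eq, closure_Ioo hdom.ne, closure_Ioo hT.ne]
    exact ⟨hx, Ioc_subset_Icc_self ht⟩
  have hmem : (x, t) ∈ Icc P.left P.right ×ˢ Ioc 0 P.T := ⟨hx, ht⟩
  have c1 : ContinuousOn (fun p : ℝ × ℝ => |l1Approx P.μ (u p.1) n p.2 - P.rhs u p.1 p.2|)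
      (Icc P.left P.right ×ˢ Ioc 0 P.T) :=
    ((continuousOn_l1Approx hμ₁ hux.continuousOn_zero n).sub
      ((continuousOn_rhs (by norm_num) hux hψ).mono (prod_mono le_rfl Ioc_subset_Icc_self))).abs
  have c2 : ContinuousOn (fun p : ℝ × ℝ => C * (p.2 / (n + 1 : ℕ)) ^ (2 - P.μ))
      (Icc P.left P.right ×ˢ Ioc 0 P.T) :=
    continuousOn_const.mul (ContinuousOn.rpow_const (by fun_prop) fun _ _ => Or.inr (by linarith))
  exact ContinuousWithinAt.closure_le hcl ((c1 _ hmem).mono hsub) ((c2 _ hmem).mono hsub) hopen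

end

/-! ### Solvability -/

/-- The linear functional `c₁ r_{m-1} + c₂ r_m + c₃ r_{m+1}`. -/
noncomputable def threeTerm (c₁ c₂ c₃ : ℝ) (m : ℤ) : (ℤ → ℝ) →ₗ[ℝ] ℝ :=
  c₁ • LinearMap.proj (m - 1) + c₂ • LinearMap.proj m + c₃ • LinearMap.proj (m + 1)

lemma threeTerm_apply (c₁ c₂ c₃ : ℝ) (m : ℤ) (r : ℤ → ℝ) :
    threeTerm c₁ c₂ c₃ m r = c₁ * r (m - 1) + c₂ * r m + c₃ * r (m + 1) := by
  simp [threeTerm]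

/-- A system of `N + 3` equations in the unknowns `r_{-1}, …, r_{N+1}` is solvable if the
homogeneous system is only solvable trivially. -/
lemma exists_solution_of_injective {N : ℕ} (T : (ℤ → ℝ) →ₗ[ℝ] (Fin (N + 3) → ℝ))
    (hT : ∀ r, T r = 0 → ∀ m : ℤ, -1 ≤ m → m ≤ N + 1 → r m = 0) (v : Fin (N + 3) → ℝ) :
    ∃ r, T r = v := by
  -- Indices outside `-1, …, N + 1` are clamped to the nearest end; `φ` is a left inverse of the
  -- shift `i ↦ i - 1`, and finite dimension then gives surjectivity.
  let φ : ℤ → Fin (N + 3) := fun m => ⟨min (m + 1).toNat (N + 2), by omega⟩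
  let E : (Fin (N + 3) → ℝ) →ₗ[ℝ] (ℤ → ℝ) := LinearMap.funLeft ℝ ℝ φ
  have hinj : Function.Injective (T ∘ₗ E) := by
    rw [← LinearMap.ker_eq_bot, LinearMap.ker_eq_bot']
    intro w hw
    funext i
    have hi := i.2
    have h := hT (E w) hw ((i : ℕ) - 1) (by omega) (by omega)
    have hφ : φ ((i : ℕ) - 1) = i := by
      ext
      simp only [φ]
      omega
    have : E w ((i : ℕ) - 1) = w (φ ((i : ℕ) - 1)) := rfl
    rw [this, hφ] at h
    exact h
  obtain ⟨w, hw⟩ := (LinearMap.injective_iff_surjective.1 hinj) v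
  exact ⟨E w, hw⟩

lemma exists_tridiagonal_solution {N : ℕ} (b₁ b₂ b₃ c₁ c₂ c₃ : ℝ)
    (hinj : ∀ r : ℤ → ℝ, b₁ * r (0 - 1) + b₂ * r 0 + b₃ * r (0 + 1) = 0 →
      b₁ * r (N - 1) + b₂ * r N + b₃ * r (N + 1) = 0 →
      (∀ m : ℤ, 0 ≤ m → m ≤ N → c₁ * r (m - 1) + c₂ * r m + c₃ * r (m + 1) = 0) →
      ∀ m : ℤ, -1 ≤ m → m ≤ N + 1 → r m = 0) (vl vr : ℝ) (v : ℤ → ℝ) :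
    ∃ r : ℤ → ℝ, b₁ * r (0 - 1) + b₂ * r 0 + b₃ * r (0 + 1) = vl ∧
      b₁ * r (N - 1) + b₂ * r N + b₃ * r (N + 1) = vr ∧
      ∀ m : ℤ, 0 ≤ m → m ≤ N → c₁ * r (m - 1) + c₂ * r m + c₃ * r (m + 1) = v m := by
  let T : (ℤ → ℝ) →ₗ[ℝ] (Fin (N + 3) → ℝ) := LinearMap.pi fun i =>
    if (i : ℕ) = 0 then threeTerm b₁ b₂ b₃ 0 else if (i : ℕ) = N + 2 then threeTerm b₁ b₂ b₃ N
      else threeTerm c₁ c₂ c₃ ((i : ℕ) - 1)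
  have hl : ∀ r, T r ⟨0, by omega⟩ = b₁ * r (0 - 1) + b₂ * r 0 + b₃ * r (0 + 1) := fun r => by
    simp only [T, LinearMap.pi_apply, if_true, threeTerm_apply]
  have hr : ∀ r, T r ⟨N + 2, by omega⟩ = b₁ * r (N - 1) + b₂ * r N + b₃ * r (N + 1) := fun r => by
    simp only [T, LinearMap.pi_apply]
    rw [if_neg (by omega), if_pos trivial, threeTerm_apply]
  have hm : ∀ (r) (m : ℤ) (h0 : 0 ≤ m) (h1 : m ≤ N), T r ⟨(m + 1).toNat, by omega⟩ =
      c₁ * r (m - 1) + c₂ * r m + c₃ * r (m + 1) := fun r m h0 h1 => by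
    simp only [T, LinearMap.pi_apply]
    rw [if_neg (by omega), if_neg (by omega), threeTerm_apply]
    have : (((m + 1).toNat : ℕ) : ℤ) - 1 = m := by omega
    rw [this]
  obtain ⟨r, hr'⟩ := exists_solution_of_injective T (fun r h0 => by
    refine hinj r ?_ ?_ fun m hm0 hm1 => ?_
    · rw [← hl, h0]; rfl
    · rw [← hr, h0]; rfl
    · rw [← hm r m hm0 hm1, h0]; rfl)
    (fun i => if (i : ℕ) = 0 then vl else if (i : ℕ) = N + 2 then vr else v ((i : ℕ) - 1))
  refine ⟨r, ?_, ?_, fun m hm0 hm1 => ?_⟩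
  · rw [← hl, hr']; simp
  · rw [← hr, hr']; simp
  · rw [← hm r m hm0 hm1, hr']
    simp only
    rw [if_neg (by omega), if_neg (by omega)]
    have : (((m + 1).toNat : ℕ) : ℤ) - 1 = m := by omega
    rw [this]

section
variable {ρ h : ℝ}

/-- Vanishing end slopes reflect the outer coefficients to inner ones, so the maximal modulus is
attained at a node `0, …, N`; there `2η < 1` forces it to be zero. -/
lemma initial_system_injective (hρ : 0 < ρ) (hh : 0 < h) (h1 : ρ * h ≤ 1) {N : ℕ} (hN : 1 ≤ N)
    (r : ℤ → ℝ) (hl : etaD ρ h * (r 1 - r (-1)) = 0) (hr : etaD ρ h * (r (N + 1) - r (N - 1)) = 0)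
    (hm : ∀ m : ℤ, 0 ≤ m → m ≤ N → nodal ρ h r m = 0) :
    ∀ m : ℤ, -1 ≤ m → m ≤ N + 1 → r m = 0 := by
  have hD : etaD ρ h ≠ 0 := by
    rw [etaD_eq hρ hh h1]
    exact (div_pos (one_add_two_eta_pos hρ hh h1) (by positivity)).ne'
  have hl' : r (-1) = r 1 := by
    have := (mul_eq_zero.1 hl).resolve_left hD
    linarith
  have hr' : r (N + 1) = r (N - 1) := by
    have := (mul_eq_zero.1 hr).resolve_left hD
    linarith
  obtain ⟨k, hk, hmax⟩ := Finset.exists_max_image (Finset.Icc (0 : ℤ) N) (fun m => |r m|)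
    ⟨0, by simp⟩
  rw [Finset.mem_Icc] at hk
  have hall : ∀ m : ℤ, -1 ≤ m → m ≤ N + 1 → |r m| ≤ |r k| := by
    intro m h0 h1
    rcases eq_or_ne m (-1) with rfl | hne
    · rw [hl']; exact hmax 1 (Finset.mem_Icc.2 ⟨by omega, by omega⟩)
    rcases eq_or_ne m (N + 1) with rfl | hne'
    · rw [hr']; exact hmax _ (Finset.mem_Icc.2 ⟨by omega, by omega⟩)
    · exact hmax m (Finset.mem_Icc.2 ⟨by omega, by omega⟩)
  have hη := eta_pos hρ hh h1
  have hη2 := two_eta_lt_one hρ hh h1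
  have e := hm k hk.1 hk.2
  have a1 := hall (k - 1) (by omega) (by omega)
  have a2 := hall (k + 1) (by omega) (by omega)
  have hrk : |r k| ≤ 2 * eta ρ h * |r k| := by
    have : r k = -(eta ρ h * r (k - 1)) + -(eta ρ h * r (k + 1)) := by
      rw [nodal] at e; linarith
    calc |r k| = |-(eta ρ h * r (k - 1)) + -(eta ρ h * r (k + 1))| := by rw [← this]
      _ ≤ |-(eta ρ h * r (k - 1))| + |-(eta ρ h * r (k + 1))| := abs_add_le _ _
      _ = eta ρ h * |r (k - 1)| + eta ρ h * |r (k + 1)| := by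
        rw [abs_neg, abs_neg, abs_mul, abs_mul, abs_of_pos hη]
      _ ≤ eta ρ h * |r k| + eta ρ h * |r k| := by gcongr
      _ = _ := by ring
  have hz : |r k| = 0 := by
    have := abs_nonneg (r k)
    by_contra hne
    have hpos : 0 < |r k| := lt_of_le_of_ne this (Ne.symm hne)
    nlinarith
  intro m h0 h1
  have := hall m h0 h1
  rw [hz] at this
  exact abs_nonpos_iff.1 this

end

/-! ### Maximum bounds for second differences -/

/-- The hypothesis is applied with `E` equal to the maximum itself. -/
lemma abs_le_of_contraction {n : ℕ} {C : ℝ} {ε : ℕ → ℝ}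
    (h : ∀ E : ℝ, (∀ m ≤ n + 1, |ε m| ≤ E) → ∀ m ≤ n + 1, |ε m| ≤ 2 / 3 * E + C) :
    ∀ m ≤ n + 1, |ε m| ≤ 3 * C := by
  obtain ⟨k, hk, hmax⟩ := Finset.exists_max_image (Finset.range (n + 2)) (fun m => |ε m|)
    ⟨0, by simp⟩
  have hk' := Finset.mem_range.1 hk
  have hE : ∀ m ≤ n + 1, |ε m| ≤ |ε k| := fun m hm => hmax m (Finset.mem_range.2 (by omega))
  intro m hm
  have := h _ hE k (by omega)
  linarith [hE m hm]

section
variable {n : ℕ} {a h M S : ℝ} {e ε p σ : ℕ → ℝ}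

/-- Diagonal dominance: the diagonal entry is `1 - 2a ≥ 3/5` and the off-diagonal ones add up to `2a
≤ 2/5`. -/
lemma SplineRelations.interior_contraction (H : SplineRelations n a h e ε p σ) (hh : 0 < h)
    (ha0 : 0 ≤ a) (ha : a ≤ 1 / 5) (hM : ∀ m ≤ n + 1, |e m| ≤ M) (hS : ∀ i < n, |σ (i + 1)| ≤ S)
    {E : ℝ} (hE : ∀ m ≤ n + 1, |ε m| ≤ E) {i : ℕ} (hi : i < n) :
    |ε (i + 1)| ≤ 2 / 3 * E + 5 / 3 * (4 * M / h ^ 2 + S) := by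
  have E0 : 0 ≤ E := (abs_nonneg _).trans (hE 0 (by omega))
  have k1 : |(e (i + 2) - 2 * e (i + 1) + e i) / h ^ 2| ≤ 4 * M / h ^ 2 := by
    rw [abs_div, abs_of_pos (by positivity : 0 < h ^ 2)]
    gcongr
    have m1 := abs_le.1 (hM i (by omega))
    have m2 := abs_le.1 (hM (i + 1) (by omega))
    have m3 := abs_le.1 (hM (i + 2) (by omega))
    rw [abs_le]; constructor <;> linarith [m1.1, m1.2, m2.1, m2.2, m3.1, m3.2]
  have k2 : |a * (ε (i + 2) + ε i)| ≤ a * (2 * E) := by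
    rw [abs_mul, abs_of_nonneg ha0]
    gcongr
    have m1 := abs_le.1 (hE i (by omega))
    have m3 := abs_le.1 (hE (i + 2) (by omega))
    rw [abs_le]; constructor <;> linarith [m1.1, m1.2, m3.1, m3.2]
  have k3 : (1 - 2 * a) * ε (i + 1) = (e (i + 2) - 2 * e (i + 1) + e i) / h ^ 2 + σ (i + 1)
      - a * (ε (i + 2) + ε i) := by linear_combination H.second i hi
  have k4 : (1 - 2 * a) * |ε (i + 1)| ≤ 4 * M / h ^ 2 + S + a * (2 * E) := by
    rw [← abs_of_nonneg (by linarith : (0 : ℝ) ≤ 1 - 2 * a), ← abs_mul, k3]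
    have s := hS i hi
    rw [abs_le] at k1 k2 s ⊢
    constructor <;> linarith [k1.1, k1.2, k2.1, k2.2, s.1, s.2]
  have k5 : 3 / 5 * |ε (i + 1)| ≤ (1 - 2 * a) * |ε (i + 1)| := by
    gcongr; linarith
  have k6 : a * (2 * E) ≤ 1 / 5 * (2 * E) := by gcongr
  linarith

/-- Maximum bound when the boundary relation comes from the equation. -/
lemma SplineRelations.abs_second_le (H : SplineRelations n a h e ε p σ) (hh : 0 < h)
    (ha0 : 0 ≤ a) (ha : a ≤ 1 / 5) {α β b S' : ℝ} (hα : 0 < α) (hb : 1 / 2 ≤ b)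
    (hβ : |β| * h ≤ α / 4)
    (hM : ∀ m ≤ n + 1, |e m| ≤ M) (hS : ∀ i < n, |σ (i + 1)| ≤ S) (hS0 : 0 ≤ S)
    (hl : |α * b * ε 0 + β * p 0| ≤ S') (hr : |α * b * ε (n + 1) + β * p (n + 1)| ≤ S') :
    ∀ m ≤ n + 1, |ε m| ≤
      3 * (5 / 3 * (4 * M / h ^ 2 + S) + 2 / α * (S' + |β| * (2 * M / h))) := by
  have M0 : 0 ≤ M := (abs_nonneg _).trans (hM 0 (by omega))
  have S0 : 0 ≤ S' := (abs_nonneg _).trans hl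
  have n1 : 0 ≤ 2 / α * (S' + |β| * (2 * M / h)) := by positivity
  have n2 : 0 ≤ 5 / 3 * (4 * M / h ^ 2 + S) := by positivity
  refine abs_le_of_contraction fun E hE m hm => ?_
  have E0 : 0 ≤ E := (abs_nonneg _).trans (hE 0 (by omega))
  have ahE : 0 ≤ h * E := by positivity
  -- At an end node the equation controls `ε` up to the slope. The slope brings in `|β| h E ≤ α E /
  -- 4`, and dividing by `α b ≥ α / 2` leaves the factor `1/2`.
  have bd : ∀ x q : ℝ, |α * b * x + β * q| ≤ S' → |q| ≤ 2 * M / h + h * E →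
      |x| ≤ 2 / 3 * E + 2 / α * (S' + |β| * (2 * M / h)) := by
    intro x q h1 h2
    have h3 : |α * b * x| ≤ S' + |β| * (2 * M / h + h * E) := by
      have : α * b * x = (α * b * x + β * q) + -(β * q) := by ring
      rw [this]
      refine (abs_add_le _ _).trans (add_le_add h1 ?_)
      rw [abs_neg, abs_mul]
      gcongr
    rw [abs_mul, abs_of_pos (by positivity : 0 < α * b)] at h3
    have h4 : α * (1 / 2) * |x| ≤ α * b * |x| := by gcongr
    have h5 : |β| * h * E ≤ α / 4 * E := by gcongr
    have h6 : |x| ≤ 2 / α * (S' + |β| * (2 * M / h) + α / 4 * E) := by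
      rw [div_mul_eq_mul_div, le_div_iff₀ hα]
      linarith
    have h7 : 2 / α * (S' + |β| * (2 * M / h) + α / 4 * E) =
      2 / α * (S' + |β| * (2 * M / h)) + 1 / 2 * E := by field_simp; ring
    linarith
  have bq : ∀ x y z w v : ℝ, |x| ≤ M → |y| ≤ M → |z| ≤ E → |w| ≤ E → |v| ≤ E →
      |(x - y) / h - a * h * (z - w) + h / 2 * v| ≤ 2 * M / h + h * E := by
    intro x y z w v hx hy hz hw hv
    have q1 : |(x - y) / h| ≤ 2 * M / h := by
      rw [abs_div, abs_of_pos hh]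
      gcongr
      rw [abs_le] at hx hy ⊢; constructor <;> linarith [hx.1, hx.2, hy.1, hy.2]
    have q2 : |a * h * (z - w)| ≤ 1 / 5 * h * (2 * E) := by
      rw [abs_mul, abs_of_nonneg (by positivity)]
      gcongr
      rw [abs_le] at hz hw ⊢; constructor <;> linarith [hz.1, hz.2, hw.1, hw.2]
    have q3 : |h / 2 * v| ≤ h / 2 * E := by
      rw [abs_mul, abs_of_pos (by positivity)]; gcongr
    rw [abs_le] at q1 q2 q3 ⊢
    constructor <;> linarith [q1.1, q1.2, q2.1, q2.2, q3.1, q3.2]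
  rcases Nat.eq_zero_or_pos m with rfl | hm0
  · have : |p 0| ≤ 2 * M / h + h * E := by
      have := bq (e 1) (e 0) (ε 1) (ε 0) (-ε 0) (hM 1 (by omega)) (hM 0 (by omega))
        (hE 1 (by omega)) (hE 0 (by omega)) (by rw [abs_neg]; exact hE 0 (by omega))
      convert this using 2
      rw [H.first_left]; ring
    linarith [bd _ _ hl this]
  rcases eq_or_ne m (n + 1) with rfl | hne
  · have : |p (n + 1)| ≤ 2 * M / h + h * E := by
      rw [H.first_right]
      exact bq _ _ _ _ _ (hM _ le_rfl) (hM n (by omega)) (hE _ le_rfl) (hE n (by omega))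
        (hE _ le_rfl)
    linarith [bd _ _ hr this]
  · obtain ⟨i, rfl⟩ : ∃ i, m = i + 1 := ⟨m - 1, by omega⟩
    linarith [H.interior_contraction hh ha0 ha hM hS hE (i := i) (by omega)]

/-- Maximum bound when the values are interpolated and the end slopes are prescribed. -/
lemma SplineRelations.abs_second_le_of_slopes (H : SplineRelations n a h e ε p σ) (hh : 0 < h)
    (ha0 : 0 ≤ a) (ha : a ≤ 1 / 5) {S' : ℝ} (he : ∀ m ≤ n + 1, e m = 0)
    (hS : ∀ i < n, |σ (i + 1)| ≤ S) (hS0 : 0 ≤ S) (hl : |p 0| ≤ S' * h)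
    (hr : |p (n + 1)| ≤ S' * h) :
    ∀ m ≤ n + 1, |ε m| ≤ 3 * (5 / 3 * S + 10 / 3 * S') := by
  have S0 : 0 ≤ S' := by
    have := (abs_nonneg _).trans hl
    by_contra hneg
    nlinarith
  -- For vanishing values the end relation couples the slope to the last two second differences,
  -- with dominance ratio `a / (1/2 - a) ≤ 2/3`.
  have bd : ∀ x y q E : ℝ, 0 ≤ E → |y| ≤ E → |q| ≤ S' * h → q = a * h * y + h * (1 / 2 - a) * x →
      |x| ≤ 2 / 3 * E + 10 / 3 * S' := by
    intro x y q E E0 hy hq hqe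
    have h1 : h * (1 / 2 - a) * x = q - a * h * y := by rw [hqe]; ring
    have h2 : h * ((1 / 2 - a) * |x|) ≤ h * (S' + a * E) := by
      have : h * ((1 / 2 - a) * |x|) = |q - a * h * y| := by
        rw [← h1, abs_mul, abs_mul, abs_of_pos hh,
          abs_of_nonneg (by linarith : (0 : ℝ) ≤ 1 / 2 - a)]
        ring
      rw [this]
      have h3 : |a * h * y| ≤ a * h * E := by
        rw [abs_mul, abs_of_nonneg (by positivity)]; gcongr
      rw [abs_le] at hq h3 ⊢
      constructor <;> linarith [hq.1, hq.2, h3.1, h3.2]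
    have h4 := le_of_mul_le_mul_left h2 hh
    have h5 : 3 / 10 * |x| ≤ (1 / 2 - a) * |x| := by gcongr; linarith
    have h6 : a * E ≤ 1 / 5 * E := by gcongr
    linarith
  refine abs_le_of_contraction fun E hE m hm => ?_
  have E0 : 0 ≤ E := (abs_nonneg _).trans (hE 0 (by omega))
  rcases Nat.eq_zero_or_pos m with rfl | hm0
  · have := bd (ε 0) (ε 1) (-p 0) E E0 (hE 1 (by omega)) (by rwa [abs_neg])
      (by rw [H.first_left, he 0 (by omega), he 1 (by omega)]; ring)
    linarith
  rcases eq_or_ne m (n + 1) with rfl | hne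
  · have := bd (ε (n + 1)) (ε n) (p (n + 1)) E E0 (hE n (by omega)) hr
      (by rw [H.first_right, he n (by omega), he (n + 1) (by omega)]; ring)
    linarith
  · obtain ⟨i, rfl⟩ : ∃ i, m = i + 1 := ⟨m - 1, by omega⟩
    have := H.interior_contraction (M := 0) hh ha0 ha
      (fun m hm => by rw [he m hm, abs_zero]) hS hE (i := i) (by omega)
    rw [mul_zero, zero_div, zero_add] at this
    linarith

end

/-- The step system has only the trivial homogeneous solution. -/
lemma step_system_injective (P : Problem) {ρ : ℝ} {n K : ℕ} (hα : 0 < P.α) (hγ : 0 < P.γ)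
    (hρ : 0 < ρ) (hg : 0 < P.gammaT K) (hh : 0 < P.hx (n + 1)) (h1 : ρ * P.hx (n + 1) ≤ 1 / 2)
    (hL : P.right - P.left = (n + 1 : ℕ) * P.hx (n + 1))
    (hmesh : P.hx (n + 1) ≤ energyMesh P.α P.β (P.right - P.left))
    (hβ : |P.β| * P.hx (n + 1) ≤ P.α / 4) (r : ℤ → ℝ)
    (hl : nodal ρ (P.hx (n + 1)) r 0 = 0) (hr : nodal ρ (P.hx (n + 1)) r (n + 1 : ℕ) = 0)
    (hm : ∀ m : ℤ, 0 ≤ m → m ≤ (n + 1 : ℕ) →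
      P.chi1 ρ (n + 1) K * r (m - 1) + P.chi2 ρ (n + 1) K * r m
        + P.chi3 ρ (n + 1) K * r (m + 1) = 0) :
    ∀ m : ℤ, -1 ≤ m → m ≤ (n + 1 : ℕ) + 1 → r m = 0 := by
  set h := P.hx (n + 1) with hhdef
  have h1' : ρ * h ≤ 1 := by linarith
  have hL0 : 0 < P.right - P.left := by rw [hL]; positivity
  have ha0 := ratioA_nonneg hρ hh h1'
  have ha := ratioA_le hρ hh h1'
  have hbb := abs_le.1 (abs_ratioB_sub_one_le hρ hh h1')
  have hq : ρ ^ 2 * h ^ 2 ≤ 1 / 4 := by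
    have : 0 < ρ * h := by positivity
    nlinarith
  have H := splineRelations_coef hρ hh h1' r n
  have hrow : ∀ m ≤ n + 1, nodal ρ h r (m : ℕ) - 0 = P.gammaT K *
      (P.α * ratioB ρ h * coefDD ρ h r (m : ℕ) + P.β * coefD ρ h r (m : ℕ)
        - P.γ * nodal ρ h r (m : ℕ) + 0) := by
    intro m hm'
    have := hm m (by omega) (by omega)
    rw [chi_row_eq P hρ K hh h1'] at this
    linarith
  -- With zero history and zero source the energy is nonpositive, so all nodal values vanish; the
  -- second differences vanish next, and then the coefficients.
  have hen := energy_step (f := fun _ => 0) (τ := fun _ => 0) (G := 0) hα hγ.le hh hL hmesh ha0 ha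
    (by linarith) (by linarith) hg H hl hr rfl rfl hrow (by simp) (by simp)
  have hgrad : gradForm n h (fun i => nodal ρ h r i) (fun i => nodal ρ h r i) ≤ 0 := by
    have h3 := mul_nonneg (energyWeight_pos P.α P.β).le
      (massForm_self_nonneg (n := n) hh (fun i => nodal ρ h r i))
    simp only [sub_zero] at hen
    norm_num at hen
    linarith
  have he : ∀ m ≤ n + 1, nodal ρ h r (m : ℕ) = 0 := by
    intro m hm'
    have h3 := sq_le_gradForm (n := n) hh (e := fun i => nodal ρ h r i) hl hm'
    rw [← hL] at h3
    have h4 : nodal ρ h r (m : ℕ) ^ 2 ≤ 0 :=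
      h3.trans (mul_nonpos_of_nonneg_of_nonpos hL0.le hgrad)
    exact pow_eq_zero_iff two_ne_zero |>.1 (le_antisymm h4 (sq_nonneg _))
  have hF : ∀ m ≤ n + 1, P.α * ratioB ρ h * coefDD ρ h r (m : ℕ) + P.β * coefD ρ h r (m : ℕ)
      = 0 := by
    intro m hm'
    have := hrow m hm'
    rw [he m hm', sub_zero, eq_comm, mul_eq_zero] at this
    have := this.resolve_left hg.ne'
    linarith
  have hε := H.abs_second_le hh ha0 ha (M := 0) (S := 0) (S' := 0) (b := ratioB ρ h) hα
    (by linarith) hβ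
    (fun m hm' => by rw [he m hm', abs_zero]) (by simp) le_rfl
    (by rw [hF 0 (by omega), abs_zero]) (by rw [hF (n + 1) le_rfl, abs_zero])
  have hε0 : ∀ m ≤ n + 1, coefDD ρ h r (m : ℕ) = 0 := by
    intro m hm'
    have := hε m hm'
    norm_num at this
    exact this
  have hr0 : ∀ m ≤ n + 1, r (m : ℕ) = 0 := by
    intro m hm'
    have := he m hm'
    rw [nodal_eq hρ hh h1', hε0 m hm', mul_zero, add_zero] at this
    exact (mul_eq_zero.1 this).resolve_left (one_add_two_eta_pos hρ hh h1').ne'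
  have hη := (eta_pos hρ hh h1').ne'
  intro m hm0 hm1
  rcases eq_or_ne m (-1) with rfl | hne
  · have e0 := hr0 0 (by omega)
    have e1 := hr0 1 (by omega)
    rw [nodal] at hl
    simp only [Nat.cast_zero, Nat.cast_one] at e0 e1
    rw [zero_add, e0, e1, zero_sub] at hl
    exact (mul_eq_zero.1 (by linarith : eta ρ h * r (-1) = 0)).resolve_left hη
  rcases eq_or_ne m ((n + 1 : ℕ) + 1) with rfl | hne'
  · have e0 := hr0 n (by omega)
    have e1 := hr0 (n + 1) (by omega)
    rw [nodal, e1] at hr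
    have : ((n + 1 : ℕ) : ℤ) - 1 = n := by push_cast; ring
    rw [this, e0] at hr
    exact (mul_eq_zero.1 (by linarith : eta ρ h * r ((n + 1 : ℕ) + 1) = 0)).resolve_left hη
  · have := hr0 m.toNat (by omega)
    rwa [show ((m.toNat : ℕ) : ℤ) = m by omega] at this

/-! ### From nodal errors to uniform errors -/

lemma exists_cell {l r h x : ℝ} {n : ℕ} (hr : l + (n + 1 : ℕ) * h = r)
    (hx : x ∈ Icc l r) : ∃ j ≤ n, l + (j : ℕ) * h ≤ x ∧ x ≤ l + (j + 1 : ℕ) * h := by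
  induction n generalizing r with
  | zero => exact ⟨0, le_rfl, by simpa using hx.1, by rw [hr]; exact hx.2⟩
  | succ n ih =>
    rcases le_total x (l + (n + 1 : ℕ) * h) with h1 | h1
    · obtain ⟨j, hj, h2⟩ := ih rfl ⟨hx.1, h1⟩
      exact ⟨j, by omega, h2⟩
    · exact ⟨n + 1, le_rfl, h1, by rw [hr]; exact hx.2⟩

/-- Three contributions: linear interpolation of the exact values, a convex combination of nodal
errors, and the `bend` terms. The last involve `D` only through `D h²`, so `D` itself need not be
bounded uniformly in the mesh. -/
lemma abs_sub_approx_le (P : Problem) {ρ : ℝ} {n : ℕ} {F : ℕ → ℝ → ℝ} {r : ℤ → ℝ} {M B D : ℝ}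
    (hρ : 0 < ρ) (hh : 0 < P.hx (n + 1)) (h1 : ρ * P.hx (n + 1) ≤ 1)
    (hb : ratioB ρ (P.hx (n + 1)) ≤ 2) (hb0 : 0 ≤ ratioB ρ (P.hx (n + 1)))
    (hr : P.left + (n + 1 : ℕ) * P.hx (n + 1) = P.right)
    (hF : ∀ i < 2, ∀ x ∈ Icc P.left P.right,
      HasDerivWithinAt (F i) (F (i + 1) x) (Icc P.left P.right) x)
    (hB : ∀ x ∈ Icc P.left P.right, |F 2 x| ≤ B)
    (hM : ∀ m ≤ n + 1,
      |nodal ρ (P.hx (n + 1)) r (m : ℕ) - F 0 (P.left + (m : ℕ) * P.hx (n + 1))| ≤ M)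
    (hD : ∀ m ≤ n + 1, |coefDD ρ (P.hx (n + 1)) r (m : ℕ)| ≤ D) {x : ℝ}
    (hx : x ∈ Icc P.left P.right) :
    |F 0 x - P.approx ρ (n + 1) r x| ≤
      M + B * P.hx (n + 1) ^ 2 + 4 * D * P.hx (n + 1) ^ 2 := by
  set h := P.hx (n + 1) with hhd
  obtain ⟨j, hj, hx0, hx1⟩ := exists_cell hr hx
  have c1 : ((j + 1 : ℕ) : ℤ) = (j : ℤ) + 1 := by push_cast; ring
  have n0 : node P.left h j = P.left + (j : ℕ) * h := by simp [node]
  have n1 : node P.left h ((j : ℤ) + 1) = P.left + (j + 1 : ℕ) * h := by simp [node]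
  have happ : P.approx ρ (n + 1) r x = cellForm ρ h (nodal ρ h r j) (nodal ρ h r (j + 1))
      (nodalDD ρ h r j) (nodalDD ρ h r (j + 1)) (x - node P.left h j) :=
    sum_expBSpline_eq hρ hh h1 r (by omega) (by push_cast; omega) (by rwa [n0]) (by rwa [n1])
  set y := x - node P.left h j with hy
  have y0 : 0 ≤ y := by rw [hy, n0]; linarith
  have yh : y ≤ h := by rw [hy, n0]; push_cast at hx1; linarith
  have hmem : ∀ i ≤ n + 1, P.left + (i : ℕ) * h ∈ Icc P.left P.right := fun i hi => by
    have : (i : ℝ) ≤ (n + 1 : ℕ) := by exact_mod_cast hi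
    refine ⟨by nlinarith [(Nat.cast_nonneg i : (0 : ℝ) ≤ i)], ?_⟩
    rw [← hr]; nlinarith
  have B0 : 0 ≤ B := (abs_nonneg _).trans (hB x hx)
  have D0 : 0 ≤ D := (abs_nonneg _).trans (hD 0 (by omega))
  -- the two end points of the cell
  have T : ∀ z ∈ Icc P.left P.right, |z - x| ≤ h →
      |F 0 z - (F 0 x + F 1 x * (z - x))| ≤ B * h ^ 2 := by
    intro z hz hzx
    have := abs_sub_taylor_le (k := 2) hF hB hx hz
    simp only [Finset.sum_range_succ, Finset.sum_range_zero, Nat.factorial] at this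
    norm_num at this
    refine this.trans ?_
    rw [← sq_abs]
    gcongr
  set v₀ := F 0 (P.left + (j : ℕ) * h)
  set v₁ := F 0 (P.left + (j + 1 : ℕ) * h)
  have e0 : P.left + (j : ℕ) * h - x = -y := by rw [hy, n0]; ring
  have e1 : P.left + (j + 1 : ℕ) * h - x = h - y := by rw [hy, n0]; push_cast; ring
  have t0 := T _ (hmem j (by omega)) (by rw [e0, abs_neg, abs_of_nonneg y0]; exact yh)
  have t1 := T _ (hmem (j + 1) (by omega)) (by rw [e1, abs_of_nonneg (by linarith)]; linarith)
  rw [e0] at t0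
  rw [e1] at t1
  have m0 := hM j (by omega)
  have m1 := hM (j + 1) (by omega)
  have w0 : 0 ≤ y / h := by positivity
  have w1 : 0 ≤ 1 - y / h := by rw [sub_nonneg, div_le_one hh]; exact yh
  have hcombo : ∀ p q C : ℝ, |p| ≤ C → |q| ≤ C → |(1 - y / h) * p + y / h * q| ≤ C := by
    intro p q C hp hq
    calc |(1 - y / h) * p + y / h * q| ≤ |(1 - y / h) * p| + |y / h * q| := abs_add_le _ _
      _ = (1 - y / h) * |p| + y / h * |q| := by
        rw [abs_mul, abs_mul, abs_of_nonneg w0, abs_of_nonneg w1]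
      _ ≤ (1 - y / h) * C + y / h * C := by gcongr
      _ = C := by ring
  have q1 := hcombo _ _ _ t0 t1
  have q2 := hcombo _ _ _ m0 m1
  have hdd : ∀ m ≤ n + 1, |nodalDD ρ h r (m : ℕ)| ≤ 2 * D := fun m hm => by
    rw [nodalDD_eq hρ hh h1, abs_mul, abs_of_nonneg hb0]
    have := hD m hm
    gcongr
  have q3 : |nodalDD ρ h r j * bend ρ h (h - y)| ≤ 2 * D * h ^ 2 := by
    rw [abs_mul]
    have := hdd j (by omega)
    have := abs_bend_le hρ hh h1 (y := h - y) (by linarith) (by linarith)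
    gcongr
  have q4 : |nodalDD ρ h r (j + 1) * bend ρ h y| ≤ 2 * D * h ^ 2 := by
    rw [abs_mul]
    have := hdd (j + 1) (by omega)
    rw [c1] at this
    have := abs_bend_le hρ hh h1 (y := y) y0 yh
    gcongr
  rw [c1] at q2
  have expand : F 0 x - P.approx ρ (n + 1) r x =
      -((1 - y / h) * (v₀ - (F 0 x + F 1 x * -y)) + y / h * (v₁ - (F 0 x + F 1 x * (h - y))))
      + (v₀ * (1 - y / h) + v₁ * (y / h) - (nodal ρ h r j * (1 - y / h)
        + nodal ρ h r (j + 1) * (y / h)))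
      - nodalDD ρ h r j * bend ρ h (h - y) - nodalDD ρ h r (j + 1) * bend ρ h y := by
    rw [happ, cellForm]
    field_simp
    ring
  have q2' : |v₀ * (1 - y / h) + v₁ * (y / h) - (nodal ρ h r j * (1 - y / h)
        + nodal ρ h r (j + 1) * (y / h))| ≤ M := by
    rw [← abs_neg]
    refine le_trans (le_of_eq ?_) q2
    congr 1
    ring
  rw [expand]
  rw [abs_le] at q1 q2' q3 q4 ⊢
  constructor <;> linarith [q1.1, q1.2, q2'.1, q2'.2, q3.1, q3.2, q4.1, q4.2]

/-! ### Convergence -/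

/-- The error of the nodal values at a time level. -/
noncomputable def Problem.nodalError (P : Problem) (ρ : ℝ) (u : ℝ → ℝ → ℝ) (N K : ℕ)
    (R : ℕ → ℤ → ℝ) (j i : ℕ) : ℝ :=
  nodal ρ (P.hx N) (R j) i - u (P.left + i * P.hx N) (P.time K j)

/-- The error of the second differences of the coefficients at a time level. -/
noncomputable def Problem.secondError (P : Problem) (ρ : ℝ) (u : ℝ → ℝ → ℝ) (N K : ℕ)
    (R : ℕ → ℤ → ℝ) (j i : ℕ) : ℝ :=
  coefDD ρ (P.hx N) (R j) i -
    iteratedDerivWithin 2 (fun y => u y (P.time K j)) (Icc P.left P.right)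
      (P.left + i * P.hx N)

section
variable {P : Problem} {ρ : ℝ} {u : ℝ → ℝ → ℝ} {n K : ℕ} {R : ℕ → ℤ → ℝ} {B C : ℝ}

lemma add_mul_hx (n : ℕ) : P.left + (n + 1 : ℕ) * P.hx (n + 1) = P.right := by
  unfold Problem.hx
  field_simp
  ring

lemma hx_pos (hdom : P.left < P.right) (n : ℕ) : 0 < P.hx (n + 1) :=
  div_pos (by linarith) (by positivity)

lemma node_mem (hdom : P.left < P.right) {m : ℕ} (hm : m ≤ n + 1) :
    P.left + m * P.hx (n + 1) ∈ Icc P.left P.right := by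
  have hh := hx_pos hdom n
  have : (m : ℝ) ≤ (n + 1 : ℕ) := by exact_mod_cast hm
  refine ⟨by nlinarith [(Nat.cast_nonneg m : (0 : ℝ) ≤ m)], ?_⟩
  rw [← add_mul_hx n]; nlinarith

lemma ht_pos (hT : 0 < P.T) (hK : 1 ≤ K) : 0 < P.ht K :=
  div_pos hT (by exact_mod_cast hK)

lemma time_mem (hT : 0 < P.T) (hK : 1 ≤ K) {j : ℕ} (hj : j ≤ K) : P.time K j ∈ Icc 0 P.T := by
  have hh := ht_pos hT hK
  have h1 : (j : ℝ) ≤ K := by exact_mod_cast hj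
  have hK0 : (K : ℝ) ≠ 0 := by positivity
  refine ⟨mul_nonneg (Nat.cast_nonneg j) hh.le, ?_⟩
  have : (K : ℝ) * P.ht K = P.T := by unfold Problem.ht; field_simp
  calc P.time K j = j * P.ht K := rfl
    _ ≤ K * P.ht K := by gcongr
    _ = P.T := this

lemma gammaT_pos (hT : 0 < P.T) (hK : 1 ≤ K) (hμ₁ : P.μ < 1) : 0 < P.gammaT K :=
  mul_pos (Real.Gamma_pos_of_pos (by linarith)) (Real.rpow_pos_of_pos (ht_pos hT hK) _)

lemma space_derivs (hdom : P.left < P.right) (hux : ContDiffInSpace 4 u P.left P.right P.T)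
    {t : ℝ} (ht : t ∈ Icc 0 P.T) : ∀ i < 4, ∀ x ∈ Icc P.left P.right,
      HasDerivWithinAt (iteratedDerivWithin i (fun y => u y t) (Icc P.left P.right))
        (iteratedDerivWithin (i + 1) (fun y => u y t) (Icc P.left P.right) x)
        (Icc P.left P.right) x :=
  fun _ hi _ hx => hasDerivWithinAt_iteratedDerivWithin_Icc hdom (hux.1 t ht) hi hx

/-- The spline relations of the errors at a time level. -/
lemma exists_error_relations (hdom : P.left < P.right) (hρ : 0 < ρ)
    (h1 : ρ * P.hx (n + 1) ≤ 1) (hux : ContDiffInSpace 4 u P.left P.right P.T)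
    (hB : ∀ i ≤ 4, ∀ p ∈ Icc P.left P.right ×ˢ Icc 0 P.T,
      |iteratedDerivWithin i (fun y => u y p.2) (Icc P.left P.right) p.1| ≤ B)
    {j : ℕ} (hj : P.time K j ∈ Icc 0 P.T) :
    ∃ p σ : ℕ → ℝ, SplineRelations n (ratioA ρ (P.hx (n + 1))) (P.hx (n + 1))
        (P.nodalError ρ u (n + 1) K R j) (P.secondError ρ u (n + 1) K R j)
        (fun m => coefD ρ (P.hx (n + 1)) (R j) m - p m) σ ∧
      (∀ i < n, |σ (i + 1)| ≤ 3 * B * P.hx (n + 1) ^ 2) ∧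
      ∀ m ≤ n + 1, |p m - iteratedDerivWithin 1 (fun y => u y (P.time K j))
        (Icc P.left P.right) (P.left + m * P.hx (n + 1))| ≤ 2 * B * P.hx (n + 1) ^ 2 := by
  have hh := hx_pos hdom n
  obtain ⟨p, σ, H, h2, h3⟩ := exists_splineRelations_sample hh (ratioA_nonneg hρ hh h1)
    (ratioA_le hρ hh h1) (add_mul_hx n)
    (F := fun i => iteratedDerivWithin i (fun y => u y (P.time K j)) (Icc P.left P.right))
    (space_derivs hdom hux hj) (fun i hi x hx => hB i hi (x, P.time K j) ⟨hx, hj⟩)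
  have H' := (splineRelations_coef hρ hh h1 (R j) n).sub H
  refine ⟨p, fun i => 0 - σ i, ?_, fun i hi => ?_, h3⟩
  · simp only [iteratedDerivWithin_zero] at H'
    exact H'
  · have := h2 i hi
    rwa [← abs_neg, ← zero_sub] at this

/-- The error equation of one time step. -/
lemma exists_error_step (hdom : P.left < P.right) (hT : 0 < P.T) (hμ₁ : P.μ < 1) (hK : 1 ≤ K)
    (hα : 0 < P.α) (hρ : 0 < ρ) (h1 : ρ * P.hx (n + 1) ≤ 1) (hB0 : 0 ≤ B) (hC0 : 0 ≤ C)
    (hux : ContDiffInSpace 4 u P.left P.right P.T)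
    (hB : ∀ i ≤ 4, ∀ p ∈ Icc P.left P.right ×ˢ Icc 0 P.T,
      |iteratedDerivWithin i (fun y => u y p.2) (Icc P.left P.right) p.1| ≤ B)
    (hC : ∀ n : ℕ, ∀ x ∈ Icc P.left P.right, ∀ t ∈ Ioc 0 P.T,
      |l1Approx P.μ (u x) n t - P.rhs u x t| ≤ C * (t / (n + 1 : ℕ)) ^ (2 - P.μ))
    (hR : P.IsDiscreteSolution ρ (n + 1) K R) {j : ℕ} (hj : j < K) {G : ℝ}
    (hG : G = (P.α * ρ ^ 2 * B + 2 * |P.β| * B + 3 * B) * P.hx (n + 1) ^ 2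
      + C * P.ht K ^ (2 - P.μ)) :
    ∃ p σ τ : ℕ → ℝ, SplineRelations n (ratioA ρ (P.hx (n + 1))) (P.hx (n + 1))
        (P.nodalError ρ u (n + 1) K R (j + 1)) (P.secondError ρ u (n + 1) K R (j + 1)) p σ ∧
      (∀ i < n, |σ (i + 1)| ≤ G) ∧ (∀ m ≤ n + 1, |τ m| ≤ G) ∧
      ∀ m ≤ n + 1, P.nodalError ρ u (n + 1) K R (j + 1) m
          - l1History P.μ (fun i => P.nodalError ρ u (n + 1) K R i m) j =
        P.gammaT K * (P.α * ratioB ρ (P.hx (n + 1)) * P.secondError ρ u (n + 1) K R (j + 1) m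
          + P.β * p m - P.γ * P.nodalError ρ u (n + 1) K R (j + 1) m + τ m) := by
  have hh := hx_pos hdom n
  have hht := ht_pos hT hK
  have htm := time_mem hT hK (show j + 1 ≤ K by omega)
  have ht0 : 0 < P.time K (j + 1) := mul_pos (by positivity) hht
  have htime : P.time K (j + 1) / (j + 1 : ℕ) = P.ht K := by
    unfold Problem.time; field_simp
  obtain ⟨p, σ, H, h2, h3⟩ := exists_error_relations (K := K) (R := R) hdom hρ h1 hux hB htm
  have hb := abs_ratioB_sub_one_le hρ hh h1
  set h := P.hx (n + 1) with hhd
  set b := ratioB ρ h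
  set t := P.time K (j + 1) with htd
  set w : ℕ → ℝ := fun m => iteratedDerivWithin 2 (fun y => u y t) (Icc P.left P.right)
    (P.left + m * h) with hw
  set d : ℕ → ℝ := fun m => iteratedDerivWithin 1 (fun y => u y t) (Icc P.left P.right)
    (P.left + m * h) with hd
  set l : ℕ → ℝ := fun m => l1Approx P.μ (u (P.left + m * h)) j t
    - P.rhs u (P.left + m * h) t with hl
  have p1 : 0 ≤ P.α * ρ ^ 2 * B * h ^ 2 := by positivity
  have p2 : 0 ≤ 2 * |P.β| * B * h ^ 2 := by positivity
  have p3 : 0 ≤ 3 * B * h ^ 2 := by positivity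
  have p4 : 0 ≤ C * P.ht K ^ (2 - P.μ) := mul_nonneg hC0 (Real.rpow_nonneg hht.le _)
  -- The source collects the deviation of `b` from `1`, the slope error of the samples and the L1
  -- residual: the terms `α ρ² B`, `2 |β| B` and `C` of `G`. The remaining `3 B` covers the defect
  -- `σ`.
  refine ⟨_, σ, fun m => P.α * ((b - 1) * w m) + P.β * (p m - d m) - l m, H,
    fun i hi => (h2 i hi).trans (by rw [hG]; linarith), fun m hm => ?_, fun m hm => ?_⟩
  · have k1 : |P.α * ((b - 1) * w m)| ≤ P.α * (ρ ^ 2 * h ^ 2 * B) := by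
      rw [abs_mul, abs_mul, abs_of_pos hα]
      have := hB 2 (by norm_num) (P.left + m * h, t) ⟨node_mem hdom hm, htm⟩
      gcongr
    have k2 : |P.β * (p m - d m)| ≤ |P.β| * (2 * B * h ^ 2) := by
      rw [abs_mul]
      have := h3 m hm
      gcongr
    have k3 : |l m| ≤ C * P.ht K ^ (2 - P.μ) := by
      have := hC j _ (node_mem hdom hm) t ⟨ht0, htm.2⟩
      rwa [htime] at this
    rw [hG]
    rw [abs_le] at k1 k2 k3 ⊢
    constructor <;> linarith [k1.1, k1.2, k2.1, k2.2, k3.1, k3.2]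
  · have hg := (gammaT_pos hT hK hμ₁).ne'
    have s1 := hR.step j hj m (by omega) (by omega)
    rw [chi_row_eq P hρ K hh h1] at s1
    have e1 : P.xNode (n + 1) m = P.left + m * h := by
      simp [Problem.xNode, node, hhd]
    have s2 : nodal ρ h (R j) m - ∑ k ∈ Finset.Icc 1 j, l1Weight P.μ k *
        (nodal ρ h (R (j - k + 1)) m - nodal ρ h (R (j - k)) m) =
        l1History P.μ (fun i => nodal ρ h (R i) m) j := rfl
    rw [s2, e1] at s1
    -- `l1Approx` with index `j` divides `[0, t_{j+1}]` into `j + 1` steps, so its step is the time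
    -- step of the scheme.
    have s3 : P.gammaT K * l1Approx P.μ (u (P.left + m * h)) j t = u (P.left + m * h) t
        - l1History P.μ (fun i => u (P.left + m * h) (P.time K i)) j := by
      unfold l1Approx
      rw [htime]
      exact mul_div_cancel₀ _ hg
    have s4 : l1Approx P.μ (u (P.left + m * h)) j t = l m + (P.α * w m + P.β * d m
        - P.γ * u (P.left + m * h) t + P.ψ (P.left + m * h) t) := by
      simp only [hl, Problem.rhs, hw, hd]; ring
    rw [s4] at s3
    have s5 : l1History P.μ (fun i => P.nodalError ρ u (n + 1) K R i m) j =
        l1History P.μ (fun i => nodal ρ h (R i) m) j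
          - l1History P.μ (fun i => u (P.left + m * h) (P.time K i)) j := l1History_sub _ _ _
    rw [s5]
    have s6 : P.nodalError ρ u (n + 1) K R (j + 1) m = nodal ρ h (R (j + 1)) m
      - u (P.left + m * h) t := rfl
    have s7 : P.secondError ρ u (n + 1) K R (j + 1) m = coefDD ρ h (R (j + 1)) m - w m := rfl
    rw [s6, s7]
    linear_combination s1 + s3

/-- Since `h_t ^ μ (j + 1) ^ μ = t_{j+1} ^ μ ≤ T ^ μ`, the loss `1 / w_j` in the stability bound is
uniform in the number of time steps. -/
lemma gammaT_div_l1Weight_le (hT : 0 < P.T) (hμ₀ : 0 < P.μ) (hμ₁ : P.μ < 1) (hK : 1 ≤ K) {j : ℕ}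
    (hj : j < K) : P.gammaT K / l1Weight P.μ j ≤ Real.Gamma (2 - P.μ) / (1 - P.μ) * P.T ^ P.μ := by
  have hΓ : 0 < Real.Gamma (2 - P.μ) := Real.Gamma_pos_of_pos (by linarith)
  have hht := ht_pos hT hK
  have hj1 : (0 : ℝ) < (j : ℝ) + 1 := by positivity
  have hμ' : 0 < 1 - P.μ := by linarith
  have hp : 0 < ((j : ℝ) + 1) ^ P.μ := Real.rpow_pos_of_pos hj1 _
  have h2 : P.ht K ^ P.μ * ((j : ℝ) + 1) ^ P.μ ≤ P.T ^ P.μ := by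
    rw [← Real.mul_rpow hht.le hj1.le]
    refine Real.rpow_le_rpow (by positivity) ?_ hμ₀.le
    have := (time_mem hT hK (show j + 1 ≤ K by omega)).2
    unfold Problem.time at this
    push_cast at this
    linarith
  calc P.gammaT K / l1Weight P.μ j ≤ P.gammaT K / ((1 - P.μ) / ((j : ℝ) + 1) ^ P.μ) :=
        div_le_div_of_nonneg_left (gammaT_pos hT hK hμ₁).le (by positivity)
          (l1Weight_ge hμ₀ hμ₁ j)
    _ = Real.Gamma (2 - P.μ) / (1 - P.μ) * (P.ht K ^ P.μ * ((j : ℝ) + 1) ^ P.μ) := by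
        unfold Problem.gammaT; field_simp
    _ ≤ _ := by gcongr

/-- The constant of the nodal error estimate. -/
noncomputable def Problem.nodalConst (P : Problem) : ℝ :=
  √((P.right - P.left) * (2 * energyConst P.α P.β (P.right - P.left)
    * (Real.Gamma (2 - P.μ) / (1 - P.μ) * P.T ^ P.μ)))

/-- Conditions on the mesh width under which the scheme is analysed. -/
structure Problem.MeshCondition (P : Problem) (ρ h : ℝ) : Prop where
  tension : ρ * h ≤ 1 / 2
  energy : h ≤ energyMesh P.α P.β (P.right - P.left)
  convection : |P.β| * h ≤ P.α / 4

lemma ratioB_mem (hρ : 0 < ρ) {h : ℝ} (hh : 0 < h) (h1 : ρ * h ≤ 1 / 2) :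
    1 / 2 ≤ ratioB ρ h ∧ ratioB ρ h ≤ 2 := by
  have hbb := abs_le.1 (abs_ratioB_sub_one_le hρ hh (by linarith))
  have hq : ρ ^ 2 * h ^ 2 ≤ 1 / 4 := by
    have : 0 < ρ * h := by positivity
    nlinarith
  constructor <;> linarith [hbb.1, hbb.2]

/-! ### Initial and boundary errors, and the error bounds at the nodes -/

lemma nodalError_initial (hdom : P.left < P.right) (hu : P.IsSolution u)
    (hR : P.IsDiscreteSolution ρ (n + 1) K R) {m : ℕ} (hm : m ≤ n + 1) :
    P.nodalError ρ u (n + 1) K R 0 m = 0 := by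
  have h1 := hR.initial m (by omega) (by omega)
  have e1 : P.xNode (n + 1) m = P.left + m * P.hx (n + 1) := by simp [Problem.xNode, node]
  have e2 : P.time K 0 = 0 := by simp [Problem.time]
  rw [Problem.nodalError, h1, e1, e2, hu.initial _ (node_mem hdom hm), sub_self]

lemma nodalError_left (hT : 0 < P.T) (hK : 1 ≤ K) (hu : P.IsSolution u)
    (hR : P.IsDiscreteSolution ρ (n + 1) K R) {j : ℕ} (hj : j < K) :
    P.nodalError ρ u (n + 1) K R (j + 1) 0 = 0 := by
  have h1 := hR.boundary_left j hj
  have h2 := hu.boundary_left _ (time_mem hT hK (show j + 1 ≤ K by omega))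
  simp only [Problem.nodalError, nodal, Nat.cast_zero, zero_mul, add_zero, zero_sub, zero_add]
  rw [h2]
  linarith

lemma nodalError_right (hT : 0 < P.T) (hK : 1 ≤ K) (hu : P.IsSolution u)
    (hR : P.IsDiscreteSolution ρ (n + 1) K R) {j : ℕ} (hj : j < K) :
    P.nodalError ρ u (n + 1) K R (j + 1) (n + 1) = 0 := by
  have h1 := hR.boundary_right j hj
  have h2 := hu.boundary_right _ (time_mem hT hK (show j + 1 ≤ K by omega))
  rw [Problem.nodalError, add_mul_hx, nodal, h2]
  linarith

/-- Nodal errors are bounded by the consistency error. -/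
theorem abs_nodalError_le (hdom : P.left < P.right) (hT : 0 < P.T) (hμ₀ : 0 < P.μ)
    (hμ₁ : P.μ < 1) (hK : 1 ≤ K) (hα : 0 < P.α) (hγ : 0 < P.γ) (hρ : 0 < ρ)
    (hmesh : P.MeshCondition ρ (P.hx (n + 1))) (hB0 : 0 ≤ B) (hC0 : 0 ≤ C)
    (hu : P.IsSolution u) (hux : ContDiffInSpace 4 u P.left P.right P.T)
    (hB : ∀ i ≤ 4, ∀ p ∈ Icc P.left P.right ×ˢ Icc 0 P.T,
      |iteratedDerivWithin i (fun y => u y p.2) (Icc P.left P.right) p.1| ≤ B)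
    (hC : ∀ n : ℕ, ∀ x ∈ Icc P.left P.right, ∀ t ∈ Ioc 0 P.T,
      |l1Approx P.μ (u x) n t - P.rhs u x t| ≤ C * (t / (n + 1 : ℕ)) ^ (2 - P.μ))
    (hR : P.IsDiscreteSolution ρ (n + 1) K R) {G : ℝ}
    (hG : G = (P.α * ρ ^ 2 * B + 2 * |P.β| * B + 3 * B) * P.hx (n + 1) ^ 2
      + C * P.ht K ^ (2 - P.μ)) {j : ℕ} (hj : j ≤ K) {m : ℕ} (hm : m ≤ n + 1) :
    |P.nodalError ρ u (n + 1) K R j m| ≤ P.nodalConst * G := by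
  have hh := hx_pos hdom n
  have h1 : ρ * P.hx (n + 1) ≤ 1 := by linarith [hmesh.tension]
  have hht := ht_pos hT hK
  have hg := gammaT_pos hT hK hμ₁
  have G0 : 0 ≤ G := by
    rw [hG]
    have : 0 ≤ P.ht K ^ (2 - P.μ) := Real.rpow_nonneg hht.le _
    positivity
  have hL0 : 0 < P.right - P.left := by linarith
  have hL : P.right - P.left = (n + 1 : ℕ) * P.hx (n + 1) := by
    have := add_mul_hx (P := P) n; linarith
  have hE0 := energyConst_nonneg (β := P.β) hα hL0
  obtain ⟨hb1, hb2⟩ := ratioB_mem hρ hh hmesh.tension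
  rcases Nat.eq_zero_or_pos j with rfl | hj0
  · rw [nodalError_initial hdom hu hR hm, abs_zero]
    exact mul_nonneg (Real.sqrt_nonneg _) G0
  obtain ⟨i, rfl⟩ : ∃ i, j = i + 1 := ⟨j - 1, by omega⟩
  have hi : i < K := by omega
  have hev := energy_evolution (n := n) (h := P.hx (n + 1)) (K := energyWeight P.α P.β)
    (G := P.gammaT K * (energyConst P.α P.β (P.right - P.left) * G ^ 2)) hμ₀ hμ₁ hh
    (energyWeight_pos _ _).le (by positivity) (e := P.nodalError ρ u (n + 1) K R) (T := K)
    (fun m hm => nodalError_initial hdom hu hR hm) (fun k hk => by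
      obtain ⟨p, σ, τ, H, hσ, hτ, hstep⟩ := exists_error_step hdom hT hμ₁ hK hα hρ h1 hB0 hC0 hux
        hB hC hR hk hG
      have hist0 : ∀ m : ℕ, (∀ i ≤ K, P.nodalError ρ u (n + 1) K R i m = 0) →
          l1History P.μ (fun i => P.nodalError ρ u (n + 1) K R i m) k = 0 := by
        intro m hz
        rw [l1History, hz k hk.le]
        rw [Finset.sum_eq_zero, sub_zero]
        intro q hq
        have := Finset.mem_Icc.1 hq
        rw [hz _ (by omega), hz _ (by omega), sub_zero, mul_zero]
      refine energy_step (τ := τ) hα hγ.le hh hL hmesh.energy (ratioA_nonneg hρ hh h1)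
        (ratioA_le hρ hh h1) hb1 hb2 hg H (nodalError_left hT hK hu hR hk)
        (nodalError_right hT hK hu hR hk) (hist0 _ fun i hi => ?_) (hist0 _ fun i hi => ?_) hstep hσ hτ
      · rcases i with _ | i
        · exact nodalError_initial hdom hu hR (by omega)
        · exact nodalError_left hT hK hu hR (by omega)
      · rcases i with _ | i
        · exact nodalError_initial hdom hu hR le_rfl
        · exact nodalError_right hT hK hu hR (by omega))
    i hi
  have hgrad : gradForm n (P.hx (n + 1)) (P.nodalError ρ u (n + 1) K R (i + 1))
      (P.nodalError ρ u (n + 1) K R (i + 1)) ≤ 2 * energyConst P.α P.β (P.right - P.left)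
        * (Real.Gamma (2 - P.μ) / (1 - P.μ) * P.T ^ P.μ) * G ^ 2 := by
    have h3 := mul_nonneg (energyWeight_pos P.α P.β).le
      (massForm_self_nonneg (n := n) hh (P.nodalError ρ u (n + 1) K R (i + 1)))
    have h4 := gammaT_div_l1Weight_le hT hμ₀ hμ₁ hK hi
    have h5 : 2 * energyConst P.α P.β (P.right - P.left) * G ^ 2 *
        (P.gammaT K / l1Weight P.μ i) ≤ 2 * energyConst P.α P.β (P.right - P.left) * G ^ 2 *
        (Real.Gamma (2 - P.μ) / (1 - P.μ) * P.T ^ P.μ) := by gcongr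
    have h6 : 2 * (P.gammaT K * (energyConst P.α P.β (P.right - P.left) * G ^ 2)) /
        l1Weight P.μ i = 2 * energyConst P.α P.β (P.right - P.left) * G ^ 2 *
        (P.gammaT K / l1Weight P.μ i) := by ring
    rw [h6, energyForm] at hev
    linarith
  have hsq := sq_le_gradForm (n := n) hh (nodalError_left hT hK hu hR hi) hm
  rw [← hL] at hsq
  refine abs_le_of_sq_le_sq ?_ (mul_nonneg (Real.sqrt_nonneg _) G0)
  rw [mul_pow, Problem.nodalConst, Real.sq_sqrt]
  · calc _ ≤ _ := hsq
      _ ≤ (P.right - P.left) * (2 * energyConst P.α P.β (P.right - P.left)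
        * (Real.Gamma (2 - P.μ) / (1 - P.μ) * P.T ^ P.μ) * G ^ 2) := by gcongr
      _ = _ := by ring
  · have : 0 < Real.Gamma (2 - P.μ) := Real.Gamma_pos_of_pos (by linarith)
    have : 0 ≤ P.T ^ P.μ := Real.rpow_nonneg hT.le _
    have : 0 < 1 - P.μ := by linarith
    positivity

/-- The factor by which the errors of second differences exceed the consistency error. -/
noncomputable def Problem.secondConst (P : Problem) : ℝ :=
  3 * (5 / 3 * (4 * P.nodalConst + 1) + 2 / P.α * (1 + |P.β| * (2 * P.nodalConst)))

lemma nodalConst_nonneg : 0 ≤ P.nodalConst := Real.sqrt_nonneg _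

lemma secondConst_nonneg (hα : 0 < P.α) : 0 ≤ P.secondConst := by
  have := nodalConst_nonneg (P := P)
  unfold Problem.secondConst
  positivity

/-- Nodal errors of size `G` only allow second differences of size `G / h²`; the weight `h²` is the
one supplied by `bend`. The initial level is separate: there no equation is available at the ends,
but values are interpolated and end slopes prescribed. -/
theorem sq_mul_abs_secondError_le (hdom : P.left < P.right) (hT : 0 < P.T) (hμ₀ : 0 < P.μ)
    (hμ₁ : P.μ < 1) (hK : 1 ≤ K) (hα : 0 < P.α) (hγ : 0 < P.γ) (hρ : 0 < ρ)
    (hmesh : P.MeshCondition ρ (P.hx (n + 1))) (hB0 : 0 ≤ B) (hC0 : 0 ≤ C)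
    (hu : P.IsSolution u) (hux : ContDiffInSpace 4 u P.left P.right P.T)
    (hB : ∀ i ≤ 4, ∀ p ∈ Icc P.left P.right ×ˢ Icc 0 P.T,
      |iteratedDerivWithin i (fun y => u y p.2) (Icc P.left P.right) p.1| ≤ B)
    (hC : ∀ n : ℕ, ∀ x ∈ Icc P.left P.right, ∀ t ∈ Ioc 0 P.T,
      |l1Approx P.μ (u x) n t - P.rhs u x t| ≤ C * (t / (n + 1 : ℕ)) ^ (2 - P.μ))
    (hR : P.IsDiscreteSolution ρ (n + 1) K R) {G : ℝ}
    (hG : G = (P.α * ρ ^ 2 * B + 2 * |P.β| * B + 3 * B) * P.hx (n + 1) ^ 2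
      + C * P.ht K ^ (2 - P.μ)) {j : ℕ} (hj : j ≤ K) {m : ℕ} (hm : m ≤ n + 1) :
    P.hx (n + 1) ^ 2 * |P.secondError ρ u (n + 1) K R j m| ≤
      P.secondConst * G + 35 * B * P.hx (n + 1) ^ 2 := by
  have hh := hx_pos hdom n
  have h1 : ρ * P.hx (n + 1) ≤ 1 := by linarith [hmesh.tension]
  have hh1 : P.hx (n + 1) ≤ 1 := hmesh.energy.trans (min_le_left _ _)
  have hht := ht_pos hT hK
  have G0 : 0 ≤ G := by
    rw [hG]
    have : 0 ≤ P.ht K ^ (2 - P.μ) := Real.rpow_nonneg hht.le _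
    positivity
  have hQ := nodalConst_nonneg (P := P)
  have hS := secondConst_nonneg hα
  have hM : ∀ {j : ℕ}, j ≤ K → ∀ m ≤ n + 1, |P.nodalError ρ u (n + 1) K R j m| ≤
      P.nodalConst * G := fun hj m hm =>
    abs_nodalError_le hdom hT hμ₀ hμ₁ hK hα hγ hρ hmesh hB0 hC0 hu hux hB hC hR hG hj hm
  have ha0 := ratioA_nonneg hρ hh h1
  have ha := ratioA_le hρ hh h1
  obtain ⟨hb1, hb2⟩ := ratioB_mem hρ hh hmesh.tension
  set h := P.hx (n + 1) with hhd
  have hhh : h ^ 2 ≤ 1 := by nlinarith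
  rcases Nat.eq_zero_or_pos j with rfl | hj0
  · have e0 : P.time K 0 = 0 := by simp [Problem.time]
    have htm := time_mem hT hK (show 0 ≤ K by omega)
    obtain ⟨p, σ, H, h2, h3⟩ := exists_error_relations (K := K) (R := R) hdom hρ h1 hux hB htm
    have hz : ∀ x ∈ Icc P.left P.right, derivWithin P.z (Icc P.left P.right) x =
        iteratedDerivWithin 1 (fun y => u y (P.time K 0)) (Icc P.left P.right) x := by
      intro x hx
      rw [iteratedDerivWithin_one, e0]
      exact derivWithin_congr (fun y hy => (hu.initial y hy).symm) (hu.initial x hx).symm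
    have hDe := etaD_eq hρ hh h1
    have hBh : 2 * B * h ^ 2 = 2 * B * h * h := by ring
    have hl : |coefD ρ h (R 0) (0 : ℕ) - p 0| ≤ 2 * B * h * h := by
      have q : coefD ρ h (R 0) (0 : ℕ) = iteratedDerivWithin 1 (fun y => u y (P.time K 0))
          (Icc P.left P.right) (P.left + (0 : ℕ) * h) := by
        have := hR.initial_left
        rw [hz _ (left_mem_Icc.2 hdom.le), hDe] at this
        simp only [Nat.cast_zero, zero_mul, add_zero, coefD, zero_add, zero_sub]
        rw [← this]; ring
      rw [q, abs_sub_comm, ← hBh]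
      exact h3 0 (by omega)
    have hr : |coefD ρ h (R 0) (n + 1 : ℕ) - p (n + 1)| ≤ 2 * B * h * h := by
      have q : coefD ρ h (R 0) (n + 1 : ℕ) = iteratedDerivWithin 1 (fun y => u y (P.time K 0))
          (Icc P.left P.right) (P.left + (n + 1 : ℕ) * h) := by
        have := hR.initial_right
        rw [hz _ (right_mem_Icc.2 hdom.le), hDe] at this
        rw [hhd, add_mul_hx, ← this, coefD]; ring
      rw [q, abs_sub_comm, ← hBh]
      exact h3 _ le_rfl
    have hS3 : ∀ i < n, |σ (i + 1)| ≤ 3 * B := fun i hi => (h2 i hi).trans (by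
      have : 3 * B * h ^ 2 ≤ 3 * B * 1 := by gcongr
      linarith)
    have hr' : |coefD ρ h (R 0) (n + 1 : ℕ) - p (n + 1)| ≤ 2 * B * h := by
      refine hr.trans ?_
      have : 2 * B * h * h ≤ 2 * B * h * 1 := by gcongr
      linarith
    have hl' : |coefD ρ h (R 0) (0 : ℕ) - p 0| ≤ 2 * B * h := by
      refine hl.trans ?_
      have : 2 * B * h * h ≤ 2 * B * h * 1 := by gcongr
      linarith
    -- The constant is `3 (5/3 * 3 + 10/3 * 2) B = 35 B`; the slope errors `2 B h²` are weakened to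
    -- `2 B h`.
    have := H.abs_second_le_of_slopes hh ha0 ha (S := 3 * B) (S' := 2 * B)
      (fun m hm => nodalError_initial hdom hu hR hm) hS3 (by positivity) hl' hr' m hm
    have k : h ^ 2 * |P.secondError ρ u (n + 1) K R 0 m| ≤ h ^ 2 * (35 * B) := by
      gcongr; linarith
    have : 0 ≤ P.secondConst * G := by positivity
    linarith
  · obtain ⟨i, rfl⟩ : ∃ i, j = i + 1 := ⟨j - 1, by omega⟩
    have hi : i < K := by omega
    obtain ⟨p, σ, τ, H, hσ, hτ, hstep⟩ := exists_error_step hdom hT hμ₁ hK hα hρ h1 hB0 hC0 hux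
      hB hC hR hi hG
    have hg := (gammaT_pos hT hK hμ₁).ne'
    have hbd : ∀ m ≤ n + 1, (∀ i ≤ K, P.nodalError ρ u (n + 1) K R i m = 0) →
        |P.α * ratioB ρ h * P.secondError ρ u (n + 1) K R (i + 1) m + P.β * p m| ≤ G := by
      intro m hm hz
      have hist0 : l1History P.μ (fun i => P.nodalError ρ u (n + 1) K R i m) i = 0 := by
        rw [l1History, hz i hi.le]
        rw [Finset.sum_eq_zero, sub_zero]
        intro q hq
        have := Finset.mem_Icc.1 hq
        rw [hz _ (by omega), hz _ (by omega), sub_zero, mul_zero]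
      have s := hstep m hm
      rw [hist0, hz (i + 1) (by omega), sub_zero, eq_comm, mul_eq_zero] at s
      have s := s.resolve_left hg
      have : P.α * ratioB ρ h * P.secondError ρ u (n + 1) K R (i + 1) m + P.β * p m = -τ m := by
        linarith
      rw [this, abs_neg]
      exact hτ m hm
    have hε := H.abs_second_le hh ha0 ha hα hb1 hmesh.convection (hM hj) hσ G0
      (hbd 0 (by omega) fun i hi => by
        rcases i with _ | i
        · exact nodalError_initial hdom hu hR (by omega)
        · exact nodalError_left hT hK hu hR (by omega))
      (hbd (n + 1) le_rfl fun i hi => by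
        rcases i with _ | i
        · exact nodalError_initial hdom hu hR le_rfl
        · exact nodalError_right hT hK hu hR (by omega)) m hm
    have k := mul_le_mul_of_nonneg_left hε (sq_nonneg h)
    refine k.trans ?_
    have e : h ^ 2 * (3 * (5 / 3 * (4 * (P.nodalConst * G) / h ^ 2 + G)
        + 2 / P.α * (G + |P.β| * (2 * (P.nodalConst * G) / h)))) =
        3 * (5 / 3 * (4 * (P.nodalConst * G) + h ^ 2 * G)
          + 2 / P.α * (h ^ 2 * G + h * (|P.β| * (2 * (P.nodalConst * G))))) := by
      field_simp
    rw [e]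
    have g1 : h ^ 2 * G ≤ 1 * G := by gcongr
    have g2 : h * (|P.β| * (2 * (P.nodalConst * G))) ≤ 1 * (|P.β| * (2 * (P.nodalConst * G))) := by
      gcongr
    have g3 : 2 / P.α * (h ^ 2 * G + h * (|P.β| * (2 * (P.nodalConst * G)))) ≤
        2 / P.α * (1 * G + 1 * (|P.β| * (2 * (P.nodalConst * G)))) := by gcongr
    have g4 : 0 ≤ 35 * B * h ^ 2 := by positivity
    have e2 : P.secondConst * G = 3 * (5 / 3 * (4 * (P.nodalConst * G) + 1 * G)
        + 2 / P.α * (1 * G + 1 * (|P.β| * (2 * (P.nodalConst * G))))) := by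
      unfold Problem.secondConst; ring
    rw [e2]
    linarith

/-- The scheme is solvable. -/
theorem exists_isDiscreteSolution (hdom : P.left < P.right) (hT : 0 < P.T)
    (hμ₁ : P.μ < 1) (hK : 1 ≤ K) (hα : 0 < P.α) (hγ : 0 < P.γ) (hρ : 0 < ρ)
    (hmesh : P.MeshCondition ρ (P.hx (n + 1))) :
    ∃ R : ℕ → ℤ → ℝ, P.IsDiscreteSolution ρ (n + 1) K R := by
  have hh := hx_pos hdom n
  have h1 : ρ * P.hx (n + 1) ≤ 1 := by linarith [hmesh.tension]
  have hg := gammaT_pos hT hK hμ₁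
  have hL : P.right - P.left = (n + 1 : ℕ) * P.hx (n + 1) := by
    have := add_mul_hx (P := P) n; linarith
  set h := P.hx (n + 1) with hhd
  -- the initial coefficients
  obtain ⟨r₀, hr₀l, hr₀r, hr₀⟩ := exists_tridiagonal_solution (N := n + 1) (-etaD ρ h) 0 (etaD ρ h)
    (eta ρ h) 1 (eta ρ h) (fun r hl hr hm => by
      refine initial_system_injective hρ hh h1 (by omega) r ?_ ?_ fun m h0 h1 => ?_
      · rw [zero_sub, zero_add] at hl; linarith
      · linarith
      · rw [nodal, ← hm m h0 h1]; ring)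
    (derivWithin P.z (Icc P.left P.right) P.left) (derivWithin P.z (Icc P.left P.right) P.right)
    (fun m => P.z (P.xNode (n + 1) m))
  -- Levels are built one at a time. The history of a step reads only levels already fixed, so
  -- overwriting later ones preserves the equations obtained before.
  have hstep : ∀ k : ℕ, ∃ R : ℕ → ℤ → ℝ, R 0 = r₀ ∧ ∀ j < k,
      (∀ m : ℤ, 0 ≤ m → m ≤ (n + 1 : ℕ) →
        P.chi1 ρ (n + 1) K * R (j + 1) (m - 1) + P.chi2 ρ (n + 1) K * R (j + 1) m
          + P.chi3 ρ (n + 1) K * R (j + 1) (m + 1) =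
        l1History P.μ (fun i => nodal ρ h (R i) m) j
          + P.gammaT K * P.ψ (P.xNode (n + 1) m) (P.time K (j + 1))) ∧
      eta ρ h * R (j + 1) (0 - 1) + 1 * R (j + 1) 0 + eta ρ h * R (j + 1) (0 + 1) =
        P.H (P.time K (j + 1)) ∧
      eta ρ h * R (j + 1) ((n + 1 : ℕ) - 1) + 1 * R (j + 1) (n + 1 : ℕ)
        + eta ρ h * R (j + 1) ((n + 1 : ℕ) + 1) = P.G (P.time K (j + 1)) := by
    intro k
    induction k with
    | zero => exact ⟨fun _ => r₀, rfl, fun j hj => absurd hj (by omega)⟩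
    | succ k ih =>
      obtain ⟨R, hR0, hR⟩ := ih
      obtain ⟨r, hrl, hrr, hrm⟩ := exists_tridiagonal_solution (N := n + 1) (eta ρ h) 1 (eta ρ h)
        (P.chi1 ρ (n + 1) K) (P.chi2 ρ (n + 1) K) (P.chi3 ρ (n + 1) K) (fun r hl hr hm =>
          step_system_injective P hα hγ hρ hg hh hmesh.tension hL hmesh.energy hmesh.convection r
            (by rw [nodal, ← hl, one_mul]) (by rw [nodal, ← hr, one_mul]) hm)
        (P.H (P.time K (k + 1))) (P.G (P.time K (k + 1)))
        (fun m => l1History P.μ (fun i => nodal ρ h (R i) m) k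
          + P.gammaT K * P.ψ (P.xNode (n + 1) m) (P.time K (k + 1)))
      set R' : ℕ → ℤ → ℝ := fun i => if i ≤ k then R i else r with hR'
      have hle : ∀ i ≤ k, R' i = R i := fun i hi => if_pos hi
      have hlast : R' (k + 1) = r := if_neg (by omega)
      have hhist : ∀ j ≤ k, ∀ m, l1History P.μ (fun i => nodal ρ h (R' i) m) j =
          l1History P.μ (fun i => nodal ρ h (R i) m) j := by
        intro j hj m
        simp only [l1History]
        rw [hle j hj]
        congr 1
        refine Finset.sum_congr rfl fun q hq => ?_
        have := Finset.mem_Icc.1 hq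
        rw [hle (j - q + 1) (by omega), hle (j - q) (by omega)]
      refine ⟨R', by rw [hle 0 (by omega), hR0], fun j hj => ?_⟩
      rcases Nat.lt_succ_iff_lt_or_eq.1 hj with hj | rfl
      · rw [hle (j + 1) (by omega)]
        refine ⟨fun m h0 hm => ?_, (hR j hj).2⟩
        rw [hhist j hj.le]
        exact (hR j hj).1 m h0 hm
      · rw [hlast]
        refine ⟨fun m h0 hm => ?_, hrl, hrr⟩
        rw [hhist j le_rfl]
        exact hrm m h0 hm
  obtain ⟨R, hR0, hR⟩ := hstep K
  refine ⟨R, ?_, ?_, ?_, ?_, ?_, ?_⟩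
  · intro m h0 hm
    rw [hR0, nodal, ← hr₀ m h0 hm]; ring
  · rw [hR0, ← hr₀l, zero_sub, zero_add]; ring
  · rw [hR0, ← hr₀r]; ring
  · intro j hj m h0 hm
    rw [(hR j hj).1 m h0 hm]
    rfl
  · intro j hj
    rw [← (hR j hj).2.1, zero_sub, zero_add]; ring
  · intro j hj
    rw [← (hR j hj).2.2]; ring

end

end TFBS

/-! ### The convergence theorem -/

theorem mainTheorem3 (P : TFBS.Problem) (ρ : ℝ) (u : ℝ → ℝ → ℝ)
    (hdom : P.left < P.right) (hT : 0 < P.T) (hμ₀ : 0 < P.μ) (hμ₁ : P.μ < 1)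
    (hα : 0 < P.α) (hγ : 0 < P.γ) (hρ : 0 < ρ)
    (hu : P.IsSolution u)
    (hux : TFBS.ContDiffInSpace 4 u P.left P.right P.T)
    (hut : TFBS.ContDiffInTime 2 u P.left P.right P.T)
    (hψ : TFBS.ContDiffInSpace 2 P.ψ P.left P.right P.T) :
    ∃ h₀ > 0, ∃ k₂ > 0, ∃ k₃ > 0, ∀ N K : ℕ, 1 ≤ N → 1 ≤ K → P.hx N ≤ h₀ →
      (∃ R : ℕ → ℤ → ℝ, P.IsDiscreteSolution ρ N K R) ∧
      ∀ R : ℕ → ℤ → ℝ, P.IsDiscreteSolution ρ N K R →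
        ∀ n ≤ K, ∀ x ∈ Set.Icc P.left P.right,
          |u x (P.time K n) - P.approx ρ N (R n) x| ≤
            k₂ * P.ht K ^ (2 - P.μ) + k₃ * P.hx N ^ 2 := by
  obtain ⟨B, hB0, hB⟩ := TFBS.exists_common_bound (isCompact_Icc.prod isCompact_Icc) 4 hux.2
  obtain ⟨C, hC0, hC⟩ := TFBS.exists_l1Approx_bound hdom hT hμ₀ hμ₁ hu hux hut hψ
  have hQ := TFBS.nodalConst_nonneg (P := P)
  have hS := TFBS.secondConst_nonneg hα
  set Q := P.nodalConst
  set S := P.secondConst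
  have hmesh0 := TFBS.energyMesh_pos (β := P.β) (L := P.right - P.left) hα
  -- The three minima give the three parts of `MeshCondition`. In `k₃`, `145 = 1 + 4 (1 + 35)`
  -- collects the Taylor term and the `bend` terms; the summands `+ 1` outside only ensure
  -- positivity.
  refine ⟨min (1 / (2 * ρ)) (min (TFBS.energyMesh P.α P.β (P.right - P.left))
      (P.α / (4 * (|P.β| + 1)))), by positivity,
    (Q + 4 * S) * C + 1, by positivity,
    (Q + 4 * S) * (P.α * ρ ^ 2 * B + 2 * |P.β| * B + 3 * B) + 145 * B + 1, by positivity, ?_⟩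
  intro N K hN hK hle
  obtain ⟨n, rfl⟩ : ∃ n, N = n + 1 := ⟨N - 1, by omega⟩
  have hh := TFBS.hx_pos hdom n
  have hmesh : P.MeshCondition ρ (P.hx (n + 1)) := by
    refine ⟨?_, hle.trans ((min_le_right _ _).trans (min_le_left _ _)), ?_⟩
    · have := hle.trans (min_le_left _ _)
      rw [le_div_iff₀ (by positivity)] at this
      linarith
    · have := hle.trans ((min_le_right _ _).trans (min_le_right _ _))
      rw [le_div_iff₀ (by positivity)] at this
      linarith
  refine ⟨TFBS.exists_isDiscreteSolution hdom hT hμ₁ hK hα hγ hρ hmesh, fun R hR j hj x hx => ?_⟩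
  have htm := TFBS.time_mem hT hK hj
  have h1 : ρ * P.hx (n + 1) ≤ 1 := by linarith [hmesh.tension]
  obtain ⟨hb1, hb2⟩ := TFBS.ratioB_mem hρ hh hmesh.tension
  obtain ⟨G, hG⟩ : ∃ G, G = (P.α * ρ ^ 2 * B + 2 * |P.β| * B + 3 * B) * P.hx (n + 1) ^ 2
      + C * P.ht K ^ (2 - P.μ) := ⟨_, rfl⟩
  -- The whole second differences of the discrete solution are bounded, not just their errors; the
  -- exact part adds only `B h²` after weighting.
  have hD : ∀ m ≤ n + 1, |TFBS.coefDD ρ (P.hx (n + 1)) (R j) (m : ℕ)| ≤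
      B + (S * G + 35 * B * P.hx (n + 1) ^ 2) / P.hx (n + 1) ^ 2 := by
    intro m hm
    have e1 := TFBS.sq_mul_abs_secondError_le hdom hT hμ₀ hμ₁ hK hα hγ hρ hmesh hB0 hC0 hu hux hB
      hC hR hG hj hm
    rw [mul_comm, ← le_div_iff₀ (by positivity)] at e1
    have e2 := hB 2 (by norm_num) (P.left + m * P.hx (n + 1), P.time K j)
      ⟨TFBS.node_mem hdom hm, htm⟩
    have e3 : TFBS.coefDD ρ (P.hx (n + 1)) (R j) (m : ℕ) =
        iteratedDerivWithin 2 (fun y => u y (P.time K j)) (Set.Icc P.left P.right)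
          (P.left + m * P.hx (n + 1)) + P.secondError ρ u (n + 1) K R j m := by
      unfold TFBS.Problem.secondError; ring
    rw [e3]
    exact (abs_add_le _ _).trans (add_le_add e2 e1)
  have key := TFBS.abs_sub_approx_le P (n := n) (r := R j)
    (F := fun i => iteratedDerivWithin i (fun y => u y (P.time K j)) (Set.Icc P.left P.right))
    (M := Q * G) (B := B) hρ hh h1 hb2 (by linarith) (TFBS.add_mul_hx n)
    (fun i hi => TFBS.space_derivs hdom hux htm i (by omega))
    (fun x hx => hB 2 (by norm_num) (x, P.time K j) ⟨hx, htm⟩)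
    (fun m hm => by
      rw [iteratedDerivWithin_zero]
      exact TFBS.abs_nodalError_le hdom hT hμ₀ hμ₁ hK hα hγ hρ hmesh hB0 hC0 hu hux hB hC hR hG hj
        hm) hD hx
  rw [iteratedDerivWithin_zero] at key
  refine key.trans ?_
  have e4 : 4 * (B + (S * G + 35 * B * P.hx (n + 1) ^ 2) / P.hx (n + 1) ^ 2) * P.hx (n + 1) ^ 2 =
      4 * B * P.hx (n + 1) ^ 2 + 4 * S * G + 140 * B * P.hx (n + 1) ^ 2 := by
    field_simp
    ring
  have p1 : 0 ≤ P.ht K ^ (2 - P.μ) := Real.rpow_nonneg (TFBS.ht_pos hT hK).le _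
  have p2 : 0 ≤ P.hx (n + 1) ^ 2 := sq_nonneg _
  rw [e4, hG]
  linarith
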